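/- Let $k\ge 1$ be an integer, $r>k$ real, $q=e^{\ell}$ with a fixed $\ell=\log q\in\mathbb C$, $\mathrm{Re}\,\ell<0$; put $q^a=e^{a\ell}$, $[a]=\frac{q^a-q^{-a}}{q-q^{-1}}$, $z=q^{2u}$, $\log z=2u\ell$, and, for $x\in\{r-k,r,k+2\}$, $$[u]_x=\vartheta_1\!\Big(\frac ux\Big|\tau_x\Big),\quad \tau_x=-\frac{\pi i}{x\ell},\quad \vartheta_1(u|\tau)=i\sum_{m\in\mathbb Z}(-1)^me^{\pi i(m-\frac12)^2\tau}e^{2\pi i(m-\frac12)u},\quad [n]_x!=\prod_{i=1}^n[i]_x .$$ Let $a_{j,m}$ ($j=0,1,2$, $m\in\mathbb Z\setminus\{0\}$), $P_j,Q_j$ be bosons with $[P_0,Q_0]=-i$, $[P_1,Q_1]=2(k+2)$, $[P_2,Q_2]=-2k$, $$[a_{0,m},a_{0,n}]=\tfrac{[2m][km][rm]}{m[(r-k)m]}\delta_{m+n,0},\quad [a_{1,m},a_{1,n}]=\tfrac{[2m][(k+2)m]}{m}\delta_{m+n,0},\quad [a_{2,m},a_{2,n}]=-\tfrac{[2m][km]}{m}\delta_{m+n,0},$$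 all other commutators being $0$. They act on the Fock modules $\mathcal F_p=\mathbb C[a_{j,-m}\,(m>0)]\,|p\rangle$, $p\in\mathbb C^3$, with $a_{j,m}|p\rangle=0$ for $m>0$, $P_j|p\rangle=p_j|p\rangle$, $e^{\alpha Q_j}$ shifting $p_j$ by $\alpha[P_j,Q_j]$. Put $$\phi_0(C|z)=\tfrac1C\sqrt{\tfrac{2kr}{r-k}}\,(iQ_0+P_0\log z)+\sum_{m\ne0}\tfrac{a_{0,m}}{[Cm]}z^{-m},\qquad \phi_0'(C|z)=\tfrac1C\sqrt{\tfrac{2k(r-k)}{r}}\,(iQ_0+P_0\log z)+\sum_{m\ne0}\tfrac{[(r-k)m]}{[rm]}\tfrac{a_{0,m}}{[Cm]}z^{-m},$$ $$\phi_j(C|z;\delta)=-\tfrac1C(Q_j+P_j\log z)+\sum_{m\neq0}\tfrac{a_{j,m}}{[Cm]}z^{-m}q^{\delta|m|},\qquad \phi_j^{(\pm)}(z;\delta)=\tfrac{P_j}{2}\log q+(q-q^{-1})\sum_{m>0}\tfrac{[m]}{[2m]}a_{j,\pm m}z^{\mp m}q^{\delta m}\qquad(j=1,2),$$ and let $:\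 :$ be the normal ordering ($a_{j,-m},Q_j$ to the left of $a_{j,m},P_j$, $m>0$). The currents are $$E(z)=\tfrac{1}{q-q^{-1}}:e^{-\phi_2(k|z;-\frac k2)-\phi_0(k|z)}\Big(e^{-\phi_2^{(+)}(z;\frac{k+2}2)-\phi_1^{(+)}(z;\frac k2)}-e^{\phi_2^{(-)}(z;\frac{k+2}2)+\phi_1^{(-)}(z;\frac k2)}\Big):,$$ $$F(z)=\tfrac{-1}{q-q^{-1}}:e^{\phi_2(k|z;\frac k2)+\phi_0'(k|z)}\Big(e^{-\phi_2^{(+)}(z;-\frac{k+2}2)+\phi_1^{(+)}(z;-\frac k2)}-e^{\phi_2^{(-)}(z;-\frac{k+2}2)-\phi_1^{(-)}(z;-\frac k2)}\Big):,$$ $$S(z)=\tfrac{-1}{q-q^{-1}}:e^{\phi_1(k+2|z;-\frac{k+2}2)}\Big(e^{\phi_2^{(+)}(z;\frac{k+2}2)+\phi_1^{(+)}(z;\frac k2)}-e^{-\phi_2^{(-)}(z;\frac{k+2}2)-\phi_1^{(-)}(z;\frac k2)}\Big):,$$ and with $\hat\Pi=\sqrt{\tfrac{2r(r-k)}k}P_0-\tfrac{r-k}kP_2$,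 $\hat\Pi'=\sqrt{\tfrac{2r(r-k)}k}P_0-\tfrac rkP_2$ the screening operators are, with contour $|z|=1$, $$Q_+=\oint\!\tfrac{dz}{2\pi iz}E(z)\tfrac{[u-\frac12+\hat\Pi]_{r-k}}{[u-\frac12]_{r-k}},\quad Q_-=\oint\!\tfrac{dz}{2\pi iz}F(z)\tfrac{[u+\frac12-\hat\Pi']_r}{[u+\frac12]_r},\quad Q=\oint\!\tfrac{dz}{2\pi iz}S(z)\tfrac{[u-\frac12+P_1]_{k+2}}{[u-\frac12]_{k+2}} .$$ These map $\mathcal F_p$ to a completed Fock module (the product of the homogeneous components for the degree $\deg a_{j,-m}=m$). Operators are composed by summing over the homogeneous components of the intermediate Fock modules; all identities below are between matrix elements on $\mathcal F_p$, $p$ arbitrary, and all contours are $|z_j|=1$ ($z_j=q^{2u_j}$). Products of the current $F$, which converge only for $|z_{i+1}|<|q|^2|z_i|$, are continued analytically to $|z_1|=\dots=|z_n|=1$ (off the poles $z_j=q^{2-2rm}z_i$, $i<j$, $m\ge 0$, and, for products of the integrand of $Q_-$, off the zeros of $[u_i+\frac12]_r$), and $Q_-^n$ denotes the $n$-fold integral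 of the so continued product of $n$ copies of the integrand of $Q_-$. For $Q_+$ and $Q$ the sums defining the composed powers $Q_+^n,Q^n$, and those defining the products of the currents $E$, $S$ on $|z_j|=1$, converge absolutely. Then for every $n\ge0$ (assuming for the first formula that $[1]_{r-k}\ne0$, i.e. $1/(r-k)\notin\mathbb Z$) $$Q_+^n=\frac{[n]_{r-k}!}{n!\,[1]_{r-k}^n}\oint\prod_{j=1}^n\frac{dz_j}{2\pi iz_j}\;E(z_n)\cdots E(z_1)\prod_{i<j}\frac{[u_i-u_j]_{r-k}}{[u_i-u_j-1]_{r-k}}\prod_{i=1}^n\frac{[u_i+\frac12+\hat\Pi-n]_{r-k}}{[u_i-\frac12]_{r-k}},$$ $$Q_-^n=\frac{[n]_r!}{n!\,[1]_r^n}\oint\prod_{j=1}^n\frac{dz_j}{2\pi iz_j}\;F(z_1)\cdots F(z_n)\prod_{i<j}\frac{[u_i-u_j]_r}{[u_i-u_j-1]_r}\prod_{i=1}^n\frac{[u_i-\frac12-\hat\Pi'+n]_r}{[u_i+\frac12]_r},$$ $$Q^n=\frac{[n]_{k+2}!}{n!\,[1]_{k+2}^n}\oint\prod_{j=1}^n\frac{dz_j}{2\pi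 iz_j}\;S(z_n)\cdots S(z_1)\prod_{i<j}\frac{[u_i-u_j]_{k+2}}{[u_i-u_j-1]_{k+2}}\prod_{i=1}^n\frac{[u_i+\frac12+P_1-n]_{k+2}}{[u_i-\frac12]_{k+2}} .$$ -/

import Mathlib

namespace QCoset

noncomputable section

/-- The parameters: the level `k`, the real number `r`, and a chosen logarithm `lq` of `q`
(so `q = exp lq`, and `q ^ a` means `exp (a * lq)`; `|q| < 1` is `lq.re < 0`). -/
structure Params where
  k : ℕ
  r : ℝ
  lq : ℂ

/-- `q ^ a`. -/
def qp (D : Params) (a : ℂ) : ℂ := Complex.exp (a * D.lq)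

/-- The `q`-number `[a] = (q^a - q^(-a)) / (q - q^(-1))` (not to be confused with `[u]_x`). -/
def br (D : Params) (a : ℝ) : ℂ := (qp D a - qp D (-a)) / (qp D 1 - qp D (-1))

/-- The multiplicative variable `z = q^(2u)`. -/
def zOf (D : Params) (u : ℂ) : ℂ := qp D (2 * u)

/-- `log z = 2 u log q`. -/
def logz (D : Params) (u : ℂ) : ℂ := 2 * u * D.lq

/-! ### Theta functions -/

/-- The Jacobi theta function `ϑ₁(u|τ)`. -/
def theta1 (u τ : ℂ) : ℂ :=
  Complex.I * ∑' n : ℤ, (-1 : ℂ) ^ n *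
    Complex.exp (Real.pi * Complex.I * ((n : ℂ) - 1 / 2) ^ 2 * τ) *
    Complex.exp (2 * Real.pi * Complex.I * ((n : ℂ) - 1 / 2) * u)

/-- `τ_x`, determined by `q^(2x) = exp (-2πi/τ_x)`, more precisely `2 x log q = -2πi/τ_x`. -/
def tau (D : Params) (x : ℝ) : ℂ := -(Real.pi * Complex.I) / (x * D.lq)

/-- `[u]_x = ϑ₁(u/x | τ_x)`. -/
def th (D : Params) (x : ℝ) (u : ℂ) : ℂ := theta1 (u / x) (tau D x)

/-- `[n]_x! = [1]_x [2]_x ⋯ [n]_x`. -/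
def thFact (D : Params) (x : ℝ) (n : ℕ) : ℂ := ∏ i ∈ Finset.range n, th D x ((i : ℂ) + 1)

/-- The prefactor `[n]_x! / (n! [1]_x^n)`. -/
def prefactor (D : Params) (x : ℝ) (n : ℕ) : ℂ :=
  thFact D x n / ((n.factorial : ℂ) * th D x 1 ^ n)

/-! ### Fock modules

The Fock module of momentum `p` (the eigenvalues of `P₀, P₁, P₂` on its highest weight vector) is
the polynomial ring in the creation operators `a_{j,-m}`, `j = 0, 1, 2`, `m > 0`.  On it `a_{j,-m}`
is multiplication by the variable `(j, m)` and `a_{j,m}` is `[a_{j,m}, a_{j,-m}]` times the partial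
derivative in that variable.  The underlying space does not depend on `p`.
For example, the highest weight vector `e^{J Q₁/(2(k+2)) + M Q₂/(2k)} e^{-i√2 α Q₀}|0⟩` has the
momentum `(-√2 α, J, -M)`. -/

/-- `(j, m)` is the label of the creation operator `a_{j,-m}`. -/
abbrev Idx := Fin 3 × ℕ+

/-- A Fock module. -/
abbrev Fock := MvPolynomial Idx ℂ

/-- The completion of a Fock module: the product of its homogeneous components. -/
abbrev CFock := MvPowerSeries Idx ℂ

/-- Momenta: eigenvalues of `(P₀, P₁, P₂)`. -/
abbrev Mom := Fin 3 → ℂ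

/-- The commutator `[a_{j,m}, a_{j,-m}]` for `m > 0`. -/
def comm (D : Params) (i : Idx) : ℂ :=
  let m : ℝ := (i.2 : ℕ)
  ![br D (2 * m) * br D (D.k * m) / m * (br D (D.r * m) / br D ((D.r - D.k) * m)),
    br D (2 * m) * br D ((D.k + 2) * m) / m,
    -(br D (2 * m) * br D (D.k * m) / m)] i.1

/-- The zero-mode commutators `[P_j, Q_j]`. -/
def zcomm (D : Params) : Fin 3 → ℂ := ![-Complex.I, 2 * ((D.k : ℂ) + 2), -(2 * (D.k : ℂ))]

/-- The degree `∑ m` of a monomial in the `a_{j,-m}`. -/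
def deg (n : Idx →₀ ℕ) : ℕ := n.sum fun i e => e * (i.2 : ℕ)

/-- The finite set of monomials of degree `d`. -/
def level (d : ℕ) : Finset (Idx →₀ ℕ) :=
  (((Finset.univ : Finset (Fin 3)) ×ˢ Finset.Icc (1 : ℕ+) d.succPNat).finsupp
    (fun _ => Finset.range (d + 1))).filter fun n => deg n = d

theorem mem_level (d : ℕ) (n : Idx →₀ ℕ) : n ∈ level d ↔ deg n = d := by
  unfold level
  rw [Finset.mem_filter, and_iff_right_iff_imp]
  intro h
  have key : ∀ i ∈ n.support, n i * (i.2 : ℕ) ≤ d := by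
    intro i hi
    rw [← h]
    exact Finset.single_le_sum (f := fun i : Idx => n i * (i.2 : ℕ))
      (fun _ _ => Nat.zero_le _) hi
  rw [Finset.mem_finsupp_iff]
  refine ⟨fun i hi => ?_, fun i _ => ?_⟩
  · have h1 := key i hi
    have h2 : 1 ≤ n i := Nat.one_le_iff_ne_zero.mpr (Finsupp.mem_support_iff.mp hi)
    have h3 : (i.2 : ℕ) ≤ d := le_trans (Nat.le_mul_of_pos_left _ h2) h1
    rw [Finset.mem_product, Finset.mem_Icc]
    refine ⟨Finset.mem_univ _, one_le, ?_⟩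
    rw [← PNat.coe_le_coe, Nat.succPNat_coe]
    exact le_trans h3 (Nat.le_succ d)
  · rw [Finset.mem_range]
    by_cases hi : i ∈ n.support
    · have h1 := key i hi
      have h2 : n i ≤ n i * (i.2 : ℕ) := Nat.le_mul_of_pos_right _ i.2.pos
      omega
    · rw [Finsupp.notMem_support_iff.mp hi]
      omega

/-- The component of degree `d` of an element of the completion. -/
def comp (d : ℕ) (ψ : CFock) : Fock :=
  ∑ n ∈ level d, MvPolynomial.monomial n (MvPowerSeries.coeff n ψ)

/-! ### Boson fields and normal ordered exponentials -/

/-- The modes `a_{j,m}` (`m ≠ 0`), `Q_j`, `P_j`. -/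
inductive Mode where
  | osc (j : Fin 3) (m : ℤ)
  | Q (j : Fin 3)
  | P (j : Fin 3)

/-- A boson field at a point: a formal (infinite) linear combination of modes, given by its
coefficients. -/
abbrev Field := Mode → ℂ

/-- `φ₀(A;B,C|z;δ)`. -/
def phi0 (D : Params) (A B C : ℝ) (u : ℂ) (δ : ℝ) : Field
  | .osc j m => if j = 0 ∧ m ≠ 0 then
      br D (A * m) / (br D (B * m) * br D (C * m)) * zOf D u ^ (-m) * qp D (δ * |(m : ℝ)|) else 0
  | .Q j => if j = 0 then
      A / (B * C) * (Real.sqrt (2 * D.k * D.r / (D.r - D.k)) : ℝ) * Complex.I else 0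
  | .P j => if j = 0 then
      A / (B * C) * (Real.sqrt (2 * D.k * D.r / (D.r - D.k)) : ℝ) * logz D u else 0

/-- `φ₀'(A;B,C|z;δ)`, in which `a'_{0,m} = [(r-k)m]/[rm] a_{0,m}`. -/
def phi0' (D : Params) (A B C : ℝ) (u : ℂ) (δ : ℝ) : Field
  | .osc j m => if j = 0 ∧ m ≠ 0 then
      br D (A * m) / (br D (B * m) * br D (C * m)) *
        (br D ((D.r - D.k) * m) / br D (D.r * m)) *
        zOf D u ^ (-m) * qp D (δ * |(m : ℝ)|) else 0
  | .Q j => if j = 0 then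
      A / (B * C) * (Real.sqrt (2 * D.k * (D.r - D.k) / D.r) : ℝ) * Complex.I else 0
  | .P j => if j = 0 then
      A / (B * C) * (Real.sqrt (2 * D.k * (D.r - D.k) / D.r) : ℝ) * logz D u else 0

/-- `φ_j(A;B,C|z;δ)` for `j = 1, 2`. -/
def phi (D : Params) (j : Fin 3) (A B C : ℝ) (u : ℂ) (δ : ℝ) : Field
  | .osc j' m => if j' = j ∧ m ≠ 0 then
      br D (A * m) / (br D (B * m) * br D (C * m)) * zOf D u ^ (-m) * qp D (δ * |(m : ℝ)|) else 0
  | .Q j' => if j' = j then -(A / (B * C) : ℂ) else 0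
  | .P j' => if j' = j then -(A / (B * C) : ℂ) * logz D u else 0

/-- `φ_j^{(+)}(A;B|z;C)` for `j = 1, 2`. -/
def phiP (D : Params) (j : Fin 3) (A B : ℝ) (u : ℂ) (C : ℝ) : Field
  | .osc j' m => if j' = j ∧ 0 < m then
      (qp D 1 - qp D (-1)) * (br D (A * m) / br D (B * m)) * zOf D u ^ (-m) * qp D (C * (m : ℝ))
      else 0
  | .Q _ => 0
  | .P j' => if j' = j then D.lq / 2 else 0

/-- `φ_j^{(-)}(A;B|z;C)` for `j = 1, 2`: the mode `a_{j,m}` with `m < 0` has the coefficient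
`(q - q⁻¹) [A|m|]/[B|m|] z^{|m|} q^{C|m|}`. -/
def phiM (D : Params) (j : Fin 3) (A B : ℝ) (u : ℂ) (C : ℝ) : Field
  | .osc j' m => if j' = j ∧ m < 0 then
      (qp D 1 - qp D (-1)) * (br D (A * -m) / br D (B * -m)) * zOf D u ^ (-m) *
        qp D (C * (-m : ℝ)) else 0
  | .Q _ => 0
  | .P j' => if j' = j then D.lq / 2 else 0

/-- The exponential of the annihilation part `∑ φ(a_{j,m}) a_{j,m}`, `m > 0`.  As `a_{j,m}` is
`comm (j, m)` times a partial derivative, the exponential is a translation of the variables. -/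
def expAnn (D : Params) (φ : Field) (v : Fock) : Fock :=
  MvPolynomial.aeval
    (fun i : Idx => (MvPolynomial.X i + MvPolynomial.C (φ (.osc i.1 i.2) * comm D i) : Fock)) v

/-- The exponential of the creation part `∑ φ(a_{j,-m}) a_{j,-m}`, `m > 0`, as a power series in
the commuting variables `a_{j,-m}`. -/
def expCre (φ : Field) : CFock :=
  fun n => n.prod fun i e => φ (.osc i.1 (-(i.2 : ℤ))) ^ e / (e.factorial : ℂ)

/-- The normal ordered exponential `:exp φ:` on the Fock module of momentum `p`: creation operators
and `Q_j` to the left of annihilation operators and `P_j`.  It maps into the completed Fock module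
of momentum `p + momShift D φ`. -/
def vop (D : Params) (φ : Field) (p : Mom) (v : Fock) : CFock :=
  Complex.exp (∑ j, φ (.P j) * p j) • (expCre φ * (expAnn D φ v : CFock))

/-- The change of the momentum under `exp (∑ φ(Q_j) Q_j)`. -/
def momShift (D : Params) (φ : Field) : Mom := fun j => φ (.Q j) * zcomm D j

/-! ### Currents -/

/-- A current of the form `coef · (:exp one(u): - :exp two(u):)`, with `z = q^(2u)`. -/
structure Current where
  coef : ℂ
  one : ℂ → Field
  two : ℂ → Field

/-- The action of a current on the Fock module of momentum `p`. -/
def Current.act (D : Params) (X : Current) (u : ℂ) (p : Mom) (v : Fock) : CFock :=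
  X.coef • (vop D (X.one u) p v - vop D (X.two u) p v)

/-- The change of momentum under a current (for the three currents below the `Q_j`-part is the same
in both exponentials and does not depend on `u`). -/
def Current.shift (D : Params) (X : Current) : Mom := momShift D (X.one 0)

/-- `E(z) = Ψ⁻(z) :exp(-φ₀(k|z)):`. -/
def curE (D : Params) : Current where
  coef := 1 / (qp D 1 - qp D (-1))
  one u := -phi D 2 1 1 D.k u (-D.k / 2)
    + (-phiP D 2 1 2 u ((D.k + 2) / 2) - phiP D 1 1 2 u (D.k / 2)) - phi0 D 1 1 D.k u 0
  two u := -phi D 2 1 1 D.k u (-D.k / 2)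
    + (phiM D 2 1 2 u ((D.k + 2) / 2) + phiM D 1 1 2 u (D.k / 2)) - phi0 D 1 1 D.k u 0

/-- `F(z) = Ψ⁺(z) :exp(φ₀'(k|z)):`. -/
def curF (D : Params) : Current where
  coef := -1 / (qp D 1 - qp D (-1))
  one u := phi D 2 1 1 D.k u (D.k / 2)
    + (-phiP D 2 1 2 u (-(D.k + 2) / 2) + phiP D 1 1 2 u (-D.k / 2)) + phi0' D 1 1 D.k u 0
  two u := phi D 2 1 1 D.k u (D.k / 2)
    + (phiM D 2 1 2 u (-(D.k + 2) / 2) - phiM D 1 1 2 u (-D.k / 2)) + phi0' D 1 1 D.k u 0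

/-- The screening current `S(z)`. -/
def curS (D : Params) : Current where
  coef := -1 / (qp D 1 - qp D (-1))
  one u := phi D 1 1 1 (D.k + 2) u (-(D.k + 2) / 2)
    + (phiP D 2 1 2 u ((D.k + 2) / 2) + phiP D 1 1 2 u (D.k / 2))
  two u := phi D 1 1 1 (D.k + 2) u (-(D.k + 2) / 2)
    + (-phiM D 2 1 2 u ((D.k + 2) / 2) - phiM D 1 1 2 u (D.k / 2))

/-! ### Products of operators -/

/-- An operator from the Fock modules (of arbitrary momentum) to completed Fock modules. -/
abbrev Op := Mom → Fock → CFock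

/-- `T₁ T₂ ⋯ T_l v` for `v` in the Fock module of momentum `p`, where every `T_i` changes the
momentum by `δ`.  An operator is applied to an element of a completed Fock module by summing over
the homogeneous components of that element. -/
def opProd (δ p : Mom) (v : Fock) : List Op → CFock
  | [] => (v : CFock)
  | T :: l => fun w =>
      ∑' d : ℕ, MvPowerSeries.coeff w (T (p + l.length • δ) (comp d (opProd δ p v l)))

/-- All the sums over homogeneous components in `T₁ T₂ ⋯ T_l v` converge absolutely. -/
def OpProdConverges (δ p : Mom) (v : Fock) : List Op → Prop
  | [] => True
  | T :: l => OpProdConverges δ p v l ∧ ∀ w : Idx →₀ ℕ, Summable fun d : ℕ =>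
      MvPowerSeries.coeff w (T (p + l.length • δ) (comp d (opProd δ p v l)))

/-! ### Contour integrals over `|z| = 1` -/

/-- The point of the contour with `z = exp(iθ)`. -/
def uOf (D : Params) (θ : ℝ) : ℂ := Complex.I * θ / (2 * D.lq)

/-- `∏_j ∮ dz_j/(2πi z_j) f`, all `z_j` on the unit circle. -/
def contourInt (D : Params) {n : ℕ} (f : (Fin n → ℂ) → ℂ) : ℂ :=
  ((2 * Real.pi : ℝ) : ℂ)⁻¹ ^ n *
    ∫ θ in Set.Icc (0 : Fin n → ℝ) (fun _ => 2 * Real.pi), f fun j => uOf D (θ j)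

/-- The integrand of `contourInt D f` is integrable. -/
def ContourIntegrable (D : Params) {n : ℕ} (f : (Fin n → ℂ) → ℂ) : Prop :=
  MeasureTheory.IntegrableOn (fun θ : Fin n → ℝ => f fun j => uOf D (θ j))
    (Set.Icc (0 : Fin n → ℝ) (fun _ => 2 * Real.pi))

/-- The operator `∮ dz/(2πi z) T(z)` of an operator valued function `T`. -/
def opInt (D : Params) (T : ℂ → Op) : Op := fun p v w =>
  contourInt D fun u : Fin 1 → ℂ => MvPowerSeries.coeff w (T (u 0) p v)

/-! ### Screening operators -/

/-- `Π̂`. -/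
def piPlus (D : Params) (p : Mom) : ℂ :=
  (Real.sqrt (2 * D.r * (D.r - D.k) / D.k) : ℝ) * p 0 - ((D.r - D.k) / D.k : ℝ) * p 2

/-- `Π̂'`. -/
def piMinus (D : Params) (p : Mom) : ℂ :=
  (Real.sqrt (2 * D.r * (D.r - D.k) / D.k) : ℝ) * p 0 - (D.r / D.k : ℝ) * p 2

/-- The integrand `E(z) [u-1/2+Π̂]_{r-k}/[u-1/2]_{r-k}` of `Q_+`. -/
def integrandPlus (D : Params) (u : ℂ) : Op := fun p v =>
  (th D (D.r - D.k) (u - 1 / 2 + piPlus D p) / th D (D.r - D.k) (u - 1 / 2)) •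
    (curE D).act D u p v

/-- The integrand `F(z) [u+1/2-Π̂']_r/[u+1/2]_r` of `Q_-`. -/
def integrandMinus (D : Params) (u : ℂ) : Op := fun p v =>
  (th D D.r (u + 1 / 2 - piMinus D p) / th D D.r (u + 1 / 2)) • (curF D).act D u p v

/-- The integrand `S(z) [u-1/2+P₁]_{k+2}/[u-1/2]_{k+2}` of `Q`. -/
def integrandS (D : Params) (u : ℂ) : Op := fun p v =>
  (th D (D.k + 2) (u - 1 / 2 + p 1) / th D (D.k + 2) (u - 1 / 2)) • (curS D).act D u p v

/-- The screening operator `Q_+`. -/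
def Qplus (D : Params) : Op := opInt D (integrandPlus D)

/-- The screening operator `Q_-`. -/
def Qminus (D : Params) : Op := opInt D (integrandMinus D)

/-- The screening operator `Q`. -/
def Qscr (D : Params) : Op := opInt D (integrandS D)

/-! ### Products of the current `F`

The product `F(z_1) ⋯ F(z_n)` converges only for `|z_{i+1}| < |q|²|z_i|`, because of a pole at
`z_j = q² z_i`.  At points with `|z_1| = ⋯ = |z_n|` it is defined by analytic continuation. -/

/-- The region `|z_j| < |q|² |z_i|` for `i < j`. -/
def nested (D : Params) (n : ℕ) : Set (Fin n → ℂ) :=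
  {u | ∀ i j, i < j → ‖zOf D (u j)‖ < ‖qp D 1‖ ^ 2 * ‖zOf D (u i)‖}

/-- The complement of the hyperplanes `z_j = q² p^{-m} z_i`, `i < j`, `m ≥ 0`, `p = q^{2r}`. -/
def regF (D : Params) (n : ℕ) : Set (Fin n → ℂ) :=
  {u | ∀ i j, i < j → ∀ m : ℕ, zOf D (u j) ≠ qp D (2 - 2 * D.r * m) * zOf D (u i)}

/-- The same, with the poles of the factors `1/[u_i+1/2]_r` removed as well. -/
def regMinus (D : Params) (n : ℕ) : Set (Fin n → ℂ) :=
  regF D n ∩ {u | ∀ i, th D D.r (u i + 1 / 2) ≠ 0}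

/-- `G` is the matrix element, at the monomial `w`, of the product `T(u_1) ⋯ T(u_n) v`, analytically
continued from the region `nested` (where the product must converge) to the set `U`.  The sets `U`
used below are open and connected and meet `nested`, so `G` is unique on `U`. -/
def IsProduct (D : Params) (δ p : Mom) (v : Fock) (T : ℂ → Op) {n : ℕ} (U : Set (Fin n → ℂ))
    (w : Idx →₀ ℕ) (G : (Fin n → ℂ) → ℂ) : Prop :=
  AnalyticOnNhd ℂ G U ∧ ∀ u ∈ nested D n ∩ U,
    OpProdConverges δ p v (List.ofFn fun i => T (u i)) ∧
      G u = MvPowerSeries.coeff w (opProd δ p v (List.ofFn fun i => T (u i)))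

/-- `ψ = Q_-^n v`: the `n`-fold integral over `|z_1| = ⋯ = |z_n| = 1` of the product of `n` copies
of the integrand of `Q_-` applied to `v`. -/
def IsMinusPower (D : Params) (n : ℕ) (p : Mom) (v : Fock) (ψ : CFock) : Prop :=
  ∀ w : Idx →₀ ℕ, ∃ G : (Fin n → ℂ) → ℂ,
    IsProduct D ((curF D).shift D) p v (integrandMinus D) (regMinus D n) w G ∧
      ContourIntegrable D G ∧ MvPowerSeries.coeff w ψ = contourInt D G

/-- The factor `∏_{i<j} [u_i-u_j]_x/[u_i-u_j-1]_x`. -/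
def crossFactor (D : Params) (x : ℝ) {n : ℕ} (u : Fin n → ℂ) : ℂ :=
  ∏ i : Fin n, ∏ j ∈ Finset.Ioi i, th D x (u i - u j) / th D x (u i - u j - 1)

/-- The operator `X(z_n) ⋯ X(z_1) v`: the operator at `z_1` acts first. -/
def descProd (D : Params) (X : Current) (p : Mom) (v : Fock) {n : ℕ} (u : Fin n → ℂ) : CFock :=
  opProd (X.shift D) p v (List.ofFn fun i => X.act D (u i)).reverse

/-- All the sums in `X(z_n) ⋯ X(z_1) v` converge absolutely. -/
def DescProdConverges (D : Params) (X : Current) (p : Mom) (v : Fock) {n : ℕ} (u : Fin n → ℂ) :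
    Prop :=
  OpProdConverges (X.shift D) p v (List.ofFn fun i => X.act D (u i)).reverse

/-- `Q^n v`, the `n`-th power of an operator `Q` which changes the momentum by `δ`. -/
def opPow (δ : Mom) (Q : Op) (n : ℕ) (p : Mom) (v : Fock) : CFock :=
  opProd δ p v (List.replicate n Q)

/-- All the sums in `Q^n v` converge absolutely. -/
def OpPowConverges (δ : Mom) (Q : Op) (n : ℕ) (p : Mom) (v : Fock) : Prop :=
  OpProdConverges δ p v (List.replicate n Q)

/-- The integrand of the formula for `Q_+^n` (matrix element at `w`); `Π̂` acts first. -/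
def formulaPlus (D : Params) (n : ℕ) (p : Mom) (v : Fock) (w : Idx →₀ ℕ) (u : Fin n → ℂ) : ℂ :=
  MvPowerSeries.coeff w (descProd D (curE D) p v u) * crossFactor D (D.r - D.k) u *
    ∏ i, th D (D.r - D.k) (u i + 1 / 2 + piPlus D p - n) / th D (D.r - D.k) (u i - 1 / 2)

/-- The integrand of the formula for `Q_-^n`, where `G` is the matrix element of
`F(z_1) ⋯ F(z_n) v`. -/
def formulaMinus (D : Params) (n : ℕ) (p : Mom) (G : (Fin n → ℂ) → ℂ) (u : Fin n → ℂ) : ℂ :=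
  G u * crossFactor D D.r u *
    ∏ i, th D D.r (u i - 1 / 2 - piMinus D p + n) / th D D.r (u i + 1 / 2)

/-- The integrand of the formula for `Q^n` (matrix element at `w`). -/
def formulaS (D : Params) (n : ℕ) (p : Mom) (v : Fock) (w : Idx →₀ ℕ) (u : Fin n → ℂ) : ℂ :=
  MvPowerSeries.coeff w (descProd D (curS D) p v u) * crossFactor D (D.k + 2) u *
    ∏ i, th D (D.k + 2) (u i + 1 / 2 + p 1 - n) / th D (D.k + 2) (u i - 1 / 2)

end

end QCoset

open QCoset

/-! Each current is a difference of two normal ordered exponentials, so a product of n currents is a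
sum over labels ε in {true, false}^n of normal ordered exponentials times pairwise contractions
(Wick's theorem, `opProd_ofFn`). For E, F and S alike, the contraction of label ε at u with label ε'
at u' has the shape `pairFactor`, with a period s = r-k, r, k+2 and a sign η = 1, -1, 1: an
exponential from the zero modes, a quotient of infinite products in p = q^(2s), and a factor 1 -
z'/z when ε = ε'. `VertexPair` records exactly this, and the argument is carried out once for any
`VertexPair`.

Exchange relation. By `pairFactor_swap`, `pairFactor` times [u-u'-η] equals the exchanged
`pairFactor` times [u-u'+η]. Hence the product of the currents times ∏_{i<j} [u_i-u_j]/[u_i-u_j+η]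
is a symmetric function (`kernel_mul_cross_perm`). The relation compares infinite products, so it
needs the product formula `th_eq_poch` for [u]_s in the variable q^(2u): Jacobi's triple product
after the modular inversion τ ↦ -1/τ.

Symmetrization. Every current lowers Π̂, Π̂' or P_1 by 2. When these operators are evaluated on the
initial momentum, the theta factors of the n integrands become [u_i - η/2 + η(Π - 2(n-1-i))] / [u_i
- η/2] with i = 0, ..., n-1 from left to right. The identity needed is (`sum_perm_orderedProd`) ∑_σ
∏_{i<j} [u_σi - u_σj - 1]/[u_σi - u_σj] ∏_i [u_σi + a - 2i] = [n]!/[1]^n ∏_i [u_i + a + 1 - n]. It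
follows by induction on n, choosing σ 0 first; the inductive step `sum_shift` is an elliptic partial
fraction identity with n+1 points. Partial fractions are in turn deduced from the three-term
relation, that is, from the rank two of [x+y][x-y].

Analysis. The sum over intermediate degrees in a product of two vertex operators is the Cauchy
product of the contraction series with a finitely supported sequence
(`coeff_expCre_mul_expAnn_comp`). For η = 1 it has a summable majorant uniform on the torus, so sums
and integrals commute and the power of the screening operator is an n-fold integral (`opPow_opInt`).
For F the series converge only in the nested region; `pairFactor` itself is the continuation to the
torus.

Conclusion. The n-fold integral is unchanged by permuting its variables, so the integrand may be
averaged over all permutations. Writing it as (currents times cross factor, symmetric) times (theta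
factors divided by cross factor), only the second part has to be summed over σ, and the
symmetrization identity gives the prefactor [n]!/(n! [1]^n) (`contourInt_symmetrize`). -/

namespace QCoset
noncomputable section

/-! ### Exponential series in infinitely many variables, graded by degree -/

/-- The coefficient `∏ c_i ^ n_i / n_i !` of the exponential of `∑ c_i x_i` at the monomial `n`. -/
def expCoeff {R : Type*} [CommRing R] [Algebra ℂ R] (c : Idx → R) (n : Idx →₀ ℕ) : R :=
  n.prod fun i e => ((e.factorial : ℂ)⁻¹) • c i ^ e

theorem inv_factorial_smul_add_pow {R : Type*} [CommRing R] [Algebra ℂ R] (a b : R) (e : ℕ) :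
    ((e.factorial : ℂ)⁻¹) • (a + b) ^ e =
      ∑ x ∈ Finset.HasAntidiagonal.antidiagonal e,
        (((x.1.factorial : ℂ)⁻¹) • a ^ x.1) * (((x.2.factorial : ℂ)⁻¹) • b ^ x.2) := by
  rw [(Commute.all a b).add_pow', Finset.smul_sum]
  refine Finset.sum_congr rfl fun x hx => ?_
  rw [Finset.HasAntidiagonal.mem_antidiagonal] at hx
  subst hx
  rw [smul_mul_smul_comm, ← Nat.cast_smul_eq_nsmul ℂ, smul_smul]
  congr 1
  have := Nat.add_choose_mul_factorial_mul_factorial x.1 x.2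
  rw [← Nat.choose_symm_add] at this
  have h1 : (x.1.factorial : ℂ) ≠ 0 := by exact_mod_cast x.1.factorial_ne_zero
  have h2 : (x.2.factorial : ℂ) ≠ 0 := by exact_mod_cast x.2.factorial_ne_zero
  have h3 : ((x.1 + x.2).factorial : ℂ) ≠ 0 := by exact_mod_cast (x.1 + x.2).factorial_ne_zero
  field_simp
  rw [← this]
  push_cast
  ring

/-- The binomial theorem in every variable, multiplied out: a choice of a splitting of `n i` for
each `i` in the support is the same as a splitting of `n`. -/
theorem expCoeff_add {R : Type*} [CommRing R] [Algebra ℂ R] (a b : Idx → R) (n : Idx →₀ ℕ) :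
    expCoeff (a + b) n =
      ∑ x ∈ Finset.HasAntidiagonal.antidiagonal n, expCoeff a x.1 * expCoeff b x.2 := by
  classical
  unfold expCoeff Finsupp.prod
  simp_rw [Pi.add_apply, inv_factorial_smul_add_pow]
  rw [Finset.prod_sum]
  refine Finset.sum_bij' (fun p _ => (Finsupp.indicator n.support fun i hi => (p i hi).1,
    Finsupp.indicator n.support fun i hi => (p i hi).2))
    (fun x _ => fun i _ => (x.1 i, x.2 i)) ?_ ?_ ?_ ?_ ?_
  · intro p hp
    rw [Finset.HasAntidiagonal.mem_antidiagonal]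
    ext i
    by_cases hi : i ∈ n.support
    · have := Finset.mem_pi.mp hp i hi
      rw [Finset.HasAntidiagonal.mem_antidiagonal] at this
      simp only [Finsupp.add_apply, Finsupp.indicator_of_mem hi, this]
    · simp only [Finsupp.add_apply, Finsupp.indicator_of_notMem hi]
      rw [Finsupp.notMem_support_iff.mp hi, add_zero]
  · intro x hx
    rw [Finset.HasAntidiagonal.mem_antidiagonal] at hx
    rw [Finset.mem_pi]
    intro i hi
    rw [Finset.HasAntidiagonal.mem_antidiagonal, ← hx, Finsupp.add_apply]
  · intro p hp
    funext i hi
    simp only [Finsupp.indicator_of_mem hi]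
  · intro x hx
    rw [Finset.HasAntidiagonal.mem_antidiagonal] at hx
    have h1 : ∀ i, n i = x.1 i + x.2 i := fun i => by rw [← hx, Finsupp.add_apply]
    refine Prod.ext ?_ ?_ <;> ext i <;> by_cases hi : i ∈ n.support
    · simp only [Finsupp.indicator_of_mem hi]
    · simp only [Finsupp.indicator_of_notMem hi]
      have := h1 i; rw [Finsupp.notMem_support_iff.mp hi] at this; omega
    · simp only [Finsupp.indicator_of_mem hi]
    · simp only [Finsupp.indicator_of_notMem hi]
      have := h1 i; rw [Finsupp.notMem_support_iff.mp hi] at this; omega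
  · intro p hp
    rw [Finset.prod_mul_distrib]
    congr 1
    · exact (Finsupp.prod_indicator_index_eq_prod_attach (fun i hi => (p i hi).1)
        (h := fun i e => ((e.factorial : ℂ)⁻¹) • a i ^ e) (fun i _ => by simp)).symm
    · exact (Finsupp.prod_indicator_index_eq_prod_attach (fun i hi => (p i hi).2)
        (h := fun i e => ((e.factorial : ℂ)⁻¹) • b i ^ e) (fun i _ => by simp)).symm

theorem deg_add (l s : Idx →₀ ℕ) : deg (l + s) = deg l + deg s := by
  unfold deg
  exact Finsupp.sum_add_index' (fun _ => by simp) (fun _ _ _ => by ring)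

theorem deg_zero : deg 0 = 0 := by simp [deg]

/-- The monomials of degree `e`, split into two factors in all possible ways. -/
theorem sum_level_antidiagonal {R : Type*} [AddCommMonoid R] (g : (Idx →₀ ℕ) → (Idx →₀ ℕ) → R)
    (e : ℕ) :
    ∑ n ∈ level e, ∑ x ∈ Finset.HasAntidiagonal.antidiagonal n, g x.1 x.2 =
      ∑ y ∈ Finset.HasAntidiagonal.antidiagonal e, ∑ l ∈ level y.1, ∑ s ∈ level y.2, g l s := by
  classical
  simp_rw [← Finset.sum_product']
  rw [Finset.sum_sigma', Finset.sum_sigma']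
  refine Finset.sum_bij' (fun x _ => ⟨(deg x.2.1, deg x.2.2), x.2⟩)
    (fun y _ => ⟨y.2.1 + y.2.2, y.2⟩) ?_ ?_ ?_ ?_ ?_
  · rintro ⟨n, x⟩ h
    simp only [Finset.mem_sigma, Finset.HasAntidiagonal.mem_antidiagonal, Finset.mem_product, mem_level] at h ⊢
    refine ⟨?_, trivial, trivial⟩
    rw [← deg_add, h.2, h.1]
  · rintro ⟨y, x⟩ h
    simp only [Finset.mem_sigma, Finset.HasAntidiagonal.mem_antidiagonal, Finset.mem_product, mem_level] at h ⊢
    rw [deg_add, h.2.1, h.2.2]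
    exact ⟨h.1, trivial⟩
  · rintro ⟨n, x⟩ h
    simp only [Finset.mem_sigma, Finset.HasAntidiagonal.mem_antidiagonal] at h ⊢
    rw [h.2]
  · rintro ⟨y, x⟩ h
    simp only [Finset.mem_sigma, Finset.HasAntidiagonal.mem_antidiagonal, Finset.mem_product, mem_level] at h ⊢
    rw [h.2.1, h.2.2]
  · rintro ⟨n, x⟩ h
    rfl

/-- The coefficient of `t ^ e` in `exp (∑ c_{(j,m)} t ^ m)`. -/
def gradedExp (c : Idx → ℂ) (e : ℕ) : ℂ := ∑ n ∈ level e, expCoeff c n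

theorem gradedExp_add (a b : Idx → ℂ) (e : ℕ) :
    gradedExp (a + b) e =
      ∑ y ∈ Finset.HasAntidiagonal.antidiagonal e, gradedExp a y.1 * gradedExp b y.2 := by
  unfold gradedExp
  simp_rw [expCoeff_add, Finset.sum_mul_sum]
  exact sum_level_antidiagonal (fun l s => expCoeff a l * expCoeff b s) e

theorem level_zero : level 0 = {0} := by
  ext n
  rw [mem_level, Finset.mem_singleton]
  refine ⟨fun h => ?_, fun h => by rw [h, deg_zero]⟩
  unfold deg Finsupp.sum at h
  rw [Finset.sum_eq_zero_iff] at h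
  ext i
  by_contra hi
  have := h i (Finsupp.mem_support_iff.mpr hi)
  rcases Nat.mul_eq_zero.mp this with h1 | h1
  · exact hi h1
  · exact i.2.ne_zero h1

theorem gradedExp_zero_right (c : Idx → ℂ) : gradedExp c 0 = 1 := by
  simp [gradedExp, level_zero, expCoeff]

theorem expCoeff_zero_left {R : Type*} [CommRing R] [Algebra ℂ R] (n : Idx →₀ ℕ) (hn : n ≠ 0) :
    expCoeff (0 : Idx → R) n = 0 := by
  obtain ⟨i, hi⟩ := Finsupp.support_nonempty_iff.mpr hn
  refine Finset.prod_eq_zero hi ?_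
  dsimp only
  rw [Pi.zero_apply, zero_pow (Finsupp.mem_support_iff.mp hi), smul_zero]

theorem gradedExp_zero_left (e : ℕ) (he : e ≠ 0) : gradedExp 0 e = 0 := by
  refine Finset.sum_eq_zero fun n hn => expCoeff_zero_left n ?_
  rintro rfl
  rw [mem_level, deg_zero] at hn
  exact he hn.symm

/-- Rescaling `c_{(j,m)}` by `x ^ m` rescales the coefficients. -/
theorem gradedExp_scale (c : Idx → ℂ) (x : ℂ) (e : ℕ) :
    gradedExp (fun i => x ^ (i.2 : ℕ) * c i) e = x ^ e * gradedExp c e := by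
  unfold gradedExp
  rw [Finset.mul_sum]
  refine Finset.sum_congr rfl fun n hn => ?_
  rw [mem_level] at hn
  unfold expCoeff
  rw [← hn]
  unfold deg Finsupp.prod Finsupp.sum
  rw [← Finset.prod_pow_eq_pow_sum, ← Finset.prod_mul_distrib]
  refine Finset.prod_congr rfl fun i _ => ?_
  simp only [smul_eq_mul, mul_pow, ← pow_mul]
  ring

end
end QCoset

/-! ### Logarithmic derivatives and exponentials of series in one variable -/

namespace QCoset
noncomputable section

/-- Coefficient form of ∂_i exp(∑ c_i x_i) = c_i exp(∑ c_i x_i); it is what makes Euler's operator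
computable in `gradedExp_rec`. -/
theorem expCoeff_sub_single (c : Idx → ℂ) (n : Idx →₀ ℕ) (i : Idx) :
    ((n i + 1 : ℕ) : ℂ) * expCoeff c (n + Finsupp.single i 1) = c i * expCoeff c n := by
  classical
  unfold expCoeff
  have hs : (n + Finsupp.single i 1).support ⊆ insert i n.support := by
    refine Finsupp.support_add.trans ?_
    intro j hj
    rcases Finset.mem_union.mp hj with h | h
    · exact Finset.mem_insert_of_mem h
    · have := Finsupp.support_single_subset h
      rw [Finset.mem_singleton] at this
      rw [this]; exact Finset.mem_insert_self _ _
  rw [Finsupp.prod_of_support_subset _ hs _ (by simp),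
    Finsupp.prod_of_support_subset n (Finset.subset_insert i n.support) _ (by simp)]
  rw [← Finset.mul_prod_erase _ _ (Finset.mem_insert_self i n.support),
    ← Finset.mul_prod_erase (insert i n.support) _ (Finset.mem_insert_self i n.support)]
  have h1 : ∏ x ∈ (insert i n.support).erase i,
      ((((n + Finsupp.single i 1 : Idx →₀ ℕ) x).factorial : ℂ)⁻¹ •
        c x ^ ((n + Finsupp.single i 1 : Idx →₀ ℕ) x)) =
      ∏ x ∈ (insert i n.support).erase i, (((n x).factorial : ℂ)⁻¹ • c x ^ (n x)) := by
    refine Finset.prod_congr rfl fun x hx => ?_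
    rw [Finsupp.add_apply, Finsupp.single_eq_of_ne (Finset.ne_of_mem_erase hx), add_zero]
  rw [h1, ← mul_assoc, ← mul_assoc]
  congr 1
  rw [Finsupp.add_apply, Finsupp.single_eq_same, Nat.factorial_succ, pow_succ]
  simp only [smul_eq_mul]
  have h2 : ((n i).factorial : ℂ) ≠ 0 := by exact_mod_cast (n i).factorial_ne_zero
  have h3 : ((n i : ℂ) + 1) ≠ 0 := by exact_mod_cast (n i).succ_ne_zero
  push_cast
  field_simp

theorem deg_single (i : Idx) : deg (Finsupp.single i 1) = (i.2 : ℕ) := by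
  simp [deg]

/-- The logarithmic derivative: the coefficients of `exp (∑ C_m t ^ m)` are determined by the
numbers `g m = m * C_m`. -/
theorem gradedExp_rec (c : Idx → ℂ) (g : ℕ → ℂ) (g0 : g 0 = 0)
    (hg : ∀ m : ℕ+, (m : ℂ) * ∑ j, c (j, m) = g m) (e : ℕ) :
    (e : ℂ) * gradedExp c e =
      ∑ y ∈ Finset.HasAntidiagonal.antidiagonal e, g y.1 * gradedExp c y.2 := by
  classical
  have h1 : (e : ℂ) * gradedExp c e =
      ∑ n ∈ level e, ∑ i ∈ n.support, ((n i : ℂ) * (i.2 : ℕ)) * expCoeff c n := by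
    unfold gradedExp
    rw [Finset.mul_sum]
    refine Finset.sum_congr rfl fun n hn => ?_
    rw [mem_level] at hn
    rw [← Finset.sum_mul, ← hn]
    unfold deg Finsupp.sum
    push_cast
    rfl
  -- The right-hand side becomes a sum over a variable (j, m) with m = `y.1` and a monomial of
  -- degree `y.2`. No variable has degree 0, which agrees with `g 0 = 0`.
  have h2 : ∑ y ∈ Finset.HasAntidiagonal.antidiagonal e, g y.1 * gradedExp c y.2 =
      ∑ y ∈ Finset.HasAntidiagonal.antidiagonal e,
        ∑ x ∈ (if h : 0 < y.1 then ((Finset.univ : Finset (Fin 3)) ×ˢ ({Nat.toPNat y.1 h} : Finset ℕ+)) else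
          (∅ : Finset Idx)) ×ˢ level y.2,
          ((x.1.2 : ℕ) : ℂ) * (c x.1 * expCoeff c x.2) := by
    refine Finset.sum_congr rfl fun y _ => ?_
    by_cases h : 0 < y.1
    · rw [dif_pos h, Finset.sum_product, Finset.sum_product]
      unfold gradedExp
      rw [← show _ = g y.1 from hg (Nat.toPNat y.1 h), mul_assoc, Finset.sum_mul, Finset.mul_sum]
      refine Finset.sum_congr rfl fun j _ => ?_
      rw [Finset.sum_singleton, Finset.mul_sum, Finset.mul_sum]
    · rw [dif_neg h, Nat.eq_zero_of_not_pos h, g0]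
      simp
  rw [h1, h2, Finset.sum_sigma', Finset.sum_sigma']
  -- A monomial with a marked variable corresponds to the variable and the monomial with one factor
  -- of it removed; `expCoeff_sub_single` matches the weights.
  refine Finset.sum_bij' (fun x _ => ⟨((x.2.2 : ℕ), deg (x.1 - Finsupp.single x.2 1)),
      (x.2, x.1 - Finsupp.single x.2 1)⟩)
    (fun y _ => ⟨y.2.2 + Finsupp.single y.2.1 1, y.2.1⟩) ?_ ?_ ?_ ?_ ?_
  · rintro ⟨n, i⟩ h
    simp only [Finset.mem_sigma, Finset.HasAntidiagonal.mem_antidiagonal, Finset.mem_product,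
      mem_level, Finsupp.mem_support_iff] at h ⊢
    have hle : Finsupp.single i 1 ≤ n := by
      rw [Finsupp.single_le_iff]; exact Nat.one_le_iff_ne_zero.mpr h.2
    refine ⟨?_, ?_, trivial⟩
    · rw [← deg_single, ← deg_add, add_comm, tsub_add_cancel_of_le hle, h.1]
    · rw [dif_pos i.2.pos]
      simp only [Finset.mem_product, Finset.mem_univ, Finset.mem_singleton, true_and]
      rfl
  · rintro ⟨y, i, n⟩ h
    simp only [Finset.mem_sigma, Finset.HasAntidiagonal.mem_antidiagonal, Finset.mem_product,
      mem_level] at h ⊢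
    obtain ⟨h3, h4, h5⟩ := h
    by_cases hy : 0 < y.1
    · rw [dif_pos hy] at h4
      simp only [Finset.mem_product, Finset.mem_univ, Finset.mem_singleton, true_and] at h4
      refine ⟨?_, by simp⟩
      rw [deg_add, deg_single, h4, h5, ← h3, add_comm]
      rfl
    · rw [dif_neg hy] at h4
      exact absurd h4 (Finset.notMem_empty _)
  · rintro ⟨n, i⟩ h
    simp only [Finset.mem_sigma, mem_level, Finsupp.mem_support_iff] at h ⊢
    have hle : Finsupp.single i 1 ≤ n := by
      rw [Finsupp.single_le_iff]; exact Nat.one_le_iff_ne_zero.mpr h.2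
    rw [tsub_add_cancel_of_le hle]
  · rintro ⟨y, i, n⟩ h
    simp only [Finset.mem_sigma, Finset.HasAntidiagonal.mem_antidiagonal, Finset.mem_product,
      mem_level] at h ⊢
    obtain ⟨h3, h4, h5⟩ := h
    by_cases hy : 0 < y.1
    · rw [dif_pos hy] at h4
      simp only [Finset.mem_product, Finset.mem_univ, Finset.mem_singleton, true_and] at h4
      rw [add_tsub_cancel_right, h5, h4]
      rfl
    · rw [dif_neg hy] at h4
      exact absurd h4 (Finset.notMem_empty _)
  · rintro ⟨n, i⟩ h
    simp only [Finset.mem_sigma, mem_level, Finsupp.mem_support_iff] at h ⊢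
    have hle : Finsupp.single i 1 ≤ n := by
      rw [Finsupp.single_le_iff]; exact Nat.one_le_iff_ne_zero.mpr h.2
    have h6 := expCoeff_sub_single c (n - Finsupp.single i 1) i
    rw [tsub_add_cancel_of_le hle] at h6
    rw [mul_right_comm, mul_comm, ← h6, Finsupp.tsub_apply, Finsupp.single_eq_same, Nat.sub_add_cancel
      (Nat.one_le_iff_ne_zero.mpr h.2)]

/-- In characteristic zero the recursion and the value at 0 determine every coefficient. Explicit
sequences are thereby recognised as exponentials. -/
theorem gradedExp_eq_of_rec (c : Idx → ℂ) (g : ℕ → ℂ) (g0 : g 0 = 0)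
    (hg : ∀ m : ℕ+, (m : ℂ) * ∑ j, c (j, m) = g m) (h : ℕ → ℂ) (h0 : h 0 = 1)
    (hrec : ∀ e : ℕ, e ≠ 0 → (e : ℂ) * h e =
      ∑ y ∈ Finset.HasAntidiagonal.antidiagonal e, g y.1 * h y.2) (e : ℕ) :
    gradedExp c e = h e := by
  induction e using Nat.strong_induction_on with
  | _ e ih =>
    rcases eq_or_ne e 0 with rfl | he
    · rw [gradedExp_zero_right, h0]
    · have h1 := gradedExp_rec c g g0 hg e
      have h2 := hrec e he
      have h3 : (e : ℂ) ≠ 0 := by exact_mod_cast he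
      refine mul_left_cancel₀ h3 ?_
      rw [h1, h2]
      refine Finset.sum_congr rfl fun y hy => ?_
      rw [Finset.HasAntidiagonal.mem_antidiagonal] at hy
      -- The term with `y.2 = e` lies outside the induction hypothesis, but its factor `g 0`
      -- vanishes.
      rcases Nat.eq_zero_or_pos y.1 with h4 | h4
      · rw [h4, g0, zero_mul, zero_mul]
      · rw [ih y.2 (by omega)]

/-- Only the sums over the three bosons matter. -/
theorem gradedExp_congr (c c' : Idx → ℂ) (h : ∀ m : ℕ+, ∑ j, c (j, m) = ∑ j, c' (j, m)) :
    gradedExp c = gradedExp c' := by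
  funext e
  let g : ℕ → ℂ := fun m => if hm : 0 < m then (m : ℂ) * ∑ j, c' (j, ⟨m, hm⟩) else 0
  have g0 : g 0 = 0 := by simp [g]
  have hg' : ∀ m : ℕ+, (m : ℂ) * ∑ j, c' (j, m) = g m := fun m => by
    simp only [g, m.pos, dif_pos]; rfl
  exact gradedExp_eq_of_rec c g g0 (fun m => by rw [h, hg']) _ (gradedExp_zero_right c')
    (fun e _ => gradedExp_rec c' g g0 hg' e) e

/-- The function on `Idx` concentrated at the boson `0`. -/
def onZero (C : ℕ → ℂ) (i : Idx) : ℂ := if i.1 = 0 then C i.2 else 0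

theorem sum_onZero (C : ℕ → ℂ) (m : ℕ+) : ∑ j, onZero C (j, m) = C m := by
  simp [onZero]

theorem onZero_add (C C' : ℕ → ℂ) : onZero (C + C') = onZero C + onZero C' := by
  funext i; simp only [onZero, Pi.add_apply]; split_ifs <;> simp

/-- The coefficients of `exp (∑ C_m t ^ m)`. -/
def seqExp (C : ℕ → ℂ) : ℕ → ℂ := gradedExp (onZero C)

theorem gradedExp_eq_seqExp (c : Idx → ℂ) (C : ℕ → ℂ) (h : ∀ m : ℕ+, ∑ j, c (j, m) = C m) :
    gradedExp c = seqExp C :=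
  gradedExp_congr _ _ fun m => by rw [h, sum_onZero]

theorem seqExp_congr {C C' : ℕ → ℂ} (h : ∀ m : ℕ, 0 < m → C m = C' m) : seqExp C = seqExp C' :=
  gradedExp_congr _ _ fun m => by rw [sum_onZero, sum_onZero, h m m.pos]

theorem seqExp_add (C C' : ℕ → ℂ) (e : ℕ) :
    seqExp (C + C') e =
      ∑ y ∈ Finset.HasAntidiagonal.antidiagonal e, seqExp C y.1 * seqExp C' y.2 := by
  unfold seqExp
  rw [onZero_add, gradedExp_add]

theorem seqExp_zero_right (C : ℕ → ℂ) : seqExp C 0 = 1 := gradedExp_zero_right _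

theorem seqExp_scale (C : ℕ → ℂ) (x : ℂ) (e : ℕ) :
    seqExp (fun m => x ^ m * C m) e = x ^ e * seqExp C e := by
  unfold seqExp
  rw [← gradedExp_scale]
  congr 1
  funext i
  simp only [onZero]
  split_ifs <;> simp

theorem seqExp_zero_left (e : ℕ) (he : e ≠ 0) : seqExp 0 e = 0 := by
  have : onZero 0 = 0 := by funext i; simp [onZero]
  unfold seqExp
  rw [this, gradedExp_zero_left e he]

/-- `exp (-∑ t ^ m / m) = 1 - t`. -/
theorem seqExp_neg_inv (e : ℕ) :
    seqExp (fun m => -(m : ℂ)⁻¹) e = if e = 0 then 1 else if e = 1 then -1 else 0 := by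
  refine gradedExp_eq_of_rec _ (fun m => if m = 0 then 0 else -1) (by simp) (fun m => ?_)
    (fun e => if e = 0 then 1 else if e = 1 then -1 else 0) (by simp) (fun e he => ?_) e
  · rw [sum_onZero, if_neg m.ne_zero]
    have : ((m : ℕ) : ℂ) ≠ 0 := by exact_mod_cast m.ne_zero
    field_simp
  · obtain ⟨e, rfl⟩ := Nat.exists_eq_succ_of_ne_zero he
    rw [Finset.Nat.antidiagonal_succ', Finset.sum_cons, Finset.sum_map]
    rcases e with _ | e
    · simp
    · rw [Finset.Nat.antidiagonal_succ', Finset.sum_cons, Finset.sum_map]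
      simp

end
end QCoset

/-! ### The product of two normal ordered exponentials -/

namespace QCoset
noncomputable section

theorem coeff_comp (d : ℕ) (ψ : CFock) (w : Idx →₀ ℕ) :
    (comp d ψ).coeff w = if deg w = d then MvPowerSeries.coeff w ψ else 0 := by
  classical
  unfold comp
  rw [MvPolynomial.coeff_sum]
  simp_rw [MvPolynomial.coeff_monomial]
  rw [Finset.sum_ite_eq']
  simp only [mem_level]

theorem comp_add (d : ℕ) (ψ ψ' : CFock) : comp d (ψ + ψ') = comp d ψ + comp d ψ' := by
  ext w
  rw [MvPolynomial.coeff_add, coeff_comp, coeff_comp, coeff_comp, map_add]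
  split_ifs <;> simp

theorem comp_smul (d : ℕ) (a : ℂ) (ψ : CFock) : comp d (a • ψ) = a • comp d ψ := by
  ext w
  rw [MvPolynomial.coeff_smul, coeff_comp, coeff_comp, MvPowerSeries.coeff_smul]
  split_ifs <;> simp

theorem comp_sum {ι : Type*} (s : Finset ι) (d : ℕ) (ψ : ι → CFock) :
    comp d (∑ i ∈ s, ψ i) = ∑ i ∈ s, comp d (ψ i) := by
  classical
  induction s using Finset.induction_on with
  | empty =>
    ext w
    simp [coeff_comp]
  | insert i s hi ih => rw [Finset.sum_insert hi, Finset.sum_insert hi, comp_add, ih]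

theorem comp_mul (d : ℕ) (a b : CFock) :
    comp d (a * b) = ∑ y ∈ Finset.HasAntidiagonal.antidiagonal d, comp y.1 a * comp y.2 b := by
  classical
  ext w
  rw [coeff_comp, MvPolynomial.coeff_sum, MvPowerSeries.coeff_mul]
  simp_rw [MvPolynomial.coeff_mul, coeff_comp]
  rw [Finset.sum_comm]
  have h1 : ∀ y ∈ Finset.HasAntidiagonal.antidiagonal w,
      ∑ x ∈ Finset.HasAntidiagonal.antidiagonal d,
        (if deg y.1 = x.1 then MvPowerSeries.coeff y.1 a else 0) *
          (if deg y.2 = x.2 then MvPowerSeries.coeff y.2 b else 0) =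
      if deg w = d then MvPowerSeries.coeff y.1 a * MvPowerSeries.coeff y.2 b else 0 := by
    intro y hy
    rw [Finset.HasAntidiagonal.mem_antidiagonal] at hy
    split_ifs with h
    · rw [Finset.sum_eq_single (deg y.1, deg y.2)]
      · simp
      · intro x _ hx
        by_cases h1 : deg y.1 = x.1
        · rw [if_neg (c := deg y.2 = x.2) (fun h2 => hx (Prod.ext h1.symm h2.symm)), mul_zero]
        · rw [if_neg h1, zero_mul]
      · intro h2
        exact absurd (by rw [Finset.HasAntidiagonal.mem_antidiagonal, ← deg_add, hy, h]) h2
    · refine Finset.sum_eq_zero fun x hx => ?_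
      rw [Finset.HasAntidiagonal.mem_antidiagonal] at hx
      by_cases h1 : deg y.1 = x.1
      · rw [if_neg (c := deg y.2 = x.2), mul_zero]
        intro h2
        exact h (by rw [← hy, deg_add, h1, h2, hx])
      · rw [if_neg h1, zero_mul]
  rw [Finset.sum_congr rfl h1]
  split_ifs <;> simp

theorem expAnn_add (D : Params) (φ : Field) (v v' : Fock) :
    expAnn D φ (v + v') = expAnn D φ v + expAnn D φ v' := map_add _ _ _

theorem expAnn_smul (D : Params) (φ : Field) (a : ℂ) (v : Fock) :
    expAnn D φ (a • v) = a • expAnn D φ v := map_smul _ _ _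

theorem expAnn_mul (D : Params) (φ : Field) (v v' : Fock) :
    expAnn D φ (v * v') = expAnn D φ v * expAnn D φ v' := map_mul _ _ _

theorem expAnn_sum (D : Params) (φ : Field) {ι : Type*} (s : Finset ι) (v : ι → Fock) :
    expAnn D φ (∑ i ∈ s, v i) = ∑ i ∈ s, expAnn D φ (v i) := map_sum _ _ _

theorem expAnn_expAnn (D : Params) (φ ψ : Field) (v : Fock) :
    expAnn D φ (expAnn D ψ v) = expAnn D (φ + ψ) v := by
  unfold expAnn
  rw [← AlgHom.comp_apply]
  congr 1
  ext i
  simp [add_mul, add_assoc, MvPolynomial.algebraMap_eq]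

theorem expCre_apply (φ : Field) (n : Idx →₀ ℕ) :
    MvPowerSeries.coeff n (expCre φ) = expCoeff (fun i : Idx => φ (.osc i.1 (-(i.2 : ℤ)))) n := by
  unfold expCoeff
  change expCre φ n = _
  unfold expCre
  refine Finsupp.prod_congr fun i _ => ?_
  rw [smul_eq_mul, div_eq_inv_mul]

theorem expCre_add (φ ψ : Field) : expCre (φ + ψ) = expCre φ * expCre ψ := by
  classical
  ext n
  rw [MvPowerSeries.coeff_mul, expCre_apply]
  simp_rw [expCre_apply]
  exact expCoeff_add (fun i : Idx => φ (.osc i.1 (-(i.2 : ℤ))))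
    (fun i : Idx => ψ (.osc i.1 (-(i.2 : ℤ)))) n

/-- The contractions of the modes of `φ` with those of `ψ`. -/
def contr (D : Params) (φ ψ : Field) (i : Idx) : ℂ :=
  φ (.osc i.1 i.2) * comm D i * ψ (.osc i.1 (-(i.2 : ℤ)))

theorem contr_add_right (D : Params) (φ ψ ψ' : Field) :
    contr D φ (ψ + ψ') = contr D φ ψ + contr D φ ψ' := by
  funext i; simp only [contr, Pi.add_apply]; ring

theorem contr_zero_right (D : Params) (φ : Field) : contr D φ 0 = 0 := by
  funext i; simp [contr]

theorem comp_expCre (ψ : Field) (e : ℕ) :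
    comp e (expCre ψ) = ∑ n ∈ level e,
      expCoeff (fun i : Idx => (ψ (.osc i.1 (-(i.2 : ℤ)))) • (MvPolynomial.X i : Fock)) n := by
  unfold comp
  refine Finset.sum_congr rfl fun n _ => ?_
  rw [expCre_apply, MvPolynomial.monomial_eq]
  unfold expCoeff Finsupp.prod
  rw [map_prod, ← Finset.prod_mul_distrib]
  refine Finset.prod_congr rfl fun i _ => ?_
  dsimp only
  rw [smul_pow, smul_smul, MvPolynomial.smul_eq_C_mul, smul_eq_mul]

theorem expCoeff_C (c : Idx → ℂ) (n : Idx →₀ ℕ) :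
    expCoeff (fun i => (MvPolynomial.C (c i) : Fock)) n = MvPolynomial.C (expCoeff c n) := by
  unfold expCoeff Finsupp.prod
  rw [map_prod]
  refine Finset.prod_congr rfl fun i _ => ?_
  dsimp only
  rw [smul_eq_mul, map_mul, map_pow, Algebra.smul_def, MvPolynomial.algebraMap_eq]

/-- `expAnn` is an algebra homomorphism translating the variables, so it sends each ψ_i X_i to
itself plus a scalar, the contraction; `expCoeff_add` then separates scalars from variables. This is
e^A e^B = e^[A,B] e^B e^A, one degree at a time. -/
theorem expAnn_comp_expCre (D : Params) (φ ψ : Field) (e : ℕ) :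
    expAnn D φ (comp e (expCre ψ)) =
      ∑ y ∈ Finset.HasAntidiagonal.antidiagonal e,
        gradedExp (contr D φ ψ) y.1 • comp y.2 (expCre ψ) := by
  have h1 : ∀ n : Idx →₀ ℕ, expAnn D φ (expCoeff (fun i : Idx => (ψ (.osc i.1 (-(i.2 : ℤ)))) •
      (MvPolynomial.X i : Fock)) n) = expCoeff ((fun i => (MvPolynomial.C (contr D φ ψ i) : Fock)) +
      fun i : Idx => (ψ (.osc i.1 (-(i.2 : ℤ)))) • (MvPolynomial.X i : Fock)) n := by
    intro n
    unfold expCoeff Finsupp.prod expAnn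
    rw [map_prod]
    refine Finset.prod_congr rfl fun i _ => ?_
    rw [map_smul, map_pow, map_smul, MvPolynomial.aeval_X]
    congr 2
    simp only [Pi.add_apply, contr, smul_add, MvPolynomial.smul_eq_C_mul]
    rw [← map_mul, add_comm]
    congr 2
    ring
  rw [comp_expCre, expAnn_sum]
  simp_rw [h1, expCoeff_add]
  rw [sum_level_antidiagonal (fun l s =>
    expCoeff (fun i => (MvPolynomial.C (contr D φ ψ i) : Fock)) l *
    expCoeff (fun i : Idx => (ψ (.osc i.1 (-(i.2 : ℤ)))) • (MvPolynomial.X i : Fock)) s)]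
  refine Finset.sum_congr rfl fun y _ => ?_
  rw [← Finset.sum_mul_sum, comp_expCre, Algebra.smul_def, MvPolynomial.algebraMap_eq]
  unfold gradedExp
  rw [map_sum]
  simp_rw [expCoeff_C]

theorem sum_antidiagonal_assoc {R : Type*} [CommSemiring R] (f g h : ℕ → R) (d : ℕ) :
    ∑ y ∈ Finset.HasAntidiagonal.antidiagonal d,
      (∑ z ∈ Finset.HasAntidiagonal.antidiagonal y.1, f z.1 * g z.2) * h y.2 =
    ∑ y ∈ Finset.HasAntidiagonal.antidiagonal d,
      f y.1 * ∑ z ∈ Finset.HasAntidiagonal.antidiagonal y.2, g z.1 * h z.2 := by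
  have := congrArg (PowerSeries.coeff d)
    (mul_assoc (PowerSeries.mk f) (PowerSeries.mk g) (PowerSeries.mk h))
  simpa only [PowerSeries.coeff_mul, PowerSeries.coeff_mk] using this

/-- Translating the variables cannot raise the degree. The bound depends on `v` alone, hence is
uniform in the points at which the fields are taken. -/
theorem comp_coe_eq_zero (v : Fock) : ∃ N : ℕ, ∀ (D : Params) (φ : Field) (d : ℕ), N < d →
    comp d (expAnn D φ v : CFock) = 0 := by
  suffices h : ∃ N : ℕ, ∀ (D : Params) (φ : Field) (n : Idx →₀ ℕ), N < deg n →
      (expAnn D φ v).coeff n = 0 by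
    obtain ⟨N, hN⟩ := h
    refine ⟨N, fun D φ d hd => ?_⟩
    ext n
    rw [coeff_comp, MvPolynomial.coeff_coe, MvPolynomial.coeff_zero]
    split_ifs with h
    · exact hN D φ n (h ▸ hd)
    · rfl
  induction v using MvPolynomial.induction_on with
  | C a =>
    refine ⟨0, fun D φ n hn => ?_⟩
    have : expAnn D φ (MvPolynomial.C a) = MvPolynomial.C a := by
      simp [expAnn, MvPolynomial.algebraMap_eq]
    rw [this, MvPolynomial.coeff_C, if_neg]
    rintro rfl
    rw [deg_zero] at hn
    exact lt_irrefl _ hn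
  | add a b ha hb =>
    obtain ⟨N, hN⟩ := ha
    obtain ⟨M, hM⟩ := hb
    refine ⟨max N M, fun D φ n hn => ?_⟩
    rw [expAnn_add, MvPolynomial.coeff_add, hN D φ n (lt_of_le_of_lt (le_max_left _ _) hn),
      hM D φ n (lt_of_le_of_lt (le_max_right _ _) hn), add_zero]
  | mul_X a i ha =>
    classical
    obtain ⟨N, hN⟩ := ha
    refine ⟨N + i.2, fun D φ n hn => ?_⟩
    have : expAnn D φ (MvPolynomial.X i) =
        MvPolynomial.X i + MvPolynomial.C (φ (.osc i.1 i.2) * comm D i) := by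
      simp only [expAnn, MvPolynomial.aeval_X]
    rw [expAnn_mul, this, mul_add, MvPolynomial.coeff_add,
      mul_comm _ (MvPolynomial.C _), MvPolynomial.coeff_C_mul,
      MvPolynomial.coeff_mul_X', hN D φ n (by omega), mul_zero, add_zero]
    split_ifs with h
    · refine hN D φ _ ?_
      have hle : Finsupp.single i 1 ≤ n := by
        rw [Finsupp.single_le_iff]
        exact Nat.one_le_iff_ne_zero.mpr (Finsupp.mem_support_iff.mp h)
      have := deg_add (n - Finsupp.single i 1) (Finsupp.single i 1)
      rw [tsub_add_cancel_of_le hle, deg_single] at this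
      omega
    · rfl

/-- The contribution of a creation part of degree `x.1` and a polynomial part of degree `x.2` to a
matrix element of the product of two vertex operators. -/
def pairTerm (D : Params) (φ ψ : Field) (v : Fock) (w : Idx →₀ ℕ) (x : ℕ × ℕ) : ℂ :=
  MvPowerSeries.coeff w (expCre φ * ((comp x.1 (expCre ψ) *
    expAnn D φ (comp x.2 (expAnn D ψ v : CFock)) : Fock) : CFock))

/-- The contribution of the intermediate degree d is a convolution: the contraction series against
the `pairTerm` sums, which are nonzero in finitely many degrees only. Convergence of operator
products thus reduces to convergence of the scalar contraction series. -/
theorem coeff_expCre_mul_expAnn_comp (D : Params) (φ ψ : Field) (v : Fock) (w : Idx →₀ ℕ) (d : ℕ) :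
    MvPowerSeries.coeff w (expCre φ *
      (expAnn D φ (comp d (expCre ψ * (expAnn D ψ v : CFock))) : CFock)) =
    ∑ y ∈ Finset.HasAntidiagonal.antidiagonal d, gradedExp (contr D φ ψ) y.1 *
      ∑ z ∈ Finset.HasAntidiagonal.antidiagonal y.2, pairTerm D φ ψ v w z := by
  rw [comp_mul, expAnn_sum]
  simp_rw [expAnn_mul, expAnn_comp_expCre, MvPolynomial.smul_eq_C_mul]
  rw [sum_antidiagonal_assoc (fun e => (MvPolynomial.C (gradedExp (contr D φ ψ) e) : Fock))
    (fun e => comp e (expCre ψ)) (fun e => expAnn D φ (comp e (expAnn D ψ v : CFock))) d]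
  have key : ∀ (s : Finset (ℕ × ℕ)) (g : ℕ × ℕ → Fock),
      ((∑ y ∈ s, g y : Fock) : CFock) = ∑ y ∈ s, (g y : CFock) := fun s g =>
    map_sum (MvPolynomial.coeToMvPowerSeries.ringHom) g s
  simp_rw [key, MvPolynomial.coe_mul, key, Finset.mul_sum, map_sum]
  refine Finset.sum_congr rfl fun y _ => Finset.sum_congr rfl fun z _ => ?_
  rw [pairTerm, MvPolynomial.coe_C, MvPolynomial.coe_mul, mul_left_comm (expCre φ),
    MvPowerSeries.coeff_C_mul]

theorem pairTerm_eq_zero_left (D : Params) (φ ψ : Field) (v : Fock) (w : Idx →₀ ℕ) (x : ℕ × ℕ)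
    (hx : deg w < x.1) : pairTerm D φ ψ v w x = 0 := by
  classical
  unfold pairTerm
  rw [MvPolynomial.coe_mul, mul_left_comm, MvPowerSeries.coeff_mul]
  refine Finset.sum_eq_zero fun y hy => ?_
  rw [Finset.HasAntidiagonal.mem_antidiagonal] at hy
  rw [MvPolynomial.coeff_coe, coeff_comp, if_neg, zero_mul]
  intro h
  rw [← hy, deg_add] at hx
  omega

/-- The degree of the polynomial part of a vertex operator. -/
def polyDeg (v : Fock) : ℕ := (comp_coe_eq_zero v).choose

theorem pairTerm_eq_zero_right (D : Params) (φ ψ : Field) (v : Fock) (w : Idx →₀ ℕ) (x : ℕ × ℕ)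
    (hx : polyDeg v < x.2) : pairTerm D φ ψ v w x = 0 := by
  unfold pairTerm
  rw [(comp_coe_eq_zero v).choose_spec D ψ x.2 hx]
  simp [expAnn]

theorem sum_comp_coe (v : Fock) (D : Params) (φ : Field) :
    ∑ e ∈ Finset.range (polyDeg v + 1), comp e (expAnn D φ v : CFock) = expAnn D φ v := by
  ext n
  rw [MvPolynomial.coeff_sum]
  simp_rw [coeff_comp, MvPolynomial.coeff_coe]
  rw [Finset.sum_ite_eq]
  split_ifs with h
  · rfl
  · rw [Finset.mem_range, not_lt] at h
    have := congrArg (MvPolynomial.coeff n) ((comp_coe_eq_zero v).choose_spec D φ (deg n) h)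
    rw [coeff_comp, if_pos rfl, MvPolynomial.coeff_coe, MvPolynomial.coeff_zero] at this
    exact this.symm

/-- With the contractions stripped off, the finite sum over all degrees reassembles the normal
ordered product of the two exponentials. -/
theorem sum_pairTerm (D : Params) (φ ψ : Field) (v : Fock) (w : Idx →₀ ℕ) :
    ∑ e ∈ Finset.range (deg w + polyDeg v + 1),
      ∑ z ∈ Finset.HasAntidiagonal.antidiagonal e, pairTerm D φ ψ v w z =
    MvPowerSeries.coeff w (expCre (φ + ψ) * (expAnn D (φ + ψ) v : CFock)) := by
  classical
  -- `pairTerm` vanishes outside the rectangle of degrees at most (`deg w`, `polyDeg v`), so whole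
  -- antidiagonals add only zeros to it.
  have h1 : ∑ z ∈ Finset.range (deg w + 1) ×ˢ Finset.range (polyDeg v + 1),
      pairTerm D φ ψ v w z = ∑ e ∈ Finset.range (deg w + polyDeg v + 1),
      ∑ z ∈ Finset.HasAntidiagonal.antidiagonal e, pairTerm D φ ψ v w z := by
    rw [← Finset.sum_fiberwise_of_maps_to (g := fun z : ℕ × ℕ => z.1 + z.2)
      (t := Finset.range (deg w + polyDeg v + 1))]
    · refine Finset.sum_congr rfl fun e _ => ?_
      refine Finset.sum_subset ?_ ?_
      · intro z hz
        rw [Finset.HasAntidiagonal.mem_antidiagonal]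
        exact (Finset.mem_filter.mp hz).2
      · intro z hz hz'
        rw [Finset.HasAntidiagonal.mem_antidiagonal] at hz
        rw [Finset.mem_filter, Finset.mem_product, Finset.mem_range, Finset.mem_range] at hz'
        by_cases h : deg w < z.1
        · exact pairTerm_eq_zero_left _ _ _ _ _ _ h
        · exact pairTerm_eq_zero_right _ _ _ _ _ _ (by omega)
    · intro z hz
      rw [Finset.mem_product, Finset.mem_range, Finset.mem_range] at hz
      rw [Finset.mem_range]
      omega
  rw [← h1, Finset.sum_product]
  have h2 : ∀ e, ∑ y ∈ Finset.range (polyDeg v + 1), pairTerm D φ ψ v w (e, y) =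
      MvPowerSeries.coeff w ((comp e (expCre ψ) : CFock) *
        (expCre φ * (expAnn D (φ + ψ) v : CFock))) := by
    intro e
    have key : ∀ (s : Finset ℕ) (g : ℕ → Fock),
        ((∑ y ∈ s, g y : Fock) : CFock) = ∑ y ∈ s, (g y : CFock) := fun s g =>
      map_sum (MvPolynomial.coeToMvPowerSeries.ringHom) g s
    rw [← expAnn_expAnn, ← sum_comp_coe v D ψ, expAnn_sum, key, Finset.mul_sum, Finset.mul_sum,
      map_sum]
    refine Finset.sum_congr rfl fun y _ => ?_
    rw [pairTerm, MvPolynomial.coe_mul, mul_left_comm]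
  simp_rw [h2]
  rw [← map_sum, ← Finset.sum_mul, expCre_add, mul_comm (expCre φ) (expCre ψ), mul_assoc,
    MvPowerSeries.coeff_mul,
    MvPowerSeries.coeff_mul]
  refine Finset.sum_congr rfl fun y hy => ?_
  rw [Finset.HasAntidiagonal.mem_antidiagonal] at hy
  congr 1
  rw [map_sum]
  simp_rw [MvPolynomial.coeff_coe, coeff_comp]
  rw [Finset.sum_ite_eq, if_pos]
  rw [Finset.mem_range, ← hy, deg_add]
  omega

end
end QCoset

/-! ### The infinite product ∏ (1 - p^i x) and its inverse -/

namespace QCoset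
noncomputable section

/-- The coefficients of `∏ (1 - p ^ i x)`, `i ≥ 0`. -/
def pochCoeff (p : ℂ) : ℕ → ℂ := seqExp fun m => -((m : ℂ) * (1 - p ^ m))⁻¹

/-- The coefficients of `∏ (1 - p ^ i x)⁻¹`, `i ≥ 0`. -/
def pochInvCoeff (p : ℂ) : ℕ → ℂ := seqExp fun m => ((m : ℂ) * (1 - p ^ m))⁻¹

/-- The entire function `∏ (1 - p ^ i x)`, `i ≥ 0`. -/
def poch (p x : ℂ) : ℂ := ∑' e, pochCoeff p e * x ^ e

theorem one_sub_pow_ne_zero {p : ℂ} (hp : ‖p‖ < 1) {m : ℕ} (hm : m ≠ 0) : 1 - p ^ m ≠ 0 := by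
  intro h
  have h1 : ‖p ^ m‖ < 1 := by rw [norm_pow]; exact pow_lt_one₀ (norm_nonneg _) hp hm
  rw [← sub_eq_zero.mp h, norm_one] at h1
  exact lt_irrefl _ h1

theorem seqExp_conv_neg_inv (C : ℕ → ℂ) (e : ℕ) :
    seqExp (C + fun m : ℕ => -(m : ℂ)⁻¹) (e + 1) = seqExp C (e + 1) - seqExp C e := by
  rw [seqExp_add, Finset.Nat.antidiagonal_succ', Finset.sum_cons, Finset.sum_map]
  rcases e with _ | e
  · simp [seqExp_neg_inv, sub_eq_add_neg]
  · rw [Finset.Nat.antidiagonal_succ', Finset.sum_cons, Finset.sum_map]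
    simp [seqExp_neg_inv, sub_eq_add_neg]

theorem pochCoeff_zero (p : ℂ) : pochCoeff p 0 = 1 := seqExp_zero_right _

/-- Coefficient form of the functional equation between x and p x: the logarithms differ by 1/(m(1 -
p^m)) - p^m/(m(1 - p^m)) = 1/m, the logarithm of a single factor 1 - x up to sign. -/
theorem pochCoeff_succ {p : ℂ} (hp : ‖p‖ < 1) (e : ℕ) :
    pochCoeff p (e + 1) = p ^ (e + 1) * pochCoeff p (e + 1) - p ^ e * pochCoeff p e := by
  have h : pochCoeff p = seqExp ((fun m : ℕ => p ^ m * -((m : ℂ) * (1 - p ^ m))⁻¹) +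
      fun m : ℕ => -(m : ℂ)⁻¹) := by
    refine seqExp_congr fun m hm => ?_
    have h1 := one_sub_pow_ne_zero hp hm.ne'
    have h2 : (m : ℂ) ≠ 0 := by exact_mod_cast hm.ne'
    rw [Pi.add_apply]
    field_simp
    ring
  conv_lhs => rw [h]
  rw [seqExp_conv_neg_inv, seqExp_scale, seqExp_scale]
  rfl

theorem pochInvCoeff_succ {p : ℂ} (hp : ‖p‖ < 1) (e : ℕ) :
    p ^ (e + 1) * pochInvCoeff p (e + 1) = pochInvCoeff p (e + 1) - pochInvCoeff p e := by
  have h : seqExp (fun m : ℕ => p ^ m * ((m : ℂ) * (1 - p ^ m))⁻¹) =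
      seqExp ((fun m : ℕ => ((m : ℂ) * (1 - p ^ m))⁻¹) + fun m : ℕ => -(m : ℂ)⁻¹) := by
    refine seqExp_congr fun m hm => ?_
    have h1 := one_sub_pow_ne_zero hp hm.ne'
    have h2 : (m : ℂ) ≠ 0 := by exact_mod_cast hm.ne'
    rw [Pi.add_apply]
    field_simp
    ring
  have h3 := congrFun h (e + 1)
  rwa [seqExp_scale, seqExp_conv_neg_inv] at h3

theorem pochCoeff_succ' {p : ℂ} (hp : ‖p‖ < 1) (e : ℕ) :
    pochCoeff p (e + 1) = -p ^ e / (1 - p ^ (e + 1)) * pochCoeff p e := by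
  have h1 := one_sub_pow_ne_zero hp e.succ_ne_zero
  have h2 := pochCoeff_succ hp e
  rw [Nat.succ_eq_add_one] at h1
  field_simp
  linear_combination h2

theorem pochInvCoeff_succ' {p : ℂ} (hp : ‖p‖ < 1) (e : ℕ) :
    pochInvCoeff p (e + 1) = 1 / (1 - p ^ (e + 1)) * pochInvCoeff p e := by
  have h1 := one_sub_pow_ne_zero hp e.succ_ne_zero
  have h2 := pochInvCoeff_succ hp e
  rw [Nat.succ_eq_add_one] at h1
  field_simp
  linear_combination -h2

open Filter Topology in
theorem summable_norm_of_ratio (f g : ℕ → ℂ) (l : ℂ) (hl : ‖l‖ < 1)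
    (hg : Tendsto g atTop (𝓝 l)) (h : ∀ e, f (e + 1) = g e * f e) :
    Summable fun e => ‖f e‖ := by
  obtain ⟨r, hr1, hr2⟩ := exists_between hl
  refine summable_of_ratio_norm_eventually_le (r := r) hr2 ?_
  filter_upwards [hg.norm.eventually_lt_const hr1] with e he
  rw [norm_norm, norm_norm, h, norm_mul]
  gcongr

open Filter Topology in
theorem tendsto_one_sub_pow {p : ℂ} (hp : ‖p‖ < 1) :
    Tendsto (fun e : ℕ => 1 - p ^ (e + 1)) atTop (𝓝 1) := by
  have := (tendsto_pow_atTop_nhds_zero_of_norm_lt_one hp).comp (tendsto_add_atTop_nat 1)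
  simpa using tendsto_const_nhds.sub this

open Filter Topology in
theorem summable_pochCoeff {p : ℂ} (hp : ‖p‖ < 1) (x : ℂ) :
    Summable fun e => ‖pochCoeff p e * x ^ e‖ := by
  refine summable_norm_of_ratio _ (fun e => -p ^ e / (1 - p ^ (e + 1)) * x) 0 (by simp) ?_
    (fun e => ?_)
  · have := ((tendsto_pow_atTop_nhds_zero_of_norm_lt_one hp).neg.div (tendsto_one_sub_pow hp)
      one_ne_zero).mul_const x
    simpa using this
  · rw [pochCoeff_succ' hp]; ring

open Filter Topology in
theorem summable_pochInvCoeff {p : ℂ} (hp : ‖p‖ < 1) {x : ℂ} (hx : ‖x‖ < 1) :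
    Summable fun e => ‖pochInvCoeff p e * x ^ e‖ := by
  refine summable_norm_of_ratio _ (fun e => 1 / (1 - p ^ (e + 1)) * x) x hx ?_ (fun e => ?_)
  · have := ((tendsto_const_nhds (x := (1 : ℂ))).div (tendsto_one_sub_pow hp)
      one_ne_zero).mul_const x
    simpa using this
  · rw [pochInvCoeff_succ' hp]; ring

theorem poch_zero (p : ℂ) : poch p 0 = 1 := by
  unfold poch
  rw [tsum_eq_single 0]
  · simp [pochCoeff_zero]
  · intro e he; simp [he]

theorem poch_eq {p : ℂ} (hp : ‖p‖ < 1) (x : ℂ) : poch p x = (1 - x) * poch p (p * x) := by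
  have h1 := (summable_pochCoeff hp x).of_norm
  have h2 := (summable_pochCoeff hp (p * x)).of_norm
  have h3 : ∀ e, pochCoeff p (e + 1) * x ^ (e + 1) =
      pochCoeff p (e + 1) * (p * x) ^ (e + 1) - x * (pochCoeff p e * (p * x) ^ e) := by
    intro e
    rw [mul_pow, mul_pow]
    linear_combination x ^ (e + 1) * pochCoeff_succ hp e
  unfold poch
  rw [h1.tsum_eq_zero_add, sub_mul, one_mul]
  simp_rw [h3]
  rw [((summable_nat_add_iff 1).mpr h2).tsum_sub (h2.mul_left x), tsum_mul_left]
  conv_rhs => enter [1]; rw [h2.tsum_eq_zero_add]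
  simp only [pow_zero]
  ring

theorem poch_differentiable {p : ℂ} (hp : ‖p‖ < 1) : Differentiable ℂ (poch p) := by
  intro x
  have h : DifferentiableOn ℂ (poch p) (Metric.ball 0 (‖x‖ + 1)) := by
    refine Complex.differentiableOn_tsum_of_summable_norm
      (u := fun e => ‖pochCoeff p e * ((‖x‖ + 1 : ℝ) : ℂ) ^ e‖) (summable_pochCoeff hp _)
      (fun e => by fun_prop) Metric.isOpen_ball (fun e y hy => ?_)
    rw [mem_ball_zero_iff] at hy
    rw [norm_mul, norm_mul, norm_pow, norm_pow, Complex.norm_real, Real.norm_eq_abs,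
      abs_of_pos (by positivity)]
    gcongr
  exact h.differentiableAt (Metric.isOpen_ball.mem_nhds (by
    rw [mem_ball_zero_iff]; exact lt_add_one _))

theorem poch_eq_prod {p : ℂ} (hp : ‖p‖ < 1) (x : ℂ) (N : ℕ) :
    poch p x = (∏ i ∈ Finset.range N, (1 - p ^ i * x)) * poch p (p ^ N * x) := by
  induction N with
  | zero => simp
  | succ N ih =>
    rw [ih, Finset.prod_range_succ, poch_eq hp (p ^ N * x), pow_succ']
    ring_nf

-- After splitting off N factors the rest tends to `poch p 0 = 1`, so for some N it is nonzero and
-- any zero comes from one of the finitely many factors.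
open Filter Topology in
theorem poch_eq_zero_iff {p : ℂ} (hp : ‖p‖ < 1) (x : ℂ) :
    poch p x = 0 ↔ ∃ i : ℕ, p ^ i * x = 1 := by
  constructor
  · intro h
    by_contra! hc
    have h1 : Tendsto (fun N : ℕ => poch p (p ^ N * x)) atTop (𝓝 1) := by
      rw [← poch_zero p]
      refine ((poch_differentiable hp).continuous.tendsto 0).comp ?_
      simpa using (tendsto_pow_atTop_nhds_zero_of_norm_lt_one hp).mul_const x
    obtain ⟨N, hN⟩ := (h1.eventually_ne one_ne_zero).exists
    rw [poch_eq_prod hp x N, mul_eq_zero, or_iff_left hN, Finset.prod_eq_zero_iff] at h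
    obtain ⟨i, -, hi⟩ := h
    exact hc i (sub_eq_zero.mp hi).symm
  · rintro ⟨i, hi⟩
    rw [poch_eq_prod hp x (i + 1), Finset.prod_range_succ, hi]
    simp

theorem poch_ne_zero_of_norm_lt {p : ℂ} (hp : ‖p‖ < 1) {x : ℂ} (hx : ‖x‖ < 1) :
    poch p x ≠ 0 := by
  rw [Ne, poch_eq_zero_iff hp]
  rintro ⟨i, hi⟩
  have := congrArg norm hi
  rw [norm_mul, norm_pow, norm_one] at this
  have h1 : ‖p‖ ^ i ≤ 1 := pow_le_one₀ (norm_nonneg _) hp.le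
  nlinarith [norm_nonneg x]

theorem tsum_seqExp_add {C C' : ℕ → ℂ} (h : Summable fun e => ‖seqExp C e‖)
    (h' : Summable fun e => ‖seqExp C' e‖) :
    (Summable fun e => ‖seqExp (C + C') e‖) ∧
      ∑' e, seqExp (C + C') e = (∑' e, seqExp C e) * ∑' e, seqExp C' e := by
  simp_rw [seqExp_add]
  exact ⟨summable_norm_sum_mul_antidiagonal_of_summable_norm h h',
    (tsum_mul_tsum_eq_tsum_sum_antidiagonal_of_summable_norm h h').symm⟩

theorem seqExp_poch (p x : ℂ) (e : ℕ) :
    seqExp (fun m => -x ^ m / ((m : ℂ) * (1 - p ^ m))) e = pochCoeff p e * x ^ e := by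
  rw [mul_comm, pochCoeff, ← seqExp_scale]
  congr 1
  funext m
  ring

theorem seqExp_pochInv (p x : ℂ) (e : ℕ) :
    seqExp (fun m => x ^ m / ((m : ℂ) * (1 - p ^ m))) e = pochInvCoeff p e * x ^ e := by
  rw [mul_comm, pochInvCoeff, ← seqExp_scale]
  congr 1

/-- The exponents of the two series are opposite, so their Cauchy product is the exponential of 0.
-/
theorem tsum_seqExp_pochInv {p : ℂ} (hp : ‖p‖ < 1) {x : ℂ} (hx : ‖x‖ < 1) :
    (Summable fun e => ‖seqExp (fun m => x ^ m / ((m : ℂ) * (1 - p ^ m))) e‖) ∧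
      ∑' e, seqExp (fun m => x ^ m / ((m : ℂ) * (1 - p ^ m))) e = (poch p x)⁻¹ := by
  have h1 : Summable fun e => ‖seqExp (fun m => x ^ m / ((m : ℂ) * (1 - p ^ m))) e‖ := by
    simp_rw [seqExp_pochInv]; exact summable_pochInvCoeff hp hx
  have h2 : Summable fun e => ‖seqExp (fun m => -x ^ m / ((m : ℂ) * (1 - p ^ m))) e‖ := by
    simp_rw [seqExp_poch]; exact summable_pochCoeff hp x
  refine ⟨h1, ?_⟩
  have h3 := (tsum_seqExp_add h1 h2).2
  have h4 : ((fun m : ℕ => x ^ m / ((m : ℂ) * (1 - p ^ m))) +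
      fun m : ℕ => -x ^ m / ((m : ℂ) * (1 - p ^ m))) = 0 := by
    funext m
    simp only [Pi.add_apply, Pi.zero_apply]
    ring
  rw [h4, tsum_eq_single 0 (fun e he => seqExp_zero_left e he), seqExp_zero_right] at h3
  simp_rw [seqExp_poch] at h3
  exact eq_inv_of_mul_eq_one_left h3.symm

/-- The exponential whose logarithm has the coefficients `(y ^ m - x ^ m) / (m (1 - p ^ m))`. -/
theorem tsum_seqExp_ratio {p : ℂ} (hp : ‖p‖ < 1) (x : ℂ) {y : ℂ} (hy : ‖y‖ < 1) :
    (Summable fun e => ‖seqExp (fun m => (y ^ m - x ^ m) / ((m : ℂ) * (1 - p ^ m))) e‖) ∧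
      ∑' e, seqExp (fun m => (y ^ m - x ^ m) / ((m : ℂ) * (1 - p ^ m))) e =
        poch p x / poch p y := by
  have h2 : Summable fun e => ‖seqExp (fun m => -x ^ m / ((m : ℂ) * (1 - p ^ m))) e‖ := by
    simp_rw [seqExp_poch]; exact summable_pochCoeff hp x
  have h3 := tsum_seqExp_pochInv hp hy
  have h4 := tsum_seqExp_add h2 h3.1
  have h5 : ((fun m : ℕ => -x ^ m / ((m : ℂ) * (1 - p ^ m))) +
      fun m : ℕ => y ^ m / ((m : ℂ) * (1 - p ^ m))) =
      fun m : ℕ => (y ^ m - x ^ m) / ((m : ℂ) * (1 - p ^ m)) := by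
    funext m
    simp only [Pi.add_apply]
    ring
  rw [h5, h3.2] at h4
  refine ⟨h4.1, h4.2.trans ?_⟩
  simp_rw [seqExp_poch]
  rw [div_eq_mul_inv]
  rfl

/-- The extra factor exp(-∑ z^m/m) = 1 - z is a polynomial as a series, so no bound on z is needed;
it occurs below with |z| = 1. -/
theorem tsum_seqExp_ratio_mul {p : ℂ} (hp : ‖p‖ < 1) (x : ℂ) {y : ℂ} (hy : ‖y‖ < 1) (z : ℂ) :
    (Summable fun e =>
      ‖seqExp (fun m => (y ^ m - x ^ m) / ((m : ℂ) * (1 - p ^ m)) - z ^ m / m) e‖) ∧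
      ∑' e, seqExp (fun m => (y ^ m - x ^ m) / ((m : ℂ) * (1 - p ^ m)) - z ^ m / m) e =
        poch p x / poch p y * (1 - z) := by
  have h1 : ∀ e, seqExp (fun m => z ^ m * -(m : ℂ)⁻¹) e =
      z ^ e * if e = 0 then 1 else if e = 1 then -1 else 0 := fun e => by
    rw [seqExp_scale, seqExp_neg_inv]
  have h2 : ∀ e ∉ Finset.range 2, seqExp (fun m => z ^ m * -(m : ℂ)⁻¹) e = 0 := by
    intro e he
    rw [Finset.mem_range] at he
    rw [h1, if_neg (by omega), if_neg (by omega), mul_zero]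
  have h3 := tsum_seqExp_ratio hp x hy
  have h4 : Summable fun e => ‖seqExp (fun m => z ^ m * -(m : ℂ)⁻¹) e‖ :=
    summable_of_ne_finset_zero (s := Finset.range 2) fun e he => by rw [h2 e he, norm_zero]
  have h5 := tsum_seqExp_add h3.1 h4
  have h6 : ((fun m : ℕ => (y ^ m - x ^ m) / ((m : ℂ) * (1 - p ^ m))) +
      fun m : ℕ => z ^ m * -(m : ℂ)⁻¹) =
      fun m : ℕ => (y ^ m - x ^ m) / ((m : ℂ) * (1 - p ^ m)) - z ^ m / m := by
    funext m
    simp only [Pi.add_apply]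
    ring
  rw [h6, h3.2] at h5
  refine ⟨h5.1, h5.2.trans ?_⟩
  rw [tsum_eq_sum h2]
  simp_rw [h1, Finset.sum_range_succ]
  simp [sub_eq_add_neg]

end
end QCoset

/-! ### Jacobi's triple product and the product formula for [u]_s -/

namespace QCoset
noncomputable section

open Filter Topology

/-- The coefficients of `poch`, extended by `0` to the negative integers. -/
def pochCoeffInt (p : ℂ) (n : ℤ) : ℂ := if 0 ≤ n then pochCoeff p n.toNat else 0

theorem pochCoeffInt_natCast (p : ℂ) (n : ℕ) : pochCoeffInt p n = pochCoeff p n := by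
  simp [pochCoeffInt]

theorem pochCoeffInt_of_neg (p : ℂ) {n : ℤ} (hn : n < 0) : pochCoeffInt p n = 0 := by
  rw [pochCoeffInt, if_neg (not_le.mpr hn)]

theorem pochCoeffInt_notMem_range (p x : ℂ) (n : ℤ) (hn : n ∉ Set.range ((↑) : ℕ → ℤ)) :
    pochCoeffInt p n * x ^ n = 0 := by
  rw [pochCoeffInt_of_neg, zero_mul]
  by_contra h
  exact hn ⟨n.toNat, Int.toNat_of_nonneg (not_lt.mp h)⟩

theorem summable_pochCoeffInt {p : ℂ} (hp : ‖p‖ < 1) (x : ℂ) :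
    Summable fun n : ℤ => ‖pochCoeffInt p n * x ^ n‖ := by
  rw [← (Nat.cast_injective (R := ℤ)).summable_iff]
  · refine (summable_pochCoeff hp x).congr fun n => ?_
    simp [pochCoeffInt_natCast]
  · intro n hn
    rw [pochCoeffInt_notMem_range p x n hn, norm_zero]

theorem tsum_pochCoeffInt (p x : ℂ) : ∑' n : ℤ, pochCoeffInt p n * x ^ n = poch p x := by
  rw [← (Nat.cast_injective (R := ℤ)).tsum_eq]
  · simp [pochCoeffInt_natCast, poch]
  · intro n hn
    by_contra h
    exact hn (pochCoeffInt_notMem_range p x n h)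

theorem pochCoeffInt_succ {p : ℂ} (hp : ‖p‖ < 1) (n : ℤ) :
    pochCoeffInt p (n + 1) * (1 - p ^ (n + 1)) = -(p ^ n * pochCoeffInt p n) := by
  rcases lt_trichotomy n (-1) with h | h | h
  · rw [pochCoeffInt_of_neg p (by omega), pochCoeffInt_of_neg p (by omega)]; simp
  · subst h; rw [pochCoeffInt_of_neg p (n := -1) (by omega)]; simp
  · lift n to ℕ using (by omega)
    have h1 := pochCoeff_succ hp n
    rw [← Nat.cast_succ, pochCoeffInt_natCast, pochCoeffInt_natCast, zpow_natCast, zpow_natCast,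
      Nat.succ_eq_add_one]
    linear_combination h1

/-- The Laurent coefficients of `poch p a * poch p (p / a)`. -/
def tripleCoeff (p : ℂ) (n : ℤ) : ℂ := ∑' m : ℤ, pochCoeffInt p (n + m) * pochCoeffInt p m * p ^ m

theorem summable_shifted {p : ℂ} (hp : ‖p‖ < 1) (x : ℂ) (n : ℤ) :
    Summable fun m : ℤ => pochCoeffInt p (n + m) * pochCoeffInt p m * x ^ m := by
  have h1 := (summable_pochCoeffInt hp 1).mul_norm (summable_pochCoeffInt hp x)
  have hinj : Function.Injective fun m : ℤ => (n + m, m) := fun a b h => (Prod.ext_iff.mp h).2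
  refine ((h1.comp_injective hinj).congr fun m => ?_).of_norm
  simp only [Function.comp, one_zpow, mul_one, mul_assoc]

theorem hasSum_tripleCoeff {p : ℂ} (hp : ‖p‖ < 1) {a : ℂ} (ha : a ≠ 0) :
    (Summable fun n : ℤ => tripleCoeff p n * a ^ n) ∧
      ∑' n : ℤ, tripleCoeff p n * a ^ n = poch p a * poch p (p / a) := by
  have h1 := (summable_pochCoeffInt hp a).mul_norm (summable_pochCoeffInt hp (p / a))
  have h2 := tsum_mul_tsum_of_summable_norm (summable_pochCoeffInt hp a)
    (summable_pochCoeffInt hp (p / a))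
  -- The shear collects equal powers of a: with exponents n + m in the first factor and m in p/a,
  -- the power of a is n.
  let e : ℤ × ℤ ≃ ℤ × ℤ :=
    { toFun := fun x => (x.1 + x.2, x.2)
      invFun := fun x => (x.1 - x.2, x.2)
      left_inv := fun x => by simp
      right_inv := fun x => by simp }
  rw [tsum_pochCoeffInt, tsum_pochCoeffInt, ← e.tsum_eq] at h2
  have h3 := (e.summable_iff.mpr h1.of_norm)
  have h4 : (fun x : ℤ × ℤ => pochCoeffInt p x.1 * a ^ x.1 * (pochCoeffInt p x.2 * (p / a) ^ x.2)) ∘ e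
      = fun x => pochCoeffInt p (x.1 + x.2) * pochCoeffInt p x.2 * p ^ x.2 * a ^ x.1 := by
    funext x
    simp only [Function.comp, e, Equiv.coe_fn_mk, zpow_add₀ ha, div_zpow]
    have := zpow_ne_zero x.2 ha
    field_simp
  rw [h4] at h3
  have h5 : ∀ n : ℤ, ∑' m : ℤ, pochCoeffInt p (n + m) * pochCoeffInt p m * p ^ m * a ^ n =
      tripleCoeff p n * a ^ n := fun n => tsum_mul_right
  refine ⟨?_, ?_⟩
  · simpa only [h5] using h3.prod
  · rw [h2]
    have h6 := h3.tsum_prod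
    simp only [h5] at h6
    rw [← h6]
    exact tsum_congr fun x => (congrFun h4 x).symm

/-- Let T_n be the Laurent coefficients, c_n those of `poch`, and M = ∑ c_{n+1+m} c_m. The recursion
for c, used in the first factor, gives p^n T_n = -M + p^(n+1) T_{n+1}; used in the second, it gives
M - T_{n+1} = -T_{n+2}. Eliminate M. -/
theorem tripleCoeff_diff {p : ℂ} (hp : ‖p‖ < 1) (hp0 : p ≠ 0) (n : ℤ) :
    tripleCoeff p (n + 1) + p ^ n * tripleCoeff p n =
      tripleCoeff p (n + 2) + p ^ (n + 1) * tripleCoeff p (n + 1) := by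
  have hM := summable_shifted hp 1 (n + 1)
  have hL1 := summable_shifted hp p (n + 1)
  have hL2 := summable_shifted hp p (n + 2)
  simp only [one_zpow, mul_one] at hM
  have h1 : p ^ n * tripleCoeff p n =
      -∑' m : ℤ, pochCoeffInt p (n + 1 + m) * pochCoeffInt p m +
        p ^ (n + 1) * tripleCoeff p (n + 1) := by
    unfold tripleCoeff
    rw [← tsum_mul_left, ← tsum_mul_left, ← tsum_neg, ← hM.neg.tsum_add (hL1.mul_left _)]
    refine tsum_congr fun m => ?_
    have := pochCoeffInt_succ hp (n + m)
    rw [show n + m + 1 = n + 1 + m by ring, zpow_add₀ hp0 (n + 1) m, zpow_add₀ hp0 n m] at this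
    linear_combination pochCoeffInt p m * this
  have h2 : (∑' m : ℤ, pochCoeffInt p (n + 1 + m) * pochCoeffInt p m) - tripleCoeff p (n + 1) =
      -tripleCoeff p (n + 2) := by
    unfold tripleCoeff
    rw [← hM.tsum_sub hL1, ← tsum_neg, ← (Equiv.addRight (1 : ℤ)).tsum_eq]
    refine tsum_congr fun m => ?_
    have := pochCoeffInt_succ hp m
    rw [Equiv.coe_addRight, show n + 1 + (m + 1) = n + 2 + m by ring]
    linear_combination (pochCoeffInt p (n + 2 + m)) * this
  linear_combination h1 - h2

/-- T_{n+1} + p^n T_n is independent of n by `tripleCoeff_diff` and tends to 0 as n grows, because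
the T_n are the terms of a convergent series at a = 1. The recursion is obtained without invoking
uniqueness of Laurent expansions. -/
theorem tripleCoeff_succ {p : ℂ} (hp : ‖p‖ < 1) (hp0 : p ≠ 0) (n : ℤ) :
    tripleCoeff p (n + 1) = -(p ^ n * tripleCoeff p n) := by
  have h1 : ∀ k : ℕ, tripleCoeff p (n + 1) + p ^ n * tripleCoeff p n =
      tripleCoeff p (n + k + 1) + p ^ (n + k : ℤ) * tripleCoeff p (n + k) := by
    intro k
    induction k with
    | zero => simp
    | succ k ih =>
      rw [ih, tripleCoeff_diff hp hp0]
      push_cast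
      ring_nf
  have h2 : Tendsto (tripleCoeff p) atTop (𝓝 0) := by
    have := (hasSum_tripleCoeff hp one_ne_zero).1.tendsto_cofinite_zero
    simp only [one_zpow, mul_one] at this
    rw [Int.cofinite_eq] at this
    exact this.mono_left le_sup_right
  have h3 : Tendsto (fun k : ℕ => n + (k : ℤ)) atTop atTop :=
    tendsto_atTop_add_const_left _ _ tendsto_natCast_atTop_atTop
  have h4 : Tendsto (fun m : ℤ => p ^ m * tripleCoeff p m) atTop (𝓝 0) := by
    refine squeeze_zero_norm' ?_ (tendsto_zero_iff_norm_tendsto_zero.mp h2)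
    filter_upwards [eventually_ge_atTop 0] with m hm
    lift m to ℕ using hm
    rw [norm_mul, zpow_natCast, norm_pow]
    exact mul_le_of_le_one_left (norm_nonneg _) (pow_le_one₀ (norm_nonneg _) hp.le)
  have h5 : Tendsto (fun k : ℕ => tripleCoeff p (n + k + 1) +
      p ^ (n + k : ℤ) * tripleCoeff p (n + k)) atTop (𝓝 (0 + 0)) :=
    (h2.comp (tendsto_atTop_add_const_right _ _ h3)).add (h4.comp h3)
  have h6 := tendsto_nhds_unique h5 (tendsto_const_nhds.congr h1)
  linear_combination -h6

theorem tripleCoeff_eq {l : ℂ} (hl : ‖Complex.exp (2 * l)‖ < 1) (n : ℤ) :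
    tripleCoeff (Complex.exp (2 * l)) n =
      (-1) ^ n * Complex.exp (l * ((n : ℂ) ^ 2 - n)) * tripleCoeff (Complex.exp (2 * l)) 0 := by
  have h1 := tripleCoeff_succ hl (Complex.exp_ne_zero _)
  have key : ∀ n : ℤ, Complex.exp (2 * l) ^ n * Complex.exp (l * ((n : ℂ) ^ 2 - n)) =
      Complex.exp (l * (((n + 1 : ℤ) : ℂ) ^ 2 - (n + 1 : ℤ))) := by
    intro n
    rw [← Complex.exp_int_mul, ← Complex.exp_add]
    congr 1
    push_cast
    ring
  induction n using Int.induction_on with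
  | zero => simp
  | succ n ih =>
    rw [h1, ih, ← key, zpow_add_one₀ (by norm_num)]
    ring
  | pred n ih =>
    have h2 := h1 (-n - 1)
    have h3 := key (-n - 1)
    rw [sub_add_cancel] at h2 h3
    rw [ih, ← h3] at h2
    have h4 : Complex.exp (2 * l) ^ (-(n : ℤ) - 1) ≠ 0 := zpow_ne_zero _ (Complex.exp_ne_zero _)
    refine mul_left_cancel₀ h4 ?_
    have h5 : (-1 : ℂ) ^ (-(n : ℤ) - 1) = -(-1) ^ (-(n : ℤ)) := by
      rw [zpow_sub_one₀ (by norm_num)]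
      norm_num
    rw [h5]
    linear_combination h2

/-- If T_0 were 0, all T_n would be, and so would the product at a = -1; but no -p^i equals 1. The
exact value of T_0 is never needed. -/
theorem tripleCoeff_zero_ne {l : ℂ} (hl : ‖Complex.exp (2 * l)‖ < 1) :
    tripleCoeff (Complex.exp (2 * l)) 0 ≠ 0 := by
  intro h
  have h1 := (hasSum_tripleCoeff hl (a := -1) (by norm_num)).2
  have h2 : ∀ n : ℤ, tripleCoeff (Complex.exp (2 * l)) n = 0 := fun n => by
    rw [tripleCoeff_eq hl, h, mul_zero]
  simp only [h2, zero_mul, tsum_zero] at h1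
  have h3 := mul_eq_zero.mp h1.symm
  have hone : ∀ (i : ℕ), Complex.exp (2 * l) ^ i * (-1) ≠ 1 := by
    intro i hi
    rcases i with _ | i
    · norm_num at hi
    · have := congrArg norm hi
      rw [norm_mul, norm_neg, norm_one, mul_one, norm_pow] at this
      exact (pow_lt_one₀ (norm_nonneg _) hl i.succ_ne_zero).ne this
  rw [poch_eq_zero_iff hl, poch_eq_zero_iff hl] at h3
  rcases h3 with ⟨i, hi⟩ | ⟨i, hi⟩
  · exact hone i hi
  · refine hone (i + 1) ?_
    linear_combination hi

/-- The theta function as an infinite product. -/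
theorem th_eq_poch (D : Params) (hq : D.lq.re < 0) {s : ℝ} (hs : 0 < s) :
    ∃ C : ℂ, C ≠ 0 ∧ ∀ u : ℂ, th D s u = C * Complex.exp (D.lq * (u ^ 2 / s)) *
      (Complex.exp (D.lq * u) - Complex.exp (-(D.lq * u))) *
      (poch (Complex.exp (2 * (s * D.lq))) (Complex.exp (2 * (s * D.lq)) *
          Complex.exp (2 * (D.lq * u))) *
        poch (Complex.exp (2 * (s * D.lq))) (Complex.exp (2 * (s * D.lq)) *
          Complex.exp (-(2 * (D.lq * u))))) := by
  have hl : ‖Complex.exp (2 * (s * D.lq))‖ < 1 := by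
    rw [Complex.norm_exp]
    rw [← Real.exp_zero]
    refine Real.exp_lt_exp.mpr ?_
    simp only [Complex.mul_re, Complex.ofReal_re, Complex.ofReal_im, Complex.re_ofNat,
      Complex.im_ofNat]
    nlinarith
  have hlq : D.lq ≠ 0 := fun h => by rw [h] at hq; simp at hq
  have hs' : (s : ℂ) ≠ 0 := by exact_mod_cast hs.ne'
  have hpi : (Real.pi : ℂ) ≠ 0 := by exact_mod_cast Real.pi_ne_zero
  set τ := tau D s with hτ
  have hτ0 : τ ≠ 0 := by
    rw [hτ, tau]
    refine div_ne_zero (neg_ne_zero.mpr (mul_ne_zero hpi Complex.I_ne_zero)) (mul_ne_zero hs' hlq)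
  have hinv : Real.pi * Complex.I * (-1 / τ) = s * D.lq := by
    rw [hτ, tau]
    field_simp
  have hinv' : τ⁻¹ = s * D.lq * Complex.I / Real.pi := by
    rw [hτ, tau]
    field_simp
    linear_combination -Complex.I_sq
  set p := Complex.exp (2 * (s * D.lq)) with hp
  have hI := Complex.I_sq
  -- Completing the square: the half-integer shift of the summation index and the sign (-1)^n become
  -- a shift of the argument by 1/2 - τ/2.
  have step1 : ∀ u : ℂ, th D s u = Complex.I * (Complex.exp (Real.pi * Complex.I * τ / 4 -
      Real.pi * Complex.I * (u / s)) * jacobiTheta₂ (u / s + 1 / 2 - τ / 2) τ) := by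
    intro u
    unfold th theta1 jacobiTheta₂ jacobiTheta₂_term
    rw [← tsum_mul_left, ← tsum_mul_left, ← tsum_mul_left]
    refine tsum_congr fun n => ?_
    have h1 : (-1 : ℂ) ^ n = Complex.exp (n * (Real.pi * Complex.I)) := by
      rw [Complex.exp_int_mul, Complex.exp_pi_mul_I]
    rw [h1, ← Complex.exp_add, ← Complex.exp_add, ← Complex.exp_add]
    congr 2
    ring
  -- The inverted modulus satisfies πi(-1/τ) = s log q, so the inverted series is the triple product
  -- at a = q^(-2u) with p = q^(2s).
  have step2 : ∀ u : ℂ, tripleCoeff p 0 *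
      jacobiTheta₂ ((u / s + 1 / 2 - τ / 2) / τ) (-1 / τ) =
      poch p (Complex.exp (-(2 * (D.lq * u)))) * poch p (p * Complex.exp (2 * (D.lq * u))) := by
    intro u
    have h1 := (hasSum_tripleCoeff hl (Complex.exp_ne_zero (-(2 * (D.lq * u))))).2
    rw [div_eq_mul_inv p, ← Complex.exp_neg, neg_neg] at h1
    rw [← h1]
    unfold jacobiTheta₂ jacobiTheta₂_term
    rw [← tsum_mul_left]
    refine tsum_congr fun n => ?_
    rw [tripleCoeff_eq hl n]
    have h1 : (-1 : ℂ) ^ n = Complex.exp (n * (-(Real.pi * Complex.I))) := by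
      rw [Complex.exp_int_mul, Complex.exp_neg, Complex.exp_pi_mul_I]
      norm_num
    rw [h1, ← Complex.exp_int_mul, mul_comm _ (tripleCoeff p 0), mul_assoc (tripleCoeff p 0),
      ← Complex.exp_add, ← Complex.exp_add]
    congr 2
    have h2 : (u / s + 1 / 2 - τ / 2) / τ = (u / s + 1 / 2) * τ⁻¹ - 1 / 2 := by
      field_simp
    rw [h2, hinv']
    have h3 : ∀ x : ℂ, (Real.pi : ℂ) * Complex.I * x * (-1 / τ) = x * (s * D.lq) := by
      intro x; rw [← hinv]; ring
    rw [h3]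
    field_simp
    linear_combination (D.lq * (n * (2 * u + s))) * hI
  -- All that does not depend on u: the automorphy factor of the inversion, 1/T_0, and the constant
  -- term of the exponents.
  refine ⟨Complex.I * (1 / (-Complex.I * τ) ^ (1 / 2 : ℂ)) / tripleCoeff p 0 *
    Complex.exp (Real.pi * Complex.I * τ / 4 - Real.pi * Complex.I * (1 / 2 - τ / 2) ^ 2 / τ),
    ?_, fun u => ?_⟩
  · refine mul_ne_zero (div_ne_zero (mul_ne_zero Complex.I_ne_zero
      (one_div_ne_zero ?_)) (tripleCoeff_zero_ne hl)) (Complex.exp_ne_zero _)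
    rw [Ne, Complex.cpow_eq_zero_iff, not_and_or]
    exact Or.inl (mul_ne_zero (neg_ne_zero.mpr Complex.I_ne_zero) hτ0)
  · have h0 := tripleCoeff_zero_ne hl
    rw [← hp] at h0
    have h1 : jacobiTheta₂ ((u / s + 1 / 2 - τ / 2) / τ) (-1 / τ) =
      poch p (Complex.exp (-(2 * (D.lq * u)))) * poch p (p * Complex.exp (2 * (D.lq * u))) /
        tripleCoeff p 0 := by
      rw [eq_div_iff h0, ← step2, mul_comm]
    rw [step1, jacobiTheta₂_functional_equation, h1, poch_eq hl (Complex.exp (-(2 * (D.lq * u))))]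
    have h2 : (1 - Complex.exp (-(2 * (D.lq * u)))) =
        Complex.exp (-(D.lq * u)) * (Complex.exp (D.lq * u) - Complex.exp (-(D.lq * u))) := by
      rw [mul_sub, ← Complex.exp_add, ← Complex.exp_add]
      rw [neg_add_cancel, Complex.exp_zero]
      ring_nf
    rw [h2]
    have h3 : Complex.exp (Real.pi * Complex.I * τ / 4 - Real.pi * Complex.I * (u / s)) *
        Complex.exp (-Real.pi * Complex.I * (u / s + 1 / 2 - τ / 2) ^ 2 / τ) *
        Complex.exp (-(D.lq * u)) =
        Complex.exp (Real.pi * Complex.I * τ / 4 - Real.pi * Complex.I * (1 / 2 - τ / 2) ^ 2 / τ) *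
        Complex.exp (D.lq * (u ^ 2 / s)) := by
      rw [← Complex.exp_add, ← Complex.exp_add, ← Complex.exp_add]
      congr 1
      have h4 : -Real.pi * Complex.I * (u / s + 1 / 2 - τ / 2) ^ 2 / τ =
          -Real.pi * Complex.I * ((u / s) ^ 2 + (u / s)) * τ⁻¹ + Real.pi * Complex.I * (u / s) -
            Real.pi * Complex.I * (1 / 2 - τ / 2) ^ 2 / τ := by
        field_simp
        ring
      rw [h4, hinv']
      field_simp
      linear_combination (-(16 * τ * D.lq * (u + s) * u)) * hI
    linear_combination (Complex.I * (1 / (-Complex.I * τ) ^ (1 / 2 : ℂ)) / tripleCoeff p 0 *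
      (Complex.exp (D.lq * u) - Complex.exp (-(D.lq * u))) *
      poch p (p * Complex.exp (-(2 * (D.lq * u)))) * poch p (p * Complex.exp (2 * (D.lq * u)))) * h3

end
end QCoset

/-! ### Zeros of [u]_s and the addition formula -/

namespace QCoset
noncomputable section

open Filter Topology

theorem tau_im_pos (D : Params) (hq : D.lq.re < 0) {s : ℝ} (hs : 0 < s) : 0 < (tau D s).im := by
  have h : (tau D s) = ((Real.pi / s : ℝ) : ℂ) * (-Complex.I * D.lq⁻¹) := by
    unfold tau
    have hlq : D.lq ≠ 0 := fun h => by rw [h] at hq; simp at hq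
    have hs' : (s : ℂ) ≠ 0 := by exact_mod_cast hs.ne'
    push_cast
    field_simp
  rw [h, Complex.im_ofReal_mul]
  refine mul_pos (div_pos Real.pi_pos hs) ?_
  have hn : 0 < Complex.normSq D.lq := Complex.normSq_pos.mpr fun h => by rw [h] at hq; simp at hq
  simp only [Complex.mul_im, Complex.neg_re, Complex.I_re, Complex.inv_im, Complex.neg_im,
    Complex.I_im, Complex.inv_re]
  have : D.lq.re / Complex.normSq D.lq < 0 := div_neg_of_neg_of_pos hq hn
  linarith

theorem th_odd (D : Params) (hq : D.lq.re < 0) {s : ℝ} (hs : 0 < s) (u : ℂ) :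
    th D s (-u) = -th D s u := by
  obtain ⟨C, -, h⟩ := th_eq_poch D hq hs
  rw [h, h]
  simp only [mul_neg, neg_neg, neg_sq]
  ring

theorem norm_nome_lt (D : Params) (hq : D.lq.re < 0) {s : ℝ} (hs : 0 < s) :
    ‖Complex.exp (2 * (s * D.lq))‖ < 1 := by
  rw [Complex.norm_exp, ← Real.exp_zero]
  refine Real.exp_lt_exp.mpr ?_
  simp only [Complex.mul_re, Complex.ofReal_re, Complex.ofReal_im, Complex.re_ofNat,
    Complex.im_ofNat]
  nlinarith

theorem th_differentiable (D : Params) (hq : D.lq.re < 0) {s : ℝ} (hs : 0 < s) :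
    Differentiable ℂ (th D s) := by
  obtain ⟨C, -, h⟩ := th_eq_poch D hq hs
  have hp := poch_differentiable (norm_nome_lt D hq hs)
  rw [funext h]
  fun_prop

theorem th_eq_zero_iff (D : Params) (hq : D.lq.re < 0) {s : ℝ} (hs : 0 < s) (u : ℂ) :
    th D s u = 0 ↔ ∃ m : ℤ, Complex.exp (2 * (D.lq * u)) = Complex.exp (2 * (s * D.lq)) ^ m := by
  obtain ⟨C, hC, h⟩ := th_eq_poch D hq hs
  have hl := norm_nome_lt D hq hs
  have hp0 := Complex.exp_ne_zero (2 * (s * D.lq))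
  set p := Complex.exp (2 * (s * D.lq))
  have hz0 := Complex.exp_ne_zero (2 * (D.lq * u))
  have h1 : Complex.exp (D.lq * u) - Complex.exp (-(D.lq * u)) = 0 ↔
      Complex.exp (2 * (D.lq * u)) = 1 := by
    rw [sub_eq_zero, Complex.exp_neg, ← mul_eq_one_iff_eq_inv₀ (Complex.exp_ne_zero _),
      ← Complex.exp_add, two_mul]
  rw [h, mul_eq_zero, mul_eq_zero, mul_eq_zero, or_iff_right hC,
    or_iff_right (Complex.exp_ne_zero _), mul_eq_zero, poch_eq_zero_iff hl, poch_eq_zero_iff hl, h1,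
    Complex.exp_neg]
  set z := Complex.exp (2 * (D.lq * u))
  constructor
  · rintro (h2 | ⟨i, hi⟩ | ⟨i, hi⟩)
    · exact ⟨0, by rw [h2, zpow_zero]⟩
    · refine ⟨-(i + 1 : ℕ), ?_⟩
      rw [zpow_neg, zpow_natCast, ← mul_eq_one_iff_eq_inv₀ (pow_ne_zero _ hp0), ← hi]
      ring
    · refine ⟨(i + 1 : ℕ), ?_⟩
      rw [zpow_natCast]
      field_simp at hi
      rw [← hi]
      ring
  · rintro ⟨m, hm⟩
    rcases lt_trichotomy m 0 with h2 | h2 | h2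
    · right; left
      refine ⟨(-m).toNat - 1, ?_⟩
      have h3 : m = -(((-m).toNat - 1 + 1 : ℕ) : ℤ) := by omega
      generalize (-m).toNat - 1 = i at *
      rw [h3, zpow_neg, zpow_natCast] at hm
      rw [hm]
      have := pow_ne_zero i hp0
      rw [pow_succ]
      field_simp
    · left; rw [hm, h2, zpow_zero]
    · right; right
      refine ⟨m.toNat - 1, ?_⟩
      have h3 : m = ((m.toNat - 1 + 1 : ℕ) : ℤ) := by omega
      generalize m.toNat - 1 = i at *
      rw [h3, zpow_natCast] at hm
      rw [hm]
      have := pow_ne_zero i hp0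
      rw [pow_succ]
      field_simp

theorem th_eventually_ne_zero (D : Params) (hq : D.lq.re < 0) {s : ℝ} (hs : 0 < s) (u : ℂ) :
    ∀ᶠ ε in 𝓝[≠] (0 : ℂ), th D s (u + ε) ≠ 0 := by
  have hd := th_differentiable D hq hs
  have ha : AnalyticOnNhd ℂ (th D s) Set.univ :=
    hd.differentiableOn.analyticOnNhd isOpen_univ
  have h1 : ∀ᶠ z in 𝓝[≠] u, th D s z ≠ 0 := by
    rcases (ha u (Set.mem_univ _)).eventually_eq_zero_or_eventually_ne_zero with h | h
    · exfalso
      have h2 := ha.eqOn_zero_of_preconnected_of_eventuallyEq_zero isPreconnected_univ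
        (Set.mem_univ u) h
      have hlq : D.lq ≠ 0 := fun h => by rw [h] at hq; simp at hq
      -- Here q^(2u) = -1. It has modulus 1, so only the zeroth power of the nome could equal it,
      -- and that is 1; hence [u]_s is not identically zero.
      have h3 : th D s (Complex.I * Real.pi / (2 * D.lq)) = 0 := h2 (Set.mem_univ _)
      rw [th_eq_zero_iff D hq hs] at h3
      obtain ⟨m, hm⟩ := h3
      have h4 : 2 * (D.lq * (Complex.I * Real.pi / (2 * D.lq))) = Real.pi * Complex.I := by
        field_simp
      rw [h4, Complex.exp_pi_mul_I] at hm
      have h5 := congrArg norm hm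
      rw [norm_neg, norm_one, norm_zpow] at h5
      have h6 : m = 0 := by
        by_contra h6
        have := zpow_eq_one_iff_right₀ (norm_nonneg (Complex.exp (2 * (s * D.lq))))
          (norm_nome_lt D hq hs).ne |>.mp h5.symm
        exact h6 this
      rw [h6, zpow_zero] at hm
      norm_num at hm
    · exact h
  have h2 : Tendsto (fun ε : ℂ => u + ε) (𝓝[≠] 0) (𝓝[≠] u) := by
    refine tendsto_nhdsWithin_iff.mpr ⟨?_, ?_⟩
    · refine Tendsto.mono_left ?_ nhdsWithin_le_nhds
      have : Continuous fun ε : ℂ => u + ε := by fun_prop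
      simpa using this.tendsto 0
    · filter_upwards [self_mem_nhdsWithin] with ε hε
      simpa using hε
  exact h2.eventually h1

/-- The lattice of pairs (m, n) is cut by the parity of m + n and each half is parametrized by
rotated coordinates. For a product of theta series at x + y and x - y these coordinates separate x
from y. -/
theorem tsum_int_prod_split (f : ℤ × ℤ → ℂ) (hf : Summable f) :
    ∑' x, f x = ∑' x : ℤ × ℤ, f (x.1 + x.2 + 1, x.1 - x.2) +
      ∑' x : ℤ × ℤ, f (x.1 + x.2 + 1, x.1 - x.2 + 1) := by
  let e : (ℤ × ℤ) ⊕ (ℤ × ℤ) → ℤ × ℤ := Sum.elim (fun x => (x.1 + x.2 + 1, x.1 - x.2))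
    (fun x => (x.1 + x.2 + 1, x.1 - x.2 + 1))
  have he : Function.Bijective e := by
    constructor
    · rintro (⟨a, b⟩ | ⟨a, b⟩) (⟨c, d⟩ | ⟨c, d⟩) h <;>
        simp only [e, Sum.elim_inl, Sum.elim_inr, Prod.mk.injEq] at h <;>
        congr 2 <;> omega
    · rintro ⟨m, n⟩
      rcases Int.even_or_odd (m + n) with ⟨k, hk⟩ | ⟨k, hk⟩
      · refine ⟨Sum.inr (k - 1, m - k), ?_⟩
        simp only [e, Sum.elim_inr, Prod.mk.injEq]
        omega
      · refine ⟨Sum.inl (k, m - k - 1), ?_⟩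
        simp only [e, Sum.elim_inl, Prod.mk.injEq]
        omega
  have h1 := (Equiv.ofBijective e he).tsum_eq f
  have h2 := (Equiv.ofBijective e he).summable_iff.mpr hf
  have h3 : Summable ((f ∘ ⇑(Equiv.ofBijective e he)) ∘ Sum.inl) := h2.comp_injective Sum.inl_injective
  have h4 : Summable ((f ∘ ⇑(Equiv.ofBijective e he)) ∘ Sum.inr) := h2.comp_injective Sum.inr_injective
  rw [← h1]
  exact (h3.hasSum.sum h4.hasSum).tsum_eq

/-- The addition formula: `[x + y][x - y]` has rank two. -/
theorem th_add_mul_th_sub (D : Params) (hq : D.lq.re < 0) {s : ℝ} (hs : 0 < s) :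
    ∃ A B : ℂ → ℂ, ∀ x y, th D s (x + y) * th D s (x - y) = A x * B y - B x * A y := by
  have hτ := tau_im_pos D hq hs
  set τ := tau D s with hτd
  have hτ2 : 0 < (2 * τ).im := by
    rw [Complex.mul_im]; simp only [Complex.re_ofNat, Complex.im_ofNat]; linarith
  -- The theta series of modulus 2τ in 2x/s, summed over the integers for A and over the
  -- half-integers for B; the two halves of the lattice produce the two products.
  let A : ℂ → ℂ := fun x => jacobiTheta₂ (2 * (x / s)) (2 * τ)
  let B : ℂ → ℂ := fun x => Complex.exp (Real.pi * Complex.I * τ / 2 + 2 * Real.pi * Complex.I * (x / s)) *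
    jacobiTheta₂ (2 * (x / s) + τ) (2 * τ)
  let t : ℂ → ℤ → ℂ := fun u n => Complex.exp (Real.pi * Complex.I * τ / 4 -
      Real.pi * Complex.I * (u / s)) * jacobiTheta₂_term n (u / s + 1 / 2 - τ / 2) τ
  have ht : ∀ u, Summable fun n => ‖t u n‖ := fun u =>
    (((summable_jacobiTheta₂_term_iff _ τ).mpr hτ).mul_left _).norm
  have hth : ∀ u, th D s u = Complex.I * ∑' n, t u n := by
    intro u
    unfold th theta1
    congr 1
    refine tsum_congr fun n => ?_
    have h1 : (-1 : ℂ) ^ n = Complex.exp (n * (Real.pi * Complex.I)) := by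
      rw [Complex.exp_int_mul, Complex.exp_pi_mul_I]
    simp only [t, jacobiTheta₂_term]
    rw [h1, ← Complex.exp_add, ← Complex.exp_add, ← Complex.exp_add]
    congr 1
    ring
  have hA : ∀ x, Summable fun i : ℤ => ‖jacobiTheta₂_term i (2 * (x / s)) (2 * τ)‖ := fun x =>
    ((summable_jacobiTheta₂_term_iff _ _).mpr hτ2).norm
  have hB : ∀ x, Summable fun i : ℤ => ‖Complex.exp (Real.pi * Complex.I * τ / 2 +
      2 * Real.pi * Complex.I * (x / s)) * jacobiTheta₂_term i (2 * (x / s) + τ) (2 * τ)‖ := fun x =>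
    (((summable_jacobiTheta₂_term_iff _ _).mpr hτ2).mul_left _).norm
  have hBt : ∀ x, B x = ∑' i : ℤ, Complex.exp (Real.pi * Complex.I * τ / 2 +
      2 * Real.pi * Complex.I * (x / s)) * jacobiTheta₂_term i (2 * (x / s) + τ) (2 * τ) := fun x =>
    tsum_mul_left.symm
  have hAt : ∀ x, A x = ∑' i : ℤ, jacobiTheta₂_term i (2 * (x / s)) (2 * τ) := fun x => rfl
  have hpiI : ∀ (c d : ℂ) (i : ℤ), c = d + i * (2 * Real.pi * Complex.I) →
      Complex.exp c = Complex.exp d := fun c d i h => by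
    rw [h, Complex.exp_add, Complex.exp_int_mul_two_pi_mul_I, mul_one]
  have hneg : ∀ (c d : ℂ) (i : ℤ), c = d + i * (2 * Real.pi * Complex.I) + Real.pi * Complex.I →
      Complex.exp c = -Complex.exp d := fun c d i h => by
    rw [h, Complex.exp_add, Complex.exp_add, Complex.exp_int_mul_two_pi_mul_I,
      Complex.exp_pi_mul_I]
    ring
  refine ⟨A, B, fun x y => ?_⟩
  rw [hth, hth]
  have h1 := tsum_mul_tsum_of_summable_norm (ht (x + y)) (ht (x - y))
  rw [tsum_int_prod_split _ ((ht (x + y)).mul_norm (ht (x - y))).of_norm] at h1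
  have h2 : ∑' z : ℤ × ℤ, t (x + y) (z.1 + z.2 + 1) * t (x - y) (z.1 - z.2) = -(A x * B y) := by
    rw [hAt, hBt, tsum_mul_tsum_of_summable_norm (hA x) (hB y), ← tsum_neg]
    refine tsum_congr fun z => ?_
    simp only [t, jacobiTheta₂_term]
    rw [← Complex.exp_add, ← Complex.exp_add, ← Complex.exp_add, ← Complex.exp_add,
      ← Complex.exp_add]
    refine hneg _ _ z.1 ?_
    push_cast
    ring
  have h3 : ∑' z : ℤ × ℤ, t (x + y) (z.1 + z.2 + 1) * t (x - y) (z.1 - z.2 + 1) = B x * A y := by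
    rw [hAt, hBt, tsum_mul_tsum_of_summable_norm (hB x) (hA y)]
    refine tsum_congr fun z => ?_
    simp only [t, jacobiTheta₂_term]
    rw [← Complex.exp_add, ← Complex.exp_add, ← Complex.exp_add, ← Complex.exp_add,
      ← Complex.exp_add]
    refine hpiI _ _ (z.1 + 1) ?_
    push_cast
    ring
  linear_combination (Complex.I ^ 2) * h1 + (Complex.I ^ 2) * h2 + Complex.I ^ 2 * h3 +
    (B x * A y - A x * B y) * Complex.I_sq

end
end QCoset

/-! ### The three-term relation and elliptic partial fractions -/

namespace QCoset
noncomputable section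

open Filter Topology

/-- The properties of the theta function `[u]_x` that are used in the identities below. -/
structure IsThetaLike (f : ℂ → ℂ) : Prop where
  odd : ∀ u, f (-u) = -f u
  cont : Continuous f
  ne : ∀ u, ∀ᶠ ε in 𝓝[≠] (0 : ℂ), f (u + ε) ≠ 0
  rank_two : ∃ A B : ℂ → ℂ, ∀ x y, f (x + y) * f (x - y) = A x * B y - B x * A y

theorem isThetaLike_th (D : Params) (hq : D.lq.re < 0) {s : ℝ} (hs : 0 < s) :
    IsThetaLike (th D s) :=
  ⟨th_odd D hq hs, (th_differentiable D hq hs).continuous, th_eventually_ne_zero D hq hs,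
    th_add_mul_th_sub D hq hs⟩

theorem IsThetaLike.map_zero {f : ℂ → ℂ} (hf : IsThetaLike f) : f 0 = 0 := by
  have h := hf.odd 0
  rw [neg_zero] at h
  exact self_eq_neg.mp h

theorem IsThetaLike.map_sub_comm {f : ℂ → ℂ} (hf : IsThetaLike f) (x y : ℂ) :
    f (x - y) = -f (y - x) := by
  rw [← hf.odd, neg_sub]

theorem eq_zero_of_eventually {g : ℂ → ℂ} (hg : Continuous g)
    (h : ∀ᶠ ε in 𝓝[≠] (0 : ℂ), g ε = 0) : g 0 = 0 := by
  have h1 : Tendsto g (𝓝[≠] 0) (𝓝 (g 0)) := (hg.tendsto 0).mono_left nhdsWithin_le_nhds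
  exact tendsto_nhds_unique (h1.congr' h) tendsto_const_nhds

/-- The three-term identity. -/
theorem IsThetaLike.three_term {f : ℂ → ℂ} (hf : IsThetaLike f) (x a b c d : ℂ) :
    f (x - c) * f (x - d) * (f (a - b) * f (a + b - (c + d))) =
      f (x - b) * f (x - (c + d - b)) * (f (a - c) * f (a - d)) -
        f (x - a) * f (x - (c + d - a)) * (f (b - c) * f (b - d)) := by
  obtain ⟨A, B, h⟩ := hf.rank_two
  -- Centred at (c + d)/2, each product is a 2 × 2 minor of the vectors (A, B); the claim becomes
  -- the Plücker relation among four such vectors.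
  have key : ∀ y z : ℂ, f (y - z) * f (y - (c + d - z)) =
      A (y - (c + d) / 2) * B (z - (c + d) / 2) - B (y - (c + d) / 2) * A (z - (c + d) / 2) := by
    intro y z
    rw [← h, mul_comm]
    congr 2 <;> ring
  have h1 := key x c
  have h2 := key a c
  have h3 := key b c
  rw [show c + d - c = d by ring] at h1 h2 h3
  have h4 := key a b
  rw [show a - (c + d - b) = a + b - (c + d) by ring] at h4
  rw [h1, h2, h3, h4, key, key]
  ring

theorem IsThetaLike.partial_fractions_pair {f : ℂ → ℂ} (hf : IsThetaLike f) {ι : Type*}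
    [DecidableEq ι] {a b : ι} (hab : a ≠ b) (x y : ι → ℂ)
    (hsum : ∑ i ∈ {a, b}, x i = ∑ i ∈ {a, b}, y i) :
    ∑ l ∈ {a, b}, (∏ j ∈ {a, b}, f (x l - y j)) / ∏ j ∈ ({a, b} : Finset ι).erase l, f (x l - x j)
      = 0 := by
  rw [Finset.sum_pair hab, Finset.sum_pair hab] at hsum
  have e1 : ({a, b} : Finset ι).erase a = {b} := Finset.erase_insert (by simpa using hab)
  have e2 : ({a, b} : Finset ι).erase b = {a} := by
    rw [Finset.pair_comm]; exact Finset.erase_insert (by simpa using hab.symm)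
  rw [Finset.sum_pair hab, Finset.prod_pair hab, Finset.prod_pair hab, e1, e2,
    Finset.prod_singleton, Finset.prod_singleton]
  have h3 : x b - y a = -(x a - y b) := by linear_combination hsum
  have h4 : x b - y b = -(x a - y a) := by linear_combination hsum
  rw [h3, h4, hf.odd, hf.odd, hf.map_sub_comm (x b) (x a)]
  rw [neg_mul_neg, div_neg, mul_comm (f (x a - y b)), add_neg_cancel]

/-- Analytically this is the vanishing of the sum of the residues of ∏ f(x - y_j)/f(x - x_j),
elliptic because the sums agree. The proof is algebraic: the three-term relation rewrites the two
numerators at y_a, y_b through pairs containing a zero at x_a or x_b, and such a zero removes one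
point, which allows induction on the number of points. -/
theorem IsThetaLike.partial_fractions {f : ℂ → ℂ} (hf : IsThetaLike f) {ι : Type*} [DecidableEq ι]
    (S : Finset ι) (x y : ι → ℂ) (hx : ∀ i ∈ S, ∀ j ∈ S, i ≠ j → f (x i - x j) ≠ 0)
    (hsum : ∑ i ∈ S, x i = ∑ i ∈ S, y i) :
    ∑ l ∈ S, (∏ j ∈ S, f (x l - y j)) / ∏ j ∈ S.erase l, f (x l - x j) = 0 := by
  induction hn : S.card using Nat.strong_induction_on generalizing S y with
  | _ n ih =>
    subst hn
    rcases Nat.lt_or_ge S.card 2 with h2 | h2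
    · interval_cases h : S.card
      · rw [Finset.card_eq_zero.mp h, Finset.sum_empty]
      · obtain ⟨a, rfl⟩ := Finset.card_eq_one.mp h
        simp only [Finset.sum_singleton, Finset.prod_singleton] at hsum ⊢
        rw [hsum, sub_self, hf.map_zero, zero_div]
    obtain ⟨a, ha, b, hb, hab⟩ := Finset.one_lt_card.mp h2
    have hbe : b ∈ S.erase a := Finset.mem_erase.mpr ⟨hab.symm, hb⟩
    have hae : a ∈ S.erase b := Finset.mem_erase.mpr ⟨hab, ha⟩
    -- removal of one point
    have removal : ∀ (y : ι → ℂ), ∑ i ∈ S, x i = ∑ i ∈ S, y i → ∀ c o, c ∈ S → o ∈ S.erase c →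
        ∑ l ∈ S, f (x l - x c) * f (x l - (y c + y o - x c)) *
          (∏ j ∈ (S.erase c).erase o, f (x l - y j)) / ∏ j ∈ S.erase l, f (x l - x j) = 0 := by
      intro y hsum c o hc ho
      -- The term `l = c` contains f(0) = 0; elsewhere f(x_l - x_c) cancels, leaving the identity
      -- for the smaller set with y_o replaced by y_c + y_o - x_c.
      rw [← Finset.add_sum_erase S _ hc, sub_self, hf.map_zero, zero_mul, zero_mul, zero_div,
        zero_add]
      have h3 : ∑ i ∈ S.erase c, x i =
          ∑ i ∈ S.erase c, Function.update y o (y c + y o - x c) i := by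
        rw [← Finset.add_sum_erase (S.erase c) (Function.update y o (y c + y o - x c)) ho,
          Function.update_self]
        have h4 : ∑ i ∈ (S.erase c).erase o, Function.update y o (y c + y o - x c) i =
            ∑ i ∈ (S.erase c).erase o, y i := Finset.sum_congr rfl fun i hi =>
          Function.update_of_ne (Finset.ne_of_mem_erase hi) _ _
        rw [h4]
        have h5 := Finset.add_sum_erase S x hc
        have h6 := Finset.add_sum_erase S y hc
        have h7 := Finset.add_sum_erase (S.erase c) y ho
        linear_combination h5 + hsum - h6 - h7
      have h4 := ih (S.erase c).card (Finset.card_lt_card (Finset.erase_ssubset hc)) (S.erase c)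
        (Function.update y o (y c + y o - x c))
        (fun i hi j hj => hx i (Finset.mem_of_mem_erase hi) j (Finset.mem_of_mem_erase hj)) h3 rfl
      rw [← h4]
      refine Finset.sum_congr rfl fun l hl => ?_
      have hlc : l ≠ c := Finset.ne_of_mem_erase hl
      have hcl : c ∈ S.erase l := Finset.mem_erase.mpr ⟨hlc.symm, hc⟩
      rw [← Finset.mul_prod_erase (S.erase l) _ hcl, ← Finset.mul_prod_erase (S.erase c) _ ho,
        Function.update_self, Finset.erase_right_comm (a := c) (b := l)]
      have h5 : ∏ i ∈ (S.erase c).erase o, f (x l - Function.update y o (y c + y o - x c) i) =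
          ∏ i ∈ (S.erase c).erase o, f (x l - y i) := Finset.prod_congr rfl fun i hi => by
        rw [Function.update_of_ne (Finset.ne_of_mem_erase hi)]
      rw [h5, mul_assoc, mul_div_mul_left _ _ (hx l (Finset.mem_of_mem_erase hl) c hc hlc)]
    -- the generic case
    have generic : ∀ y : ι → ℂ, ∑ i ∈ S, x i = ∑ i ∈ S, y i →
        f (x a + x b - (y a + y b)) ≠ 0 →
        ∑ l ∈ S, (∏ j ∈ S, f (x l - y j)) / ∏ j ∈ S.erase l, f (x l - x j) = 0 := by
      intro y hsum hW
      have hW' : f (x a - x b) * f (x a + x b - (y a + y b)) ≠ 0 :=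
        mul_ne_zero (hx a ha b hb hab) hW
      refine (mul_eq_zero.mp ?_).resolve_right hW'
      have hA := removal y hsum a b ha hbe
      have hB := removal y hsum b a hb hae
      rw [Finset.sum_mul]
      have h3 : ∀ l ∈ S, (∏ j ∈ S, f (x l - y j)) / (∏ j ∈ S.erase l, f (x l - x j)) *
          (f (x a - x b) * f (x a + x b - (y a + y b))) =
          f (x l - x b) * f (x l - (y b + y a - x b)) *
            (∏ j ∈ (S.erase b).erase a, f (x l - y j)) / (∏ j ∈ S.erase l, f (x l - x j)) *
            (f (x a - y a) * f (x a - y b)) -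
          f (x l - x a) * f (x l - (y a + y b - x a)) *
            (∏ j ∈ (S.erase a).erase b, f (x l - y j)) / (∏ j ∈ S.erase l, f (x l - x j)) *
            (f (x b - y a) * f (x b - y b)) := by
        intro l _
        rw [← Finset.mul_prod_erase S _ ha, ← Finset.mul_prod_erase (S.erase a) _ hbe,
          Finset.erase_right_comm (a := b) (b := a), add_comm (y b) (y a)]
        linear_combination ((∏ j ∈ (S.erase a).erase b, f (x l - y j)) /
          (∏ j ∈ S.erase l, f (x l - x j))) * hf.three_term (x l) (x a) (x b) (y a) (y b)
      rw [Finset.sum_congr rfl h3, Finset.sum_sub_distrib, ← Finset.sum_mul, ← Finset.sum_mul,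
        hA, hB, zero_mul, zero_mul, sub_zero]
    -- With exactly two points the sum condition makes x_a + x_b - (y_a + y_b) zero, so the generic
    -- case never applies and the two terms are compared directly.
    rcases h2.eq_or_lt with h2 | h2
    · obtain ⟨a', b', hab', rfl⟩ := Finset.card_eq_two.mp h2.symm
      exact hf.partial_fractions_pair hab' x y hsum
    · obtain ⟨c, hc⟩ : ((S.erase a).erase b).Nonempty := by
        rw [← Finset.card_pos, Finset.card_erase_of_mem hbe, Finset.card_erase_of_mem ha]
        omega
      have hcb : c ≠ b := Finset.ne_of_mem_erase hc
      have hca : c ≠ a := Finset.ne_of_mem_erase (Finset.mem_of_mem_erase hc)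
      have hcS : c ∈ S := Finset.mem_of_mem_erase (Finset.mem_of_mem_erase hc)
      -- With a third point c, move ε from y_b to y_c: the total is preserved while x_a + x_b - (y_a
      -- + y_b) leaves the zeros of f. Continuity at ε = 0 finishes.
      let Y : ℂ → ι → ℂ := fun ε j => y j + ε * ((if j = c then 1 else 0) - if j = b then 1 else 0)
      have hY0 : Y 0 = y := by funext j; simp [Y]
      have hYs : ∀ ε, ∑ i ∈ S, x i = ∑ i ∈ S, Y ε i := by
        intro ε
        simp only [Y]
        rw [Finset.sum_add_distrib, ← Finset.mul_sum, Finset.sum_sub_distrib, Finset.sum_ite_eq',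
          Finset.sum_ite_eq', if_pos hcS, if_pos hb, hsum]
        ring
      rw [← hY0]
      refine eq_zero_of_eventually (g := fun ε => ∑ l ∈ S, (∏ j ∈ S, f (x l - Y ε j)) /
        ∏ j ∈ S.erase l, f (x l - x j)) ?_ ?_
      · have := hf.cont
        simp only [Y]
        refine continuous_finsetSum _ fun l _ => Continuous.div_const ?_ _
        exact continuous_finsetProd _ fun j _ => by fun_prop
      · filter_upwards [hf.ne (x a + x b - (y a + y b))] with ε hε
        refine generic (Y ε) (hYs ε) ?_
        have e1 : Y ε a = y a := by simp [Y, hca.symm, hab]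
        have e2 : Y ε b = y b - ε := by simp [Y, hcb.symm]; ring
        rw [e1, e2]
        convert hε using 2
        ring

end
end QCoset

/-! ### The symmetrization identity -/

namespace QCoset
noncomputable section

open Filter Topology

/-- Partial fractions with one extra point: x = (0, A_i) and y = (-n, A_i + 1), whose sums agree
since there are n points A_i. The term of the extra point becomes the right-hand side. -/
theorem IsThetaLike.sum_shift_generic {f : ℂ → ℂ} (hf : IsThetaLike f) {ι : Type*} [Fintype ι]
    [DecidableEq ι] (A : ι → ℂ) (hA : ∀ i j, i ≠ j → f (A i - A j) ≠ 0) (hA0 : ∀ i, f (A i) ≠ 0)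
    (h1 : f 1 ≠ 0) :
    ∑ l, f (A l + Fintype.card ι) * ∏ j ∈ Finset.univ.erase l,
      (f (A l - A j - 1) / f (A l - A j) * f (A j)) =
    f (Fintype.card ι) / f 1 * ∏ i, f (A i + 1) := by
  let x : Option ι → ℂ := fun o => o.elim 0 A
  let y : Option ι → ℂ := fun o => o.elim (-(Fintype.card ι : ℂ)) fun i => A i + 1
  have hx : ∀ i ∈ Finset.univ, ∀ j ∈ Finset.univ, i ≠ j → f (x i - x j) ≠ 0 := by
    rintro (_ | i) - (_ | j) - hij
    · exact absurd rfl hij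
    · simp only [x, Option.elim]; rw [zero_sub, hf.odd]; exact neg_ne_zero.mpr (hA0 j)
    · simp only [x, Option.elim]; rw [sub_zero]; exact hA0 i
    · simp only [x, Option.elim]; exact hA i j fun h => hij (by rw [h])
  have hs : ∑ i, x i = ∑ i, y i := by
    rw [Fintype.sum_option, Fintype.sum_option]
    simp only [x, y, Option.elim]
    rw [Finset.sum_add_distrib]
    simp
  have h2 := hf.partial_fractions Finset.univ x y hx hs
  have e1 : (Finset.univ : Finset (Option ι)).erase none = Finset.univ.map Function.Embedding.some := by
    ext (_ | i) <;> simp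
  have e2 : ∀ l : ι, (Finset.univ : Finset (Option ι)).erase (some l) =
      Finset.insertNone (Finset.univ.erase l) := by
    intro l; ext (_ | i) <;> simp
  rw [Fintype.sum_option, e1, Finset.prod_map, Fintype.prod_option] at h2
  simp only [e2, Finset.prod_insertNone, Fintype.prod_option] at h2
  simp only [x, y, Option.elim, Function.Embedding.some_apply] at h2
  have h3 : ∏ i, f (0 - (A i + 1)) / f (0 - A i) = ∏ i, f (A i + 1) / f (A i) :=
    Finset.prod_congr rfl fun i _ => by
      rw [zero_sub, zero_sub, hf.odd, hf.odd, neg_div_neg_eq]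
  rw [mul_div_assoc, ← Finset.prod_div_distrib, h3, Finset.prod_div_distrib, zero_sub, neg_neg] at h2
  have hP : ∏ i, f (A i) ≠ 0 := Finset.prod_ne_zero_iff.mpr fun i _ => hA0 i
  have h4 : ∀ l, f (A l - -(Fintype.card ι : ℂ)) * (∏ j, f (A l - (A j + 1))) /
      (f (A l - 0) * ∏ j ∈ Finset.univ.erase l, f (A l - A j)) =
      -(f 1 / ∏ i, f (A i)) * (f (A l + Fintype.card ι) * ∏ j ∈ Finset.univ.erase l,
      (f (A l - A j - 1) / f (A l - A j) * f (A j))) := by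
    intro l
    rw [Finset.prod_mul_distrib, Finset.prod_div_distrib,
      ← Finset.mul_prod_erase Finset.univ _ (Finset.mem_univ l),
      ← Finset.mul_prod_erase Finset.univ (fun i => f (A i)) (Finset.mem_univ l)]
    have e3 : A l - (A l + 1) = -1 := by ring
    have e4 : ∏ j ∈ Finset.univ.erase l, f (A l - (A j + 1)) =
        ∏ j ∈ Finset.univ.erase l, f (A l - A j - 1) :=
      Finset.prod_congr rfl fun j _ => by rw [sub_add_eq_sub_sub]
    rw [e3, e4, hf.odd, sub_neg_eq_add, sub_zero]
    have e5 : ∏ j ∈ Finset.univ.erase l, f (A j) ≠ 0 :=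
      Finset.prod_ne_zero_iff.mpr fun i _ => hA0 i
    have e6 : ∏ j ∈ Finset.univ.erase l, f (A l - A j) ≠ 0 :=
      Finset.prod_ne_zero_iff.mpr fun i hi => hA l i (Finset.ne_of_mem_erase hi).symm
    have e7 := hA0 l
    field_simp
  rw [Finset.sum_congr rfl fun l _ => h4 l, ← Finset.mul_sum] at h2
  field_simp at h2 ⊢
  linear_combination -h2

/-- Shifting all A_i by the same ε leaves the differences alone and makes every f(A_i) nonzero, so
the last condition of `sum_shift_generic` is dropped by continuity. -/
theorem IsThetaLike.sum_shift {f : ℂ → ℂ} (hf : IsThetaLike f) {ι : Type*} [Fintype ι]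
    [DecidableEq ι] (A : ι → ℂ) (hA : ∀ i j, i ≠ j → f (A i - A j) ≠ 0) (h1 : f 1 ≠ 0) :
    ∑ l, f (A l + Fintype.card ι) * ∏ j ∈ Finset.univ.erase l,
      (f (A l - A j - 1) / f (A l - A j) * f (A j)) =
    f (Fintype.card ι) / f 1 * ∏ i, f (A i + 1) := by
  have hc := hf.cont
  have h := eq_zero_of_eventually (g := fun ε => ∑ l, f (A l + ε + Fintype.card ι) *
      ∏ j ∈ Finset.univ.erase l, (f (A l - A j - 1) / f (A l - A j) * f (A j + ε)) -
      f (Fintype.card ι) / f 1 * ∏ i, f (A i + ε + 1)) ?_ ?_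
  · simpa only [add_zero, sub_eq_zero] using h
  · refine Continuous.sub (continuous_finsetSum _ fun l _ => Continuous.mul (by fun_prop)
      (continuous_finsetProd _ fun j _ => by fun_prop))
      (Continuous.mul continuous_const (continuous_finsetProd _ fun j _ => by fun_prop))
  · filter_upwards [eventually_all.mpr fun i => hf.ne (A i)] with ε hε
    have h2 := hf.sum_shift_generic (fun i => A i + ε)
      (fun i j hij => by rw [add_sub_add_right_eq_sub]; exact hA i j hij) hε h1
    simp only [add_sub_add_right_eq_sub] at h2
    rw [h2, sub_self]

theorem prod_perm_pairs {n : ℕ} {R : Type*} [CommRing R] (σ : Equiv.Perm (Fin n))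
    (f : Fin n → Fin n → R) (hf : ∀ i j, f i j = f j i) :
    ∏ i, ∏ j ∈ Finset.Ioi i, f (σ i) (σ j) = ∏ i, ∏ j ∈ Finset.Ioi i, f i j := by
  -- Multiplying by an antisymmetric sign gives products that change by sign(σ); this sign is the
  -- same for f e and for e alone, and cancels.
  let e : Fin n → Fin n → R := fun i j => if i < j then 1 else if j < i then -1 else 0
  have he : ∀ i j, e i j = -e j i := by
    intro i j
    rcases lt_trichotomy i j with h | h | h
    · simp [e, h, h.not_gt]
    · simp [e, h]
    · simp [e, h, h.not_gt]
  have h1 := σ.prod_Ioi_comp_eq_sign_mul_prod (f := fun i j => f i j * e i j)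
    (fun i j => by rw [hf, he, mul_neg])
  have h2 := σ.prod_Ioi_comp_eq_sign_mul_prod (f := e) he
  have h3 : ∏ i, ∏ j ∈ Finset.Ioi i, e i j = 1 :=
    Finset.prod_eq_one fun i _ => Finset.prod_eq_one fun j hj => by
      simp [e, Finset.mem_Ioi.mp hj]
  simp only [Finset.prod_mul_distrib] at h1
  rw [h2, h3, mul_one, mul_one, mul_comm] at h1
  have h4 : IsUnit ((σ.sign : ℤ) : R) := (Units.isUnit σ.sign).map (Int.castRingHom R)
  exact h4.mul_left_cancel h1

/-- The ordered product whose symmetrization is computed below. -/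
def orderedProd (f : ℂ → ℂ) {n : ℕ} (u : Fin n → ℂ) (a : ℂ) : ℂ :=
  (∏ i, ∏ j ∈ Finset.Ioi i, f (u i - u j - 1) / f (u i - u j)) * ∏ i, f (u i + a - 2 * (i : ℕ))

theorem orderedProd_succ (f : ℂ → ℂ) {n : ℕ} (u : Fin (n + 1) → ℂ) (a : ℂ) :
    orderedProd f u a = f (u 0 + a) *
      (∏ j : Fin n, f (u 0 - u j.succ - 1) / f (u 0 - u j.succ)) *
      orderedProd f (fun i : Fin n => u i.succ) (a - 2) := by
  unfold orderedProd
  rw [Fin.prod_univ_succ, Fin.prod_univ_succ (fun i : Fin (n + 1) => f (u i + a - 2 * (i : ℕ)))]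
  simp only [Fin.prod_Ioi_zero, Fin.prod_Ioi_succ, Fin.val_zero, Fin.val_succ]
  have : ∀ i : Fin n, f (u i.succ + a - 2 * ((i + 1 : ℕ) : ℂ)) =
      f (u i.succ + (a - 2) - 2 * (i : ℕ)) := fun i => by congr 1; push_cast; ring
  simp only [this, Nat.cast_zero, mul_zero, sub_zero]
  ring

/-- A permutation decomposed by `decomposeFin` with σ 0 = l reaches the indices other than l through
`swap 0 l` of successors. -/
theorem prod_swap_succ {n : ℕ} {R : Type*} [CommMonoid R] (l : Fin (n + 1)) (g : Fin (n + 1) → R) :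
    ∏ j : Fin n, g (Equiv.swap 0 l j.succ) = ∏ j ∈ Finset.univ.erase l, g j := by
  have h1 : (Finset.univ.erase l : Finset (Fin (n + 1))) =
      Finset.univ.map ((Fin.succEmb n).trans (Equiv.swap 0 l).toEmbedding) := by
    ext j
    simp only [Finset.mem_erase, Finset.mem_univ, and_true, Finset.mem_map, true_and,
      Function.Embedding.trans_apply]
    constructor
    · intro h
      have h2 : Equiv.swap 0 l j ≠ 0 := by
        intro h3
        rw [Equiv.swap_apply_eq_iff, Equiv.swap_apply_left] at h3
        exact h h3
      refine ⟨(Equiv.swap 0 l j).pred h2, ?_⟩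
      simp
    · rintro ⟨i, rfl⟩ h
      have h3 : Equiv.swap 0 l i.succ = l := h
      rw [Equiv.swap_apply_eq_iff, Equiv.swap_apply_right] at h3
      exact Fin.succ_ne_zero i h3
  rw [h1, Finset.prod_map]
  rfl

/-- The symmetrization of the ordered product. -/
theorem IsThetaLike.sum_perm_orderedProd {f : ℂ → ℂ} (hf : IsThetaLike f) (h1 : f 1 ≠ 0) (n : ℕ)
    (u : Fin n → ℂ) (hu : ∀ i j, i ≠ j → f (u i - u j) ≠ 0) (a : ℂ) :
    ∑ σ : Equiv.Perm (Fin n), orderedProd f (fun i => u (σ i)) a =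
      (∏ i ∈ Finset.range n, f ((i : ℂ) + 1)) / f 1 ^ n * ∏ i, f (u i + a + 1 - n) := by
  induction n generalizing a with
  | zero => simp [orderedProd]
  | succ n ih =>
    -- Sort by l = σ 0. The other indices contribute the induction hypothesis at a - 2, and the sum
    -- over l is `sum_shift` for the points u_l + a - (n + 1).
    rw [← Equiv.Perm.decomposeFin.symm.sum_comp, Fintype.sum_prod_type]
    have h2 : ∀ l : Fin (n + 1), ∑ e : Equiv.Perm (Fin n),
        orderedProd f (fun i => u (Equiv.Perm.decomposeFin.symm (l, e) i)) a =
        (∏ i ∈ Finset.range n, f ((i : ℂ) + 1)) / f 1 ^ n *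
        (f ((u l + a - (n + 1 : ℕ)) + Fintype.card (Fin (n + 1))) * ∏ j ∈ Finset.univ.erase l,
          (f ((u l + a - (n + 1 : ℕ)) - (u j + a - (n + 1 : ℕ)) - 1) /
            f ((u l + a - (n + 1 : ℕ)) - (u j + a - (n + 1 : ℕ))) * f (u j + a - (n + 1 : ℕ)))) := by
      intro l
      have h3 : ∀ e : Equiv.Perm (Fin n),
          orderedProd f (fun i => u (Equiv.Perm.decomposeFin.symm (l, e) i)) a =
          f (u l + a) * (∏ j ∈ Finset.univ.erase l, f (u l - u j - 1) / f (u l - u j)) *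
          orderedProd f (fun i => (fun i : Fin n => u (Equiv.swap 0 l i.succ)) (e i)) (a - 2) := by
        intro e
        rw [orderedProd_succ]
        simp only [Equiv.Perm.decomposeFin_symm_apply_zero,
          Equiv.Perm.decomposeFin_symm_apply_succ]
        rw [← prod_swap_succ l fun j => f (u l - u j - 1) / f (u l - u j)]
        rw [Equiv.prod_comp e fun j : Fin n => f (u l - u (Equiv.swap 0 l j.succ) - 1) /
          f (u l - u (Equiv.swap 0 l j.succ))]
      rw [Finset.sum_congr rfl fun e _ => h3 e, ← Finset.mul_sum, ih (fun i : Fin n => u (Equiv.swap 0 l i.succ))]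
      · rw [Finset.prod_mul_distrib, prod_swap_succ l fun i => f (u i + (a - 2) + 1 - n)]
        have e1 : ∀ j, f (u j + (a - 2) + 1 - n) = f (u j + a - (n + 1 : ℕ)) := fun j => by
          congr 1; push_cast; ring
        have e2 : u l + a - (n + 1 : ℕ) + Fintype.card (Fin (n + 1)) = u l + a := by
          rw [Fintype.card_fin]; ring
        simp only [e1, e2, sub_sub_sub_cancel_right, add_sub_add_right_eq_sub]
        ring
      · intro i j hij
        exact hu _ _ fun h => hij (Fin.succ_injective _ ((Equiv.swap 0 l).injective h))
    rw [Finset.sum_congr rfl fun l _ => h2 l, ← Finset.mul_sum,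
      hf.sum_shift (fun l => u l + a - (n + 1 : ℕ)) (fun i j hij => by
        rw [sub_sub_sub_cancel_right, add_sub_add_right_eq_sub]; exact hu i j hij) h1,
      Finset.prod_range_succ, Fintype.card_fin]
    have e1 : ∀ i, f (u i + a - (n + 1 : ℕ) + 1) = f (u i + a + 1 - (n + 1 : ℕ)) := fun i => by
      congr 1; ring
    simp only [e1]
    push_cast
    field_simp
    ring

end
end QCoset

/-! ### Wick's theorem for products of n operators -/

namespace QCoset
noncomputable section

/-- The contraction of two vertex operators: the scalar by which their product differs from the
normal ordered product. -/
def contraction (D : Params) (φ ψ : Field) : ℂ :=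
  Complex.exp (∑ j, φ (.P j) * momShift D ψ j) * ∑' e, gradedExp (contr D φ ψ) e

/-- The absolute convergence of the contraction. -/
def Contractible (D : Params) (φ ψ : Field) : Prop :=
  Summable fun e => ‖gradedExp (contr D φ ψ) e‖

theorem vop_add (D : Params) (φ : Field) (p : Mom) (v v' : Fock) :
    vop D φ p (v + v') = vop D φ p v + vop D φ p v' := by
  unfold vop
  rw [expAnn_add, MvPolynomial.coe_add, mul_add, smul_add]

theorem vop_smul (D : Params) (φ : Field) (p : Mom) (a : ℂ) (v : Fock) :
    vop D φ p (a • v) = a • vop D φ p v := by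
  unfold vop
  rw [expAnn_smul, MvPolynomial.coe_smul, mul_smul_comm, smul_comm]

theorem vop_sum (D : Params) (φ : Field) (p : Mom) {ι : Type*} (s : Finset ι) (v : ι → Fock) :
    vop D φ p (∑ i ∈ s, v i) = ∑ i ∈ s, vop D φ p (v i) := by
  classical
  induction s using Finset.induction_on with
  | empty => simpa using vop_smul D φ p 0 0
  | insert i s hi ih => rw [Finset.sum_insert hi, Finset.sum_insert hi, vop_add, ih]

/-- The scalar part of the zero modes. -/
def zeroWeight (φ : Field) (p : Mom) : ℂ := Complex.exp (∑ j, φ (.P j) * p j)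

/-- The sums of the terms of total degree `e`. -/
def pairSum (D : Params) (φ ψ : Field) (v : Fock) (w : Idx →₀ ℕ) (e : ℕ) : ℂ :=
  ∑ z ∈ Finset.HasAntidiagonal.antidiagonal e, pairTerm D φ ψ v w z

theorem pairSum_eq_zero (D : Params) (φ ψ : Field) (v : Fock) (w : Idx →₀ ℕ) (e : ℕ)
    (he : e ∉ Finset.range (deg w + polyDeg v + 1)) : pairSum D φ ψ v w e = 0 := by
  refine Finset.sum_eq_zero fun z hz => ?_
  rw [Finset.HasAntidiagonal.mem_antidiagonal] at hz
  rw [Finset.mem_range] at he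
  by_cases h : deg w < z.1
  · exact pairTerm_eq_zero_left _ _ _ _ _ _ h
  · exact pairTerm_eq_zero_right _ _ _ _ _ _ (by omega)

theorem coeff_vop_comp_vop (D : Params) (φ ψ : Field) (p p' : Mom) (v : Fock) (w : Idx →₀ ℕ)
    (d : ℕ) :
    MvPowerSeries.coeff w (vop D φ p' (comp d (vop D ψ p v))) =
      zeroWeight φ p' * zeroWeight ψ p * ∑ y ∈ Finset.HasAntidiagonal.antidiagonal d,
        gradedExp (contr D φ ψ) y.1 * pairSum D φ ψ v w y.2 := by
  have h1 : vop D ψ p v = zeroWeight ψ p • (expCre ψ * (expAnn D ψ v : CFock)) := rfl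
  rw [h1, comp_smul, vop_smul, MvPowerSeries.coeff_smul]
  unfold vop
  rw [MvPowerSeries.coeff_smul, coeff_expCre_mul_expAnn_comp]
  unfold zeroWeight pairSum
  ring

/-- Cauchy product of an absolutely convergent series with a finitely supported one. The momentum
shift caused by the right operator, read by the P_j of the left one, is the zero-mode factor of the
contraction. -/
theorem hasSum_vop_comp_vop (D : Params) (φ ψ : Field) (h : Contractible D φ ψ) (p : Mom) (v : Fock)
    (w : Idx →₀ ℕ) :
    HasSum (fun d => MvPowerSeries.coeff w (vop D φ (p + momShift D ψ) (comp d (vop D ψ p v))))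
      (contraction D φ ψ * MvPowerSeries.coeff w (vop D (φ + ψ) p v)) := by
  simp_rw [coeff_vop_comp_vop]
  have h2 : Summable fun e => ‖pairSum D φ ψ v w e‖ :=
    summable_of_ne_finset_zero (s := Finset.range (deg w + polyDeg v + 1)) fun e he => by
      rw [pairSum_eq_zero _ _ _ _ _ _ he, norm_zero]
  have h3 := tsum_mul_tsum_eq_tsum_sum_antidiagonal_of_summable_norm h h2
  have h4 := (summable_norm_sum_mul_antidiagonal_of_summable_norm h h2).of_norm.hasSum
  rw [← h3] at h4
  have h5 : ∑' e, pairSum D φ ψ v w e =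
      MvPowerSeries.coeff w (expCre (φ + ψ) * (expAnn D (φ + ψ) v : CFock)) := by
    rw [tsum_eq_sum fun e he => pairSum_eq_zero _ _ _ _ _ e he]
    exact sum_pairTerm D φ ψ v w
  rw [h5] at h4
  have h7 := h4.mul_left (zeroWeight φ (p + momShift D ψ) * zeroWeight ψ p)
  suffices h8 : contraction D φ ψ * MvPowerSeries.coeff w (vop D (φ + ψ) p v) =
      zeroWeight φ (p + momShift D ψ) * zeroWeight ψ p *
        ((∑' e, gradedExp (contr D φ ψ) e) *
          MvPowerSeries.coeff w (expCre (φ + ψ) * (expAnn D (φ + ψ) v : CFock))) by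
    rw [h8]; exact h7
  unfold contraction vop zeroWeight
  rw [MvPowerSeries.coeff_smul]
  have h6 : Complex.exp (∑ j, φ (.P j) * (p + momShift D ψ) j) * Complex.exp (∑ j, ψ (.P j) * p j) =
      Complex.exp (∑ j, φ (.P j) * momShift D ψ j) *
        Complex.exp (∑ j, (φ + ψ) (.P j) * p j) := by
    rw [← Complex.exp_add, ← Complex.exp_add, ← Finset.sum_add_distrib, ← Finset.sum_add_distrib]
    congr 1
    refine Finset.sum_congr rfl fun j _ => ?_
    simp only [Pi.add_apply]
    ring
  rw [h6]
  ring

theorem momShift_sum (D : Params) {ι : Type*} (s : Finset ι) (ψ : ι → Field) :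
    momShift D (∑ i ∈ s, ψ i) = ∑ i ∈ s, momShift D (ψ i) := by
  funext j
  simp only [momShift, Finset.sum_apply, Finset.sum_mul]

theorem gradedExp_zero_of_notMem (e : ℕ) (he : e ∉ Finset.range 1) : gradedExp 0 e = 0 :=
  gradedExp_zero_left e fun h => he (by rw [h]; simp)

/-- Contractions are bilinear in the fields and enter through exponentials, so they multiply;
absolute convergence survives Cauchy products. -/
theorem contractible_sum (D : Params) (φ : Field) {ι : Type*} (s : Finset ι) (ψ : ι → Field)
    (h : ∀ i ∈ s, Contractible D φ (ψ i)) :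
    Contractible D φ (∑ i ∈ s, ψ i) ∧
      contraction D φ (∑ i ∈ s, ψ i) = ∏ i ∈ s, contraction D φ (ψ i) := by
  classical
  induction s using Finset.induction_on with
  | empty =>
    have h1 : ∀ e ∉ Finset.range 1, gradedExp (contr D φ 0) e = 0 := fun e he => by
      rw [contr_zero_right, gradedExp_zero_of_notMem e he]
    refine ⟨summable_of_ne_finset_zero (s := Finset.range 1) fun e he => ?_, ?_⟩
    · rw [Finset.sum_empty, h1 e he, norm_zero]
    · unfold contraction
      rw [Finset.sum_empty, tsum_eq_sum h1]
      simp [gradedExp_zero_right, momShift]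
  | insert i s hi ih =>
    obtain ⟨h1, h2⟩ := ih fun j hj => h j (Finset.mem_insert_of_mem hj)
    have h3 := h i (Finset.mem_insert_self i s)
    rw [Finset.sum_insert hi, Finset.prod_insert hi, ← h2]
    unfold Contractible contraction at *
    rw [contr_add_right]
    simp_rw [gradedExp_add]
    refine ⟨summable_norm_sum_mul_antidiagonal_of_summable_norm h3 h1, ?_⟩
    rw [← tsum_mul_tsum_eq_tsum_sum_antidiagonal_of_summable_norm h3 h1]
    have h4 : Complex.exp (∑ j, φ (.P j) * momShift D (ψ i + ∑ i ∈ s, ψ i) j) =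
        Complex.exp (∑ j, φ (.P j) * momShift D (ψ i) j) *
        Complex.exp (∑ j, φ (.P j) * momShift D (∑ i ∈ s, ψ i) j) := by
      rw [← Complex.exp_add, ← Finset.sum_add_distrib]
      congr 1
      refine Finset.sum_congr rfl fun j _ => ?_
      simp only [momShift, Pi.add_apply]
      ring
    rw [h4]
    ring

/-- A uniform majorant for the contractions with a sum of fields. -/
theorem exists_majorant_sum (D : Params) {ι : Type*} (s : Finset ι) (g : ι → ℕ → ℝ)
    (hg : ∀ i ∈ s, Summable (g i)) :
    ∃ G : ℕ → ℝ, Summable G ∧ (∀ e, 0 ≤ G e) ∧ ∀ (φ : Field) (ψ : ι → Field),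
      (∀ i ∈ s, ∀ e, ‖gradedExp (contr D φ (ψ i)) e‖ ≤ g i e) →
      ∀ e, ‖gradedExp (contr D φ (∑ i ∈ s, ψ i)) e‖ ≤ G e := by
  classical
  induction s using Finset.induction_on with
  | empty =>
    refine ⟨fun e => if e = 0 then 1 else 0, ?_, fun e => by dsimp only; split_ifs <;> norm_num, ?_⟩
    · exact summable_of_ne_finset_zero (s := Finset.range 1) fun e he => by
        rw [if_neg]; intro h; exact he (by rw [h]; simp)
    · intro φ ψ _ e
      rw [Finset.sum_empty, contr_zero_right]
      dsimp only
      split_ifs with h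
      · rw [h, gradedExp_zero_right, norm_one]
      · rw [gradedExp_zero_left e h, norm_zero]
  | insert i s hi ih =>
    obtain ⟨G, hG, hG0, h⟩ := ih fun j hj => hg j (Finset.mem_insert_of_mem hj)
    have hgi := hg i (Finset.mem_insert_self i s)
    have h1 := summable_norm_sum_mul_antidiagonal_of_summable_norm (R := ℝ)
      (f := fun e => ‖g i e‖) (g := G) (by simpa using hgi.norm)
      (by simpa [abs_of_nonneg, hG0] using hG)
    refine ⟨_, h1, fun e => norm_nonneg _, fun φ ψ hψ e => ?_⟩
    rw [Finset.sum_insert hi, contr_add_right, gradedExp_add]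
    refine le_trans (norm_sum_le _ _) (le_trans (Finset.sum_le_sum fun y _ => ?_) (le_abs_self _))
    rw [norm_mul]
    refine mul_le_mul ((hψ i (Finset.mem_insert_self i s) _).trans (le_abs_self _))
      (h φ ψ (fun j hj => hψ j (Finset.mem_insert_of_mem hj)) _) (norm_nonneg _) (norm_nonneg _)

/-- The operator `∑ s(ε) :exp f(ε):`. -/
def opOf (D : Params) (s : Bool → Mom → ℂ) (f : Bool → Field) : Op := fun p v =>
  ∑ ε, s ε p • vop D (f ε) p v

theorem opOf_sum (D : Params) (s : Bool → Mom → ℂ) (f : Bool → Field) (p : Mom) {ι : Type*}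
    (t : Finset ι) (a : ι → ℂ) (v : ι → Fock) :
    opOf D s f p (∑ i ∈ t, a i • v i) = ∑ i ∈ t, a i • opOf D s f p (v i) := by
  unfold opOf
  simp_rw [vop_sum, vop_smul, Finset.smul_sum]
  rw [Finset.sum_comm]
  exact Finset.sum_congr rfl fun i _ => Finset.sum_congr rfl fun ε _ => smul_comm _ _ _

/-- The scalar factor of a term in the product of `n` operators. -/
def prodScalar (D : Params) (δ p : Mom) {n : ℕ} (s : Fin n → Bool → Mom → ℂ)
    (f : Fin n → Bool → Field) (ε : Fin n → Bool) : ℂ :=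
  (∏ i, s i (ε i) (p + ((Fin.rev i : Fin n) : ℕ) • δ)) *
    ∏ i, ∏ j ∈ Finset.Ioi i, contraction D (f i (ε i)) (f j (ε j))

/-- The product of `n` operators. -/
def prodFormula (D : Params) (δ p : Mom) (v : Fock) {n : ℕ} (s : Fin n → Bool → Mom → ℂ)
    (f : Fin n → Bool → Field) : CFock :=
  ∑ ε : Fin n → Bool, prodScalar D δ p s f ε • vop D (∑ i, f i (ε i)) p v

theorem coeff_opOf_comp (D : Params) (δ p p' : Mom) (v : Fock) {n : ℕ} (s0 : Bool → Mom → ℂ)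
    (f0 : Bool → Field) (s : Fin n → Bool → Mom → ℂ) (f : Fin n → Bool → Field) (w : Idx →₀ ℕ)
    (d : ℕ) :
    MvPowerSeries.coeff w (opOf D s0 f0 p' (comp d (prodFormula D δ p v s f))) =
      ∑ ε : Fin n → Bool, prodScalar D δ p s f ε * ∑ ε0 : Bool,
        (s0 ε0 p' * MvPowerSeries.coeff w (vop D (f0 ε0) p'
          (comp d (vop D (∑ i, f i (ε i)) p v)))) := by
  unfold prodFormula
  rw [comp_sum, Finset.sum_congr rfl fun ε _ => comp_smul d _ _, opOf_sum, map_sum]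
  refine Finset.sum_congr rfl fun ε _ => ?_
  rw [MvPowerSeries.coeff_smul, opOf, map_sum]
  congr 1

/-- The new leftmost operator contracts with the sum of the other fields, which factors by
`contractible_sum`. It acts on the momentum shifted by all n others; counting by `Fin.rev` leaves
the momenta seen by the others unchanged. -/
theorem prodScalar_cons (D : Params) (δ p : Mom) {n : ℕ} (s : Fin (n + 1) → Bool → Mom → ℂ)
    (f : Fin (n + 1) → Bool → Field)
    (hc : ∀ i j, i < j → ∀ ε ε', Contractible D (f i ε) (f j ε')) (ε0 : Bool) (ε : Fin n → Bool) :
    prodScalar D δ p s f (Fin.cons ε0 ε : Fin (n + 1) → Bool) =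
      prodScalar D δ p (fun i : Fin n => s i.succ) (fun i => f i.succ) ε *
        (s 0 ε0 (p + n • δ) * contraction D (f 0 ε0) (∑ i, f (Fin.succ i) (ε i))) := by
  have hcs := (contractible_sum D (f 0 ε0) Finset.univ (fun i => f (Fin.succ i) (ε i))
    fun i _ => hc 0 i.succ (Fin.succ_pos i) _ _).2
  rw [hcs]
  unfold prodScalar
  rw [Fin.prod_univ_succ, Fin.prod_univ_succ]
  simp only [Fin.cons_zero, Fin.cons_succ, Fin.prod_Ioi_zero, Fin.prod_Ioi_succ, Fin.rev_zero,
    Fin.val_last, Fin.rev_succ, Fin.val_castSucc]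
  ring

/-- Inductive step of Wick's theorem: composing the leftmost operator with a product already in
normal ordered form is a finite combination of `hasSum_vop_comp_vop`. -/
theorem hasSum_opOf_comp (D : Params) (δ p : Mom) (v : Fock) {n : ℕ}
    (s : Fin (n + 1) → Bool → Mom → ℂ) (f : Fin (n + 1) → Bool → Field)
    (hδ : ∀ i ε, momShift D (f i ε) = δ)
    (hc : ∀ i j, i < j → ∀ ε ε', Contractible D (f i ε) (f j ε')) (w : Idx →₀ ℕ) :
    HasSum (fun d => MvPowerSeries.coeff w (opOf D (s 0) (f 0) (p + n • δ)
      (comp d (prodFormula D δ p v (fun i : Fin n => s i.succ) fun i => f i.succ))))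
      (MvPowerSeries.coeff w (prodFormula D δ p v s f)) := by
  have h2 : MvPowerSeries.coeff w (prodFormula D δ p v s f) =
      ∑ ε : Fin n → Bool,
        prodScalar D δ p (fun i : Fin n => s i.succ) (fun i => f i.succ) ε * ∑ ε0 : Bool,
        (s 0 ε0 (p + n • δ) * (contraction D (f 0 ε0) (∑ i, f (Fin.succ i) (ε i)) *
          MvPowerSeries.coeff w (vop D (f 0 ε0 + ∑ i, f (Fin.succ i) (ε i)) p v))) := by
    unfold prodFormula
    rw [← (Fin.consEquiv fun _ => Bool).sum_comp, Fintype.sum_prod_type, Finset.sum_comm, map_sum]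
    refine Finset.sum_congr rfl fun ε _ => ?_
    rw [map_sum, Finset.mul_sum]
    refine Finset.sum_congr rfl fun ε0 _ => ?_
    rw [MvPowerSeries.coeff_smul, Fin.sum_univ_succ]
    have hE : (Fin.consEquiv fun _ => Bool) (ε0, ε) = (Fin.cons ε0 ε : Fin (n + 1) → Bool) := rfl
    rw [hE, prodScalar_cons D δ p s f hc]
    simp only [Fin.cons_zero, Fin.cons_succ]
    rw [mul_assoc, mul_assoc]
  have h3 : ∀ ε : Fin n → Bool, p + n • δ = p + momShift D (∑ i, f (Fin.succ i) (ε i)) := by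
    intro ε
    rw [momShift_sum, Finset.sum_congr rfl fun i _ => hδ (Fin.succ i) (ε i), Finset.sum_const,
      Finset.card_univ, Fintype.card_fin]
  have key : ∀ (ε : Fin n → Bool) (ε0 : Bool),
      HasSum (fun d => MvPowerSeries.coeff w (vop D (f 0 ε0) (p + n • δ)
        (comp d (vop D (∑ i, f (Fin.succ i) (ε i)) p v))))
        (contraction D (f 0 ε0) (∑ i, f (Fin.succ i) (ε i)) *
          MvPowerSeries.coeff w (vop D (f 0 ε0 + ∑ i, f (Fin.succ i) (ε i)) p v)) := by
    intro ε ε0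
    rw [h3 ε]
    exact hasSum_vop_comp_vop D (f 0 ε0) (∑ i, f (Fin.succ i) (ε i))
      (contractible_sum D (f 0 ε0) Finset.univ (fun i => f (Fin.succ i) (ε i))
      fun i _ => hc 0 i.succ (Fin.succ_pos i) _ _).1 p v w
  rw [h2]
  rw [funext fun d => coeff_opOf_comp D δ p (p + n • δ) v (s 0) (f 0) (fun i : Fin n => s i.succ)
    (fun i => f i.succ) w d]
  have k1 : ∀ ε : Fin n → Bool, HasSum (fun d => ∑ ε0 : Bool,
      (s 0 ε0 (p + n • δ) * MvPowerSeries.coeff w (vop D (f 0 ε0) (p + n • δ)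
        (comp d (vop D (∑ i, f (Fin.succ i) (ε i)) p v))))) (∑ ε0 : Bool,
        (s 0 ε0 (p + n • δ) * (contraction D (f 0 ε0) (∑ i, f (Fin.succ i) (ε i)) *
          MvPowerSeries.coeff w (vop D (f 0 ε0 + ∑ i, f (Fin.succ i) (ε i)) p v)))) :=
    fun ε => hasSum_sum fun ε0 _ => HasSum.mul_left (s 0 ε0 (p + n • δ)) (key ε ε0)
  exact hasSum_sum fun ε _ => HasSum.mul_left
    (prodScalar D δ p (fun i : Fin n => s i.succ) (fun i => f i.succ) ε) (k1 ε)

theorem prodFormula_zero (D : Params) (δ p : Mom) (v : Fock) (s : Fin 0 → Bool → Mom → ℂ)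
    (f : Fin 0 → Bool → Field) : prodFormula D δ p v s f = (v : CFock) := by
  have h1 : vop D 0 p v = (v : CFock) := by
    have h2 : expCre 0 = 1 := by
      classical
      ext n
      rw [expCre_apply, MvPowerSeries.coeff_one]
      split_ifs with h
      · rw [h]; simp [expCoeff]
      · exact expCoeff_zero_left n h
    have h3 : expAnn D 0 v = v := by
      unfold expAnn
      simp
    unfold vop
    rw [h2, h3]
    simp
  simp [prodFormula, prodScalar, h1]

theorem opProd_ofFn (D : Params) (δ p : Mom) (v : Fock) {n : ℕ}
    (s : Fin n → Bool → Mom → ℂ) (f : Fin n → Bool → Field)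
    (hδ : ∀ i ε, momShift D (f i ε) = δ)
    (hc : ∀ i j, i < j → ∀ ε ε', Contractible D (f i ε) (f j ε')) :
    OpProdConverges δ p v (List.ofFn fun i => opOf D (s i) (f i)) ∧
      opProd δ p v (List.ofFn fun i => opOf D (s i) (f i)) = prodFormula D δ p v s f := by
  induction n with
  | zero => exact ⟨trivial, (prodFormula_zero D δ p v s f).symm⟩
  | succ n ih =>
    obtain ⟨h1, h2⟩ := ih (fun i => s i.succ) (fun i => f i.succ) (fun i ε => hδ _ _)
      fun i j hij => hc _ _ (Fin.succ_lt_succ_iff.mpr hij)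
    have h3 := hasSum_opOf_comp D δ p v s f hδ hc
    rw [List.ofFn_succ]
    refine ⟨⟨h1, fun w => ?_⟩, ?_⟩
    · rw [h2, List.length_ofFn]
      exact (h3 w).summable
    · ext w
      have h4 := (h3 w).tsum_eq
      rw [← h2] at h4
      rw [← h4]
      change ∑' d, MvPowerSeries.coeff w (opOf D (s 0) (f 0)
        (p + (List.ofFn fun i : Fin n => opOf D (s i.succ) (f i.succ)).length • δ) _) = _
      rw [List.length_ofFn]

end
end QCoset

/-! ### Analytic dependence on the points -/

namespace QCoset
noncomputable section

open Filter Topology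

variable {E : Type*} [NormedAddCommGroup E] [NormedSpace ℂ E]

theorem analyticAt_coeff_expAnn (D : Params) (φ : E → Field) (u : E)
    (hφ : ∀ m, AnalyticAt ℂ (fun x => φ x m) u) (v : Fock) (w : Idx →₀ ℕ) :
    AnalyticAt ℂ (fun x => (expAnn D (φ x) v).coeff w) u := by
  classical
  induction v using MvPolynomial.induction_on generalizing w with
  | C a =>
    have : ∀ x, expAnn D (φ x) (MvPolynomial.C a) = MvPolynomial.C a := fun x => by
      simp [expAnn, MvPolynomial.algebraMap_eq]
    simp_rw [this]
    exact analyticAt_const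
  | add a b ha hb =>
    simp_rw [expAnn_add, MvPolynomial.coeff_add]
    exact (ha w).add (hb w)
  | mul_X a i ha =>
    have : ∀ x, expAnn D (φ x) (MvPolynomial.X i) =
        MvPolynomial.X i + MvPolynomial.C (φ x (.osc i.1 i.2) * comm D i) := fun x => by
      simp only [expAnn, MvPolynomial.aeval_X]
    simp_rw [expAnn_mul, this, mul_add, MvPolynomial.coeff_add,
      mul_comm _ (MvPolynomial.C _), MvPolynomial.coeff_C_mul, MvPolynomial.coeff_mul_X']
    refine AnalyticAt.add ?_ (((hφ _).mul analyticAt_const).mul (ha w))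
    split_ifs with h
    · exact ha _
    · exact analyticAt_const

theorem analyticAt_coeff_expCre (φ : E → Field) (u : E)
    (hφ : ∀ m, AnalyticAt ℂ (fun x => φ x m) u) (w : Idx →₀ ℕ) :
    AnalyticAt ℂ (fun x => MvPowerSeries.coeff w (expCre (φ x))) u := by
  have h : ∀ x, MvPowerSeries.coeff w (expCre (φ x)) =
      ∏ i ∈ w.support, φ x (.osc i.1 (-(i.2 : ℤ))) ^ w i / ((w i).factorial : ℂ) := fun x => rfl
  simp_rw [h]
  exact Finset.analyticAt_fun_prod _ fun i _ => ((hφ _).pow _).div_const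

theorem analyticAt_zeroWeight (φ : E → Field) (u : E)
    (hφ : ∀ m, AnalyticAt ℂ (fun x => φ x m) u) (p : Mom) :
    AnalyticAt ℂ (fun x => zeroWeight (φ x) p) u := by
  unfold zeroWeight
  exact (Finset.analyticAt_fun_sum _ fun j _ => (hφ _).mul analyticAt_const).cexp

/-- A fixed matrix element involves finitely many modes: it is a polynomial in them times the
exponential of the zero modes. -/
theorem analyticAt_coeff_vop (D : Params) (φ : E → Field) (u : E)
    (hφ : ∀ m, AnalyticAt ℂ (fun x => φ x m) u) (p : Mom) (v : Fock) (w : Idx →₀ ℕ) :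
    AnalyticAt ℂ (fun x => MvPowerSeries.coeff w (vop D (φ x) p v)) u := by
  classical
  unfold vop
  simp_rw [MvPowerSeries.coeff_smul, MvPowerSeries.coeff_mul, MvPolynomial.coeff_coe]
  exact (analyticAt_zeroWeight φ u hφ p).mul (Finset.analyticAt_fun_sum _ fun x _ =>
    (analyticAt_coeff_expCre φ u hφ _).mul (analyticAt_coeff_expAnn D φ u hφ _ _))

theorem expAnn_comp (D : Params) (φ : Field) (d : ℕ) (ψ : CFock) :
    expAnn D φ (comp d ψ) = ∑ n ∈ level d, MvPowerSeries.coeff n ψ •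
      expAnn D φ (MvPolynomial.monomial n 1) := by
  unfold comp
  rw [expAnn_sum]
  refine Finset.sum_congr rfl fun n _ => ?_
  rw [← expAnn_smul, MvPolynomial.smul_monomial, smul_eq_mul, mul_one]

theorem analyticAt_pairSum (D : Params) (φ ψ : E → Field) (u : E)
    (hφ : ∀ m, AnalyticAt ℂ (fun x => φ x m) u) (hψ : ∀ m, AnalyticAt ℂ (fun x => ψ x m) u)
    (v : Fock) (w : Idx →₀ ℕ) (e : ℕ) :
    AnalyticAt ℂ (fun x => pairSum D (φ x) (ψ x) v w e) u := by
  classical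
  unfold pairSum
  refine Finset.analyticAt_fun_sum _ fun z _ => ?_
  unfold pairTerm
  simp_rw [MvPowerSeries.coeff_mul, MvPolynomial.coeff_coe, MvPolynomial.coeff_mul, expAnn_comp,
    MvPolynomial.coeff_sum, MvPolynomial.coeff_smul, MvPolynomial.coeff_coe, coeff_comp]
  refine Finset.analyticAt_fun_sum _ fun y _ => (analyticAt_coeff_expCre φ u hφ _).mul
    (Finset.analyticAt_fun_sum _ fun y _ => AnalyticAt.mul ?_
      (Finset.analyticAt_fun_sum _ fun y _ => ?_))
  · split_ifs
    · exact analyticAt_coeff_expCre ψ u hψ _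
    · exact analyticAt_const
  · exact (analyticAt_coeff_expAnn D ψ u hψ _ _).mul (analyticAt_coeff_expAnn D φ u hφ _ _)

end
end QCoset

/-! ### The contraction functions and their exchange relation -/

namespace QCoset
noncomputable section

/-- The multiplicative period `q ^ (2 s)`. -/
def nome (D : Params) (s : ℝ) : ℂ := Complex.exp (2 * (s * D.lq))

/-- `q ^ (2 (v - η))`, up to a factor `q ^ (2 s)`. -/
def pairNum (D : Params) (s : ℝ) (η : ℂ) : Bool → Bool → ℂ → ℂ
  | true, false, v => Complex.exp (2 * (D.lq * (v - η)))
  | _, _, v => nome D s * Complex.exp (2 * (D.lq * (v - η)))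

/-- `q ^ (2 (v + η))`, up to a factor `q ^ (2 s)`. -/
def pairDen (D : Params) (s : ℝ) (η : ℂ) : Bool → Bool → ℂ → ℂ
  | false, true, v => nome D s * Complex.exp (2 * (D.lq * (v + η)))
  | _, _, v => Complex.exp (2 * (D.lq * (v + η)))

/-- The oscillator part of the logarithm of a contraction, in the degree `m`. -/
def pairCoeff (D : Params) (s : ℝ) (η : ℂ) (ε ε' : Bool) (v : ℂ) (m : ℕ) : ℂ :=
  (pairDen D s η ε ε' v ^ m - pairNum D s η ε ε' v ^ m) / ((m : ℂ) * (1 - nome D s ^ m)) -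
    if ε = ε' then Complex.exp (2 * (D.lq * v)) ^ m / m else 0

/-- The sign `1` or `-1`. -/
def sgn (ε : Bool) : ℂ := if ε then 1 else -1

/-- The contraction of two vertex operators, continued analytically. -/
def pairFactor (D : Params) (s : ℝ) (η : ℂ) (ε ε' : Bool) (u u' : ℂ) : ℂ :=
  Complex.exp (η * (D.lq * (4 * u / s + sgn ε))) *
    (poch (nome D s) (pairNum D s η ε ε' (u' - u)) /
      poch (nome D s) (pairDen D s η ε ε' (u' - u)) *
      if ε = ε' then 1 - Complex.exp (2 * (D.lq * (u' - u))) else 1)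

theorem norm_pairDen_lt (D : Params) (hq : D.lq.re < 0) {s : ℝ} (hs : 0 < s) (η : ℂ) (ε ε' : Bool)
    (v : ℂ) (h : ‖Complex.exp (2 * (D.lq * (v + η)))‖ < 1) : ‖pairDen D s η ε ε' v‖ < 1 := by
  have hP : ‖nome D s‖ < 1 := norm_nome_lt D hq hs
  have h2 : ‖nome D s * Complex.exp (2 * (D.lq * (v + η)))‖ < 1 := by
    rw [norm_mul]
    nlinarith [norm_nonneg (nome D s), norm_nonneg (Complex.exp (2 * (D.lq * (v + η))))]
  cases ε <;> cases ε' <;> simp only [pairDen] <;> assumption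

/-- The only restriction is |q^(2(v+η))| < 1. For η = 1 it holds on the whole torus; for η = -1 it
says |z'| < |q|²|z|. -/
theorem tsum_pairCoeff (D : Params) (hq : D.lq.re < 0) {s : ℝ} (hs : 0 < s) (η : ℂ) (ε ε' : Bool)
    (v : ℂ) (h : ‖Complex.exp (2 * (D.lq * (v + η)))‖ < 1) :
    (Summable fun e => ‖seqExp (pairCoeff D s η ε ε' v) e‖) ∧
      ∑' e, seqExp (pairCoeff D s η ε ε' v) e =
        poch (nome D s) (pairNum D s η ε ε' v) / poch (nome D s) (pairDen D s η ε ε' v) *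
          if ε = ε' then 1 - Complex.exp (2 * (D.lq * v)) else 1 := by
  have hP : ‖nome D s‖ < 1 := norm_nome_lt D hq hs
  have h2 := norm_pairDen_lt D hq hs η ε ε' v h
  unfold pairCoeff
  by_cases hε : ε = ε'
  · simp only [hε, if_true] at h2 ⊢
    exact tsum_seqExp_ratio_mul hP _ h2 _
  · simp only [hε, if_false, sub_zero, mul_one]
    exact tsum_seqExp_ratio hP _ h2

theorem pairCoeff_scale (D : Params) (s : ℝ) (η : ℂ) (ε ε' : Bool) (v : ℂ) (m : ℕ) :
    pairCoeff D s η ε ε' v m = Complex.exp (2 * (D.lq * v)) ^ m * pairCoeff D s η ε ε' 0 m := by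
  have h1 : ∀ a : ℂ, Complex.exp (2 * (D.lq * (v + a))) =
      Complex.exp (2 * (D.lq * v)) * Complex.exp (2 * (D.lq * (0 + a))) := fun a => by
    rw [← Complex.exp_add]; ring_nf
  have h2 : Complex.exp (2 * (D.lq * (v - η))) =
      Complex.exp (2 * (D.lq * v)) * Complex.exp (2 * (D.lq * (0 - η))) := by
    rw [← Complex.exp_add]; ring_nf
  have h3 : pairNum D s η ε ε' v = Complex.exp (2 * (D.lq * v)) * pairNum D s η ε ε' 0 := by
    cases ε <;> cases ε' <;> simp only [pairNum, h2] <;> ring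
  have h4 : pairDen D s η ε ε' v = Complex.exp (2 * (D.lq * v)) * pairDen D s η ε ε' 0 := by
    cases ε <;> cases ε' <;> simp only [pairDen, h1] <;> ring
  unfold pairCoeff
  rw [h3, h4, mul_pow, mul_pow]
  split_ifs <;> (simp; ring)

/-- On |z'/z| = 1 the moduli of the terms do not depend on the points, so their values at v = 0 are
a uniform majorant. -/
theorem norm_seqExp_pairCoeff (D : Params) (s : ℝ) (η : ℂ) (ε ε' : Bool) (v : ℂ)
    (hv : ‖Complex.exp (2 * (D.lq * v))‖ = 1) (e : ℕ) :
    ‖seqExp (pairCoeff D s η ε ε' v) e‖ = ‖seqExp (pairCoeff D s η ε ε' 0) e‖ := by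
  rw [funext (pairCoeff_scale D s η ε ε' v), seqExp_scale, norm_mul, norm_pow, hv, one_pow, one_mul]

/-- The elementary factor q^u - q^(-u) is absorbed into one of the infinite products, which can then
cancel a denominator of `pairFactor`. -/
theorem th_eq_poch_inv (D : Params) (hq : D.lq.re < 0) {s : ℝ} (hs : 0 < s) :
    ∃ C : ℂ, C ≠ 0 ∧ ∀ u : ℂ, th D s u = C * Complex.exp (D.lq * (u ^ 2 / s)) *
        Complex.exp (D.lq * u) * (poch (nome D s) (nome D s * Complex.exp (2 * (D.lq * u))) *
          poch (nome D s) (Complex.exp (2 * (D.lq * -u)))) := by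
  obtain ⟨C, hC, h⟩ := th_eq_poch D hq hs
  refine ⟨C, hC, fun u => ?_⟩
  have hP : ‖nome D s‖ < 1 := norm_nome_lt D hq hs
  have h1 : Complex.exp (-(D.lq * u)) =
      Complex.exp (D.lq * u) * Complex.exp (2 * (D.lq * -u)) := by
    rw [← Complex.exp_add]; ring_nf
  have h2 : Complex.exp (-(2 * (D.lq * u))) = Complex.exp (2 * (D.lq * -u)) := by ring_nf
  rw [h, poch_eq hP (Complex.exp (2 * (D.lq * -u))), h1, h2]
  simp only [nome]
  ring

/-- The two infinite products of the theta function on either side are that side's own denominator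
and the other side's numerator; only elementary factors remain to be compared. -/
theorem cancel_swap {E n d t A E' n' d' t' A' : ℂ} (hd : d ≠ 0) (hd' : d' ≠ 0)
    (h : E * t * A = E' * t' * A') :
    E * (n / d * t) * (A * (n' * d)) = E' * (n' / d' * t') * (A' * (n * d')) := by
  field_simp
  linear_combination n * n' * h

/-- The infinite products cancel against those of the theta functions, leaving Gaussian and
zero-mode exponentials. Depending on the labels, p stands with z'/z or with z/z', which decides
whether [x] or -[-x] is expanded. -/
theorem pairFactor_swap (D : Params) (hq : D.lq.re < 0) {s : ℝ} (hs : 0 < s) {η : ℂ}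
    (ε ε' : Bool) (u u' : ℂ)
    (h1 : poch (nome D s) (Complex.exp (2 * (D.lq * (u' - u + η)))) ≠ 0)
    (h2 : poch (nome D s) (Complex.exp (2 * (D.lq * (u - u' + η)))) ≠ 0) :
    pairFactor D s η ε ε' u u' * th D s (u - u' - η) =
      pairFactor D s η ε' ε u' u * th D s (u - u' + η) := by
  have hP : ‖nome D s‖ < 1 := norm_nome_lt D hq hs
  obtain ⟨C, hC, h⟩ := th_eq_poch_inv D hq hs
  have hs' : (s : ℂ) ≠ 0 := by exact_mod_cast hs.ne'
  have d1 : poch (nome D s) (nome D s * Complex.exp (2 * (D.lq * (u' - u + η)))) ≠ 0 :=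
    fun h0 => h1 (by rw [poch_eq hP, h0, mul_zero])
  have d2 : poch (nome D s) (nome D s * Complex.exp (2 * (D.lq * (u - u' + η)))) ≠ 0 :=
    fun h0 => h2 (by rw [poch_eq hP, h0, mul_zero])
  have e1 : u - u' - η = -(u' - u + η) := by ring
  have e2 : u - u' + η = -(u' - u - η) := by ring
  have o1 := th_odd D hq hs (u' - u + η)
  have o2 := th_odd D hq hs (u' - u - η)
  have a1 := h (u - u' - η)
  have a2 := h (u - u' + η)
  have b1 := h (u' - u + η)
  have b2 := h (u' - u - η)
  rw [show -(u - u' - η) = u' - u + η by ring] at a1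
  rw [show -(u - u' + η) = u' - u - η by ring] at a2
  rw [show -(u' - u + η) = u - u' - η by ring] at b1
  rw [show -(u' - u - η) = u - u' + η by ring] at b2
  have key : Complex.exp (η * (D.lq * (4 * u / s))) *
      (Complex.exp (D.lq * ((u - u' - η) ^ 2 / s)) * Complex.exp (D.lq * (u - u' - η)) *
        Complex.exp (η * D.lq)) = Complex.exp (η * (D.lq * (4 * u' / s))) *
      (Complex.exp (D.lq * ((u - u' + η) ^ 2 / s)) * Complex.exp (D.lq * (u - u' + η)) *
        Complex.exp (-(η * D.lq))) := by
    simp only [← Complex.exp_add]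
    congr 1
    field_simp
    ring
  have key2 : Complex.exp (η * (D.lq * (4 * u / s))) *
      (Complex.exp (D.lq * ((u' - u + η) ^ 2 / s)) * Complex.exp (D.lq * (u' - u + η)) *
        Complex.exp (-(η * D.lq))) = Complex.exp (η * (D.lq * (4 * u' / s))) *
      (Complex.exp (D.lq * ((u' - u - η) ^ 2 / s)) * Complex.exp (D.lq * (u' - u - η)) *
        Complex.exp (η * D.lq)) := by
    simp only [← Complex.exp_add]
    congr 1
    field_simp
    ring
  have key3 : Complex.exp (η * (D.lq * (4 * u / s))) *
      (Complex.exp (D.lq * ((u - u' - η) ^ 2 / s)) * Complex.exp (D.lq * (u - u' - η))) *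
      (1 - Complex.exp (2 * (D.lq * (u' - u)))) =
      -(Complex.exp (η * (D.lq * (4 * u' / s))) *
      (Complex.exp (D.lq * ((u' - u - η) ^ 2 / s)) * Complex.exp (D.lq * (u' - u - η)))) *
      (1 - Complex.exp (2 * (D.lq * (u - u')))) := by
    have : Complex.exp (η * (D.lq * (4 * u / s))) *
        (Complex.exp (D.lq * ((u - u' - η) ^ 2 / s)) * Complex.exp (D.lq * (u - u' - η))) =
        Complex.exp (η * (D.lq * (4 * u' / s))) *
        (Complex.exp (D.lq * ((u' - u - η) ^ 2 / s)) * Complex.exp (D.lq * (u' - u - η))) *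
        Complex.exp (2 * (D.lq * (u - u'))) := by
      simp only [← Complex.exp_add]
      congr 1
      field_simp
      ring
    rw [this]
    have e3 : Complex.exp (2 * (D.lq * (u - u'))) * Complex.exp (2 * (D.lq * (u' - u))) = 1 := by
      rw [← Complex.exp_add, ← Complex.exp_zero]; ring_nf
    linear_combination -(Complex.exp (η * (D.lq * (4 * u' / s))) *
        (Complex.exp (D.lq * ((u' - u - η) ^ 2 / s)) * Complex.exp (D.lq * (u' - u - η)))) * e3
  have sp : ∀ (x : ℂ), Complex.exp (η * (D.lq * (x + 1))) =
      Complex.exp (η * (D.lq * x)) * Complex.exp (η * D.lq) := fun x => by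
    rw [← Complex.exp_add]; ring_nf
  have sm : ∀ (x : ℂ), Complex.exp (η * (D.lq * (x + -1))) =
      Complex.exp (η * (D.lq * x)) * Complex.exp (-(η * D.lq)) := fun x => by
    rw [← Complex.exp_add]; ring_nf
  have key4 : th D s (u - u' + η) = -th D s (u' - u - η) := by rw [e2, o2]
  have key5 : th D s (u - u' - η) = -th D s (u' - u + η) := by rw [e1, o1]
  -- Equal labels reduce to `key3`, where the factors 1 - z'/z and 1 - z/z' also enter; (false,
  -- true) reduces to `key2` and (true, false) to `key`.
  cases ε <;> cases ε' <;>
    simp only [pairFactor, pairNum, pairDen, sgn, if_true, if_false,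
      Bool.false_eq_true, Bool.true_eq_false]
  · rw [key4, a1, b2, sm, sm, ← neg_mul (C * _ * _)]
    refine cancel_swap h1 h2 ?_
    linear_combination C * Complex.exp (-(η * D.lq)) * key3
  · rw [key5, key4, b1, b2, sm, sp, mul_comm (poch _ (_ * Complex.exp (2 * (D.lq * (u' - u + η))))),
      ← neg_mul (C * _ * _), ← neg_mul (C * _ * _)]
    refine cancel_swap d1 h2 ?_
    linear_combination -C * key2
  · rw [a1, a2, sm, sp, mul_comm (poch _ (_ * Complex.exp (2 * (D.lq * (u - u' + η)))))]
    refine cancel_swap h1 d2 ?_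
    linear_combination C * key
  · rw [key4, a1, b2, sp, sp, ← neg_mul (C * _ * _)]
    refine cancel_swap h1 h2 ?_
    linear_combination C * Complex.exp (η * D.lq) * key3

/-- A family of pairs of vertex operators with the contractions `pairFactor`. -/
structure VertexPair (D : Params) where
  s : ℝ
  pos : 0 < s
  η : ℂ
  sign : η = 1 ∨ η = -1
  field : Bool → ℂ → Field
  δ : Mom
  analytic : ∀ ε m, AnalyticOnNhd ℂ (fun u => field ε u m) Set.univ
  shift : ∀ ε u, momShift D (field ε u) = δ
  zeroMode : ∀ ε u, ∑ j, field ε u (.P j) * δ j = η * (D.lq * (4 * u / s + sgn ε))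
  oscillators : ∀ ε ε' u u' (m : ℕ+), ∑ j, contr D (field ε u) (field ε' u') (j, m) =
    pairCoeff D s η ε ε' (u' - u) m

namespace VertexPair

variable {D : Params} (V : VertexPair D)

theorem gradedExp_eq (ε ε' : Bool) (u u' : ℂ) :
    gradedExp (contr D (V.field ε u) (V.field ε' u')) =
      seqExp (pairCoeff D V.s V.η ε ε' (u' - u)) :=
  gradedExp_eq_seqExp _ _ (V.oscillators ε ε' u u')

theorem contractible (hq : D.lq.re < 0) (ε ε' : Bool) (u u' : ℂ)
    (h : ‖Complex.exp (2 * (D.lq * (u' - u + V.η)))‖ < 1) :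
    Contractible D (V.field ε u) (V.field ε' u') := by
  unfold Contractible
  rw [V.gradedExp_eq]
  exact (tsum_pairCoeff D hq V.pos V.η ε ε' _ h).1

theorem contraction_eq (hq : D.lq.re < 0) (ε ε' : Bool) (u u' : ℂ)
    (h : ‖Complex.exp (2 * (D.lq * (u' - u + V.η)))‖ < 1) :
    contraction D (V.field ε u) (V.field ε' u') = pairFactor D V.s V.η ε ε' u u' := by
  unfold contraction pairFactor
  rw [V.gradedExp_eq, (tsum_pairCoeff D hq V.pos V.η ε ε' _ h).2, V.shift, V.zeroMode]

end VertexPair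

end
end QCoset

/-! ### Contour integrals, uniform bounds and continuity on the torus -/

namespace QCoset
noncomputable section

open MeasureTheory

/-- The domain of integration. -/
def box (n : ℕ) : Set (Fin n → ℝ) := Set.Icc 0 fun _ => 2 * Real.pi

theorem isCompact_box (n : ℕ) : IsCompact (box n) := isCompact_Icc

theorem setIntegral_box_mul (n : ℕ) (f : ℝ → ℂ) (g : (Fin n → ℝ) → ℂ) :
    ∫ θ in box (n + 1), f (θ 0) * g (fun i => θ i.succ) =
      (∫ x in Set.Icc 0 (2 * Real.pi), f x) * ∫ θ in box n, g θ := by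
  have h1 := volume_preserving_piFinSuccAbove (fun _ : Fin (n + 1) => ℝ) 0
  have h2 := h1.setIntegral_preimage_emb (MeasurableEquiv.measurableEmbedding _)
    (fun y : ℝ × (Fin n → ℝ) => f y.1 * g y.2) (Set.Icc 0 (2 * Real.pi) ×ˢ box n)
  have h3 : (MeasurableEquiv.piFinSuccAbove (fun _ : Fin (n + 1) => ℝ) 0) ⁻¹'
      (Set.Icc 0 (2 * Real.pi) ×ˢ box n) = box (n + 1) := by
    ext θ
    simp only [box, Set.mem_preimage, Set.mem_prod, Set.mem_Icc, Pi.le_def, Fin.forall_fin_succ,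
      MeasurableEquiv.piFinSuccAbove_apply, Fin.insertNthEquiv_symm_apply, Fin.removeNth,
      Fin.zero_succAbove, Pi.zero_apply]
    tauto
  rw [h3] at h2
  rw [← setIntegral_prod_mul]
  exact h2

theorem contourInt_one (D : Params) (f : ℂ → ℂ) :
    contourInt D (fun u : Fin 1 → ℂ => f (u 0)) =
      ((2 * Real.pi : ℝ) : ℂ)⁻¹ * ∫ x in Set.Icc 0 (2 * Real.pi), f (uOf D x) := by
  have h := setIntegral_box_mul 0 (fun x => f (uOf D x)) (fun _ => 1)
  have h1 : ∫ _ in box 0, (1 : ℂ) = 1 := by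
    have : box 0 = Set.univ := Set.eq_univ_of_forall fun θ => by simp [box]
    rw [this, setIntegral_const, measureReal_def, volume_pi, Measure.pi_of_empty,
      Measure.dirac_apply_of_mem (Set.mem_univ _)]
    simp
  rw [h1, mul_one] at h
  simp only [mul_one] at h
  unfold contourInt
  rw [pow_one, ← h]
  rfl

theorem contourInt_mul (D : Params) {n : ℕ} (f : ℂ → ℂ) (g : (Fin n → ℂ) → ℂ) :
    contourInt D (fun t : Fin (n + 1) → ℂ => f (t 0) * g (fun i => t i.succ)) =
      contourInt D (fun u : Fin 1 → ℂ => f (u 0)) * contourInt D g := by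
  have h := setIntegral_box_mul n (fun x => f (uOf D x)) (fun θ => g fun j => uOf D (θ j))
  rw [contourInt_one]
  unfold contourInt
  simp only [box] at h
  rw [h, pow_succ']
  ring

/-- The points of the torus. -/
def torusPt (D : Params) {n : ℕ} (θ : Fin n → ℝ) : Fin n → ℂ := fun j => uOf D (θ j)

theorem continuous_uOf (D : Params) : Continuous (uOf D) := by
  unfold uOf
  fun_prop

theorem continuous_torusPt (D : Params) {n : ℕ} : Continuous (torusPt D (n := n)) :=
  continuous_pi fun j => (continuous_uOf D).comp (continuous_apply j)

theorem contourIntegrable_of_continuous (D : Params) {n : ℕ} (f : (Fin n → ℂ) → ℂ)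
    (hf : Continuous fun θ => f (torusPt D θ)) : ContourIntegrable D f :=
  hf.continuousOn.integrableOn_compact (isCompact_box n)

theorem contourInt_sum (D : Params) {n : ℕ} {ι : Type*} (s : Finset ι) (f : ι → (Fin n → ℂ) → ℂ)
    (hf : ∀ i ∈ s, Continuous fun θ => f i (torusPt D θ)) :
    contourInt D (fun t => ∑ i ∈ s, f i t) = ∑ i ∈ s, contourInt D (f i) := by
  unfold contourInt
  rw [integral_finsetSum s fun i hi => contourIntegrable_of_continuous D (f i) (hf i hi),
    Finset.mul_sum]

theorem hasSum_contourInt (D : Params) {n : ℕ} (F : ℕ → (Fin n → ℂ) → ℂ) (f : (Fin n → ℂ) → ℂ)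
    (hF : ∀ d, Continuous fun θ => F d (torusPt D θ)) (M : ℕ → ℝ) (hM : Summable M)
    (hb : ∀ d, ∀ θ ∈ box n, ‖F d (torusPt D θ)‖ ≤ M d)
    (h : ∀ θ, HasSum (fun d => F d (torusPt D θ)) (f (torusPt D θ))) :
    HasSum (fun d => contourInt D (F d)) (contourInt D f) := by
  unfold contourInt
  refine HasSum.mul_left _ ?_
  refine hasSum_integral_of_dominated_convergence (fun d _ => M d)
    (fun d => (hF d).aestronglyMeasurable.restrict) (fun d => ?_) ?_ ?_ ?_
  · exact ae_restrict_of_forall_mem measurableSet_Icc fun θ hθ => hb d θ hθ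
  · exact Filter.Eventually.of_forall fun _ => hM
  · exact continuousOn_const.integrableOn_compact (isCompact_box n)
  · exact Filter.Eventually.of_forall fun θ => h θ

/-- In the convolution one factor has a uniform summable majorant and the other has finitely many
terms, each bounded on the compact set. This is the domination that lets the degree sums pass
through the integrals. -/
theorem exists_summable_bound {X : Type*} [TopologicalSpace X] {K : Set X} (hK : IsCompact K)
    (c : X → ℂ) (hc : Continuous c) (g : X → ℕ → ℂ) (G : ℕ → ℝ) (hG : Summable G)
    (hg : ∀ x e, ‖g x e‖ ≤ G e) (P : X → ℕ → ℂ) (hP : ∀ e, Continuous fun x => P x e) (N : ℕ)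
    (hN : ∀ x, ∀ e ∉ Finset.range N, P x e = 0) :
    ∃ M : ℕ → ℝ, Summable M ∧ ∀ x ∈ K, ∀ d,
      ‖c x * ∑ y ∈ Finset.HasAntidiagonal.antidiagonal d, g x y.1 * P x y.2‖ ≤ M d := by
  obtain ⟨A, hA⟩ := hK.exists_bound_of_continuousOn hc.continuousOn
  have h1 : ∀ e, ∃ B : ℝ, ∀ x ∈ K, ‖P x e‖ ≤ B := fun e =>
    hK.exists_bound_of_continuousOn (hP e).continuousOn
  choose B hB using h1
  let B' : ℕ → ℝ := fun e => if e ∈ Finset.range N then |B e| else 0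
  have hB' : ∀ x ∈ K, ∀ e, ‖P x e‖ ≤ B' e := fun x hx e => by
    by_cases h : e ∈ Finset.range N
    · simp only [B', if_pos h]; exact (hB e x hx).trans (le_abs_self _)
    · simp only [B', if_neg h]; rw [hN x e h, norm_zero]
  have hs : Summable fun e => ‖B' e‖ :=
    summable_of_ne_finset_zero (s := Finset.range N) fun e he => by simp only [B', if_neg he, norm_zero]
  have h2 := summable_norm_sum_mul_antidiagonal_of_summable_norm (R := ℝ) hG.norm hs
  refine ⟨_, h2.mul_left |A|, fun x hx d => ?_⟩
  rw [norm_mul]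
  refine mul_le_mul ((hA x hx).trans (le_abs_self _)) ?_ (norm_nonneg _) (abs_nonneg _)
  refine (norm_sum_le _ _).trans (le_trans (Finset.sum_le_sum fun y _ => ?_) (le_abs_self _))
  rw [norm_mul]
  exact mul_le_mul (hg x _) (hB' x hx _) (norm_nonneg _) ((norm_nonneg _).trans (hg x _))

theorem exists_summable_bound_sum {X ι : Type*} {K : Set X} (s : Finset ι) (F : ι → X → ℕ → ℂ)
    (h : ∀ i ∈ s, ∃ M : ℕ → ℝ, Summable M ∧ ∀ x ∈ K, ∀ d, ‖F i x d‖ ≤ M d) :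
    ∃ M : ℕ → ℝ, Summable M ∧ ∀ x ∈ K, ∀ d, ‖∑ i ∈ s, F i x d‖ ≤ M d := by
  choose! M hM hb using h
  exact ⟨fun d => ∑ i ∈ s, M i d, summable_sum hM, fun x hx d =>
    (norm_sum_le _ _).trans (Finset.sum_le_sum fun i hi => hb i hi x hx d)⟩

theorem exp_uOf_sub (D : Params) (hq : D.lq.re < 0) (θ θ' : ℝ) :
    Complex.exp (2 * (D.lq * (uOf D θ' - uOf D θ))) = Complex.exp ((θ' - θ : ℝ) * Complex.I) := by
  have hlq : D.lq ≠ 0 := fun h => by rw [h] at hq; simp at hq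
  congr 1
  unfold uOf
  push_cast
  field_simp

theorem norm_exp_uOf_sub (D : Params) (hq : D.lq.re < 0) (θ θ' : ℝ) :
    ‖Complex.exp (2 * (D.lq * (uOf D θ' - uOf D θ)))‖ = 1 := by
  rw [exp_uOf_sub D hq, Complex.norm_exp_ofReal_mul_I]

theorem norm_exp_uOf_sub_add (D : Params) (hq : D.lq.re < 0) (θ θ' : ℝ) (a : ℂ) :
    ‖Complex.exp (2 * (D.lq * (uOf D θ' - uOf D θ + a)))‖ = ‖Complex.exp (2 * (D.lq * a))‖ := by
  rw [mul_add, mul_add, Complex.exp_add, norm_mul, norm_exp_uOf_sub D hq, one_mul]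

theorem norm_exp_lq_lt (D : Params) (hq : D.lq.re < 0) (θ θ' : ℝ) :
    ‖Complex.exp (2 * (D.lq * (uOf D θ' - uOf D θ + 1)))‖ < 1 := by
  rw [norm_exp_uOf_sub_add D hq, Complex.norm_exp, ← Real.exp_zero]
  refine Real.exp_lt_exp.mpr ?_
  simp
  linarith

theorem differentiable_pairNum (D : Params) (s : ℝ) (η : ℂ) (ε ε' : Bool) :
    Differentiable ℂ (pairNum D s η ε ε') := by
  cases ε <;> cases ε' <;> (unfold pairNum; fun_prop)

theorem differentiable_pairDen (D : Params) (s : ℝ) (η : ℂ) (ε ε' : Bool) :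
    Differentiable ℂ (pairDen D s η ε ε') := by
  cases ε <;> cases ε' <;> (unfold pairDen; fun_prop)

theorem poch_pairDen_ne_zero (D : Params) (hq : D.lq.re < 0) {s : ℝ} (hs : 0 < s) (η : ℂ)
    (ε ε' : Bool) (v : ℂ) (h : poch (nome D s) (Complex.exp (2 * (D.lq * (v + η)))) ≠ 0) :
    poch (nome D s) (pairDen D s η ε ε' v) ≠ 0 := by
  have hP : ‖nome D s‖ < 1 := norm_nome_lt D hq hs
  have d1 : poch (nome D s) (nome D s * Complex.exp (2 * (D.lq * (v + η)))) ≠ 0 :=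
    fun h0 => h (by rw [poch_eq hP, h0, mul_zero])
  cases ε <;> cases ε' <;> simp only [pairDen] <;> assumption

section pairFactor

variable {E : Type*} [NormedAddCommGroup E] [NormedSpace ℂ E]

theorem analyticAt_pairFactor (D : Params) (hq : D.lq.re < 0) {s : ℝ} (hs : 0 < s) (η : ℂ)
    (ε ε' : Bool) (a b : E → ℂ) (x : E) (ha : AnalyticAt ℂ a x) (hb : AnalyticAt ℂ b x)
    (h : poch (nome D s) (Complex.exp (2 * (D.lq * (b x - a x + η)))) ≠ 0) :
    AnalyticAt ℂ (fun y => pairFactor D s η ε ε' (a y) (b y)) x := by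
  have hP : ‖nome D s‖ < 1 := norm_nome_lt D hq hs
  have hp := (poch_differentiable hP)
  have e1 : AnalyticAt ℂ (fun y => Complex.exp (η * (D.lq * (4 * a y / s + sgn ε)))) x := by
    have : AnalyticAt ℂ (fun v : ℂ => Complex.exp (η * (D.lq * (4 * v / s + sgn ε)))) (a x) := by
      refine (Differentiable.analyticAt (by fun_prop) _)
    exact this.comp ha
  have e2 : AnalyticAt ℂ (fun y => poch (nome D s) (pairNum D s η ε ε' (b y - a y)) /
      poch (nome D s) (pairDen D s η ε ε' (b y - a y)) *
      if ε = ε' then 1 - Complex.exp (2 * (D.lq * (b y - a y))) else 1) x := by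
    have : AnalyticAt ℂ (fun v : ℂ => poch (nome D s) (pairNum D s η ε ε' v) /
        poch (nome D s) (pairDen D s η ε ε' v) *
        if ε = ε' then 1 - Complex.exp (2 * (D.lq * v)) else 1) (b x - a x) := by
      refine AnalyticAt.mul (AnalyticAt.div ?_ ?_ (poch_pairDen_ne_zero D hq hs η ε ε' _ h)) ?_
      · exact (hp.comp (differentiable_pairNum D s η ε ε')).analyticAt _
      · exact (hp.comp (differentiable_pairDen D s η ε ε')).analyticAt _
      · split_ifs
        · exact Differentiable.analyticAt (by fun_prop) _
        · exact analyticAt_const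
    exact AnalyticAt.comp (f := fun y => b y - a y) this (hb.sub ha)
  exact e1.mul e2

end pairFactor

namespace VertexPair

variable {D : Params} (V : VertexPair D)

theorem analyticAt_sum_field {n : ℕ} (ε : Fin n → Bool) (t : Fin n → ℂ) (m : Mode) :
    AnalyticAt ℂ (fun t : Fin n → ℂ => (∑ i, V.field (ε i) (t i)) m) t := by
  simp only [Finset.sum_apply]
  refine Finset.analyticAt_fun_sum _ fun i _ => ?_
  exact AnalyticAt.comp (f := fun t : Fin n → ℂ => t i) (V.analytic (ε i) m (t i) (Set.mem_univ _))
    ((ContinuousLinearMap.proj (R := ℂ) (φ := fun _ : Fin n => ℂ) i).analyticAt t)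

theorem contraction_torus (hq : D.lq.re < 0) (hη : V.η = 1) (ε ε' : Bool) (θ θ' : ℝ) :
    contraction D (V.field ε (uOf D θ)) (V.field ε' (uOf D θ')) =
      pairFactor D V.s V.η ε ε' (uOf D θ) (uOf D θ') :=
  V.contraction_eq hq ε ε' _ _ (by rw [hη]; exact norm_exp_lq_lt D hq _ _)

theorem contractible_torus (hq : D.lq.re < 0) (hη : V.η = 1) (ε ε' : Bool) (θ θ' : ℝ) :
    Contractible D (V.field ε (uOf D θ)) (V.field ε' (uOf D θ')) :=
  V.contractible hq ε ε' _ _ (by rw [hη]; exact norm_exp_lq_lt D hq _ _)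

theorem poch_torus_ne_zero (hq : D.lq.re < 0) (hη : V.η = 1) (θ θ' : ℝ) :
    poch (nome D V.s) (Complex.exp (2 * (D.lq * (uOf D θ' - uOf D θ + V.η)))) ≠ 0 := by
  rw [hη]
  exact poch_ne_zero_of_norm_lt (norm_nome_lt D hq V.pos) (norm_exp_lq_lt D hq θ θ')

/-- The integrand of a screening operator. -/
def op (sc : ℂ → Bool → Mom → ℂ) (u : ℂ) : Op := opOf D (sc u) fun ε => V.field ε u

/-- The product of `n` copies of `op`. -/
def prod (sc : ℂ → Bool → Mom → ℂ) (p : Mom) (v : Fock) {n : ℕ} (t : Fin n → ℂ) : CFock :=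
  prodFormula D V.δ p v (fun i => sc (t i)) fun i ε => V.field ε (t i)

/-- Non-vanishing of the denominator is left as a hypothesis because its source varies: smallness of
|q|² when η = 1, or genericity of s for either sign. -/
theorem continuous_pairFactor_torus (hq : D.lq.re < 0) (hreg : ∀ θ θ' : ℝ,
      poch (nome D V.s) (Complex.exp (2 * (D.lq * (uOf D θ' - uOf D θ + V.η)))) ≠ 0) {n : ℕ}
    (ε ε' : Bool) (i j : Fin n) : Continuous fun θ : Fin n → ℝ =>
      pairFactor D V.s V.η ε ε' (torusPt D θ i) (torusPt D θ j) := by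
  rw [continuous_iff_continuousAt]
  intro θ
  have h := analyticAt_pairFactor D hq V.pos V.η ε ε' (fun x : ℂ × ℂ => x.1) (fun x => x.2)
    (torusPt D θ i, torusPt D θ j) analyticAt_fst analyticAt_snd
    (hreg (θ i) (θ j))
  have h2 : ContinuousAt (fun θ : Fin n → ℝ => (torusPt D θ i, torusPt D θ j)) θ :=
    (((continuous_apply i).comp (continuous_torusPt D)).prodMk
      ((continuous_apply j).comp (continuous_torusPt D))).continuousAt
  exact ContinuousAt.comp (f := fun θ : Fin n → ℝ => (torusPt D θ i, torusPt D θ j))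
    (g := fun x : ℂ × ℂ => pairFactor D V.s V.η ε ε' x.1 x.2) h.continuousAt h2

theorem continuous_prodScalar (hq : D.lq.re < 0) (hη : V.η = 1) (sc : ℂ → Bool → Mom → ℂ)
    (hsc : ∀ ε p, Continuous fun θ : ℝ => sc (uOf D θ) ε p) (p : Mom) {n : ℕ} (ε : Fin n → Bool) :
    Continuous fun θ : Fin n → ℝ => prodScalar D V.δ p (fun i => sc (torusPt D θ i))
      (fun i ε => V.field ε (torusPt D θ i)) ε := by
  unfold prodScalar
  refine Continuous.mul (continuous_finsetProd _ fun i _ => ?_)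
    (continuous_finsetProd _ fun i _ => continuous_finsetProd _ fun j _ => ?_)
  · exact (hsc (ε i) _).comp (continuous_apply i)
  · simp only [torusPt, V.contraction_torus hq hη]
    exact V.continuous_pairFactor_torus hq (V.poch_torus_ne_zero hq hη) (ε i) (ε j) i j

theorem continuous_coeff_prod (hq : D.lq.re < 0) (hη : V.η = 1) (sc : ℂ → Bool → Mom → ℂ)
    (hsc : ∀ ε p, Continuous fun θ : ℝ => sc (uOf D θ) ε p) (p : Mom) (v : Fock) {n : ℕ}
    (w : Idx →₀ ℕ) :
    Continuous fun θ : Fin n → ℝ => MvPowerSeries.coeff w (V.prod sc p v (torusPt D θ)) := by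
  unfold prod prodFormula
  simp only [map_sum, MvPowerSeries.coeff_smul]
  refine continuous_finsetSum _ fun ε _ =>
    (V.continuous_prodScalar hq hη sc hsc p ε).mul ?_
  have h : Continuous fun t : Fin n → ℂ =>
      MvPowerSeries.coeff w (vop D (∑ i, V.field (ε i) (t i)) p v) :=
    continuous_iff_continuousAt.mpr fun t => (analyticAt_coeff_vop D
      (fun t : Fin n → ℂ => ∑ i, V.field (ε i) (t i)) t
      (V.analyticAt_sum_field ε t) p v w).continuousAt
  exact h.comp (continuous_torusPt D)

end VertexPair

end
end QCoset

/-! ### Powers of a screening operator as n-fold integrals -/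

namespace QCoset
noncomputable section

open MeasureTheory

theorem comp_eq_sum_smul (d : ℕ) (ψ : CFock) :
    comp d ψ = ∑ k ∈ level d, MvPowerSeries.coeff k ψ • (MvPolynomial.monomial k 1 : Fock) := by
  unfold comp
  refine Finset.sum_congr rfl fun k _ => ?_
  rw [MvPolynomial.smul_monomial, smul_eq_mul, mul_one]

theorem contourInt_const_mul (D : Params) {n : ℕ} (c : ℂ) (f : (Fin n → ℂ) → ℂ) :
    contourInt D (fun t => c * f t) = c * contourInt D f := by
  unfold contourInt
  rw [integral_const_mul]
  ring

theorem contourInt_zero_dim (D : Params) (c : ℂ) : contourInt D (fun _ : Fin 0 → ℂ => c) = c := by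
  unfold contourInt
  have : Set.Icc (0 : Fin 0 → ℝ) (fun _ => 2 * Real.pi) = Set.univ :=
    Set.eq_univ_of_forall fun θ => by simp
  rw [this, setIntegral_const, measureReal_def, volume_pi, Measure.pi_of_empty,
    Measure.dirac_apply_of_mem (Set.mem_univ _)]
  simp

namespace VertexPair

variable {D : Params} (V : VertexPair D)

theorem coeff_op_comp (sc : ℂ → Bool → Mom → ℂ) (u : ℂ) (p : Mom) (d : ℕ) (ψ : CFock)
    (w : Idx →₀ ℕ) :
    MvPowerSeries.coeff w (V.op sc u p (comp d ψ)) = ∑ k ∈ level d,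
      MvPowerSeries.coeff k ψ *
        MvPowerSeries.coeff w (V.op sc u p (MvPolynomial.monomial k 1)) := by
  unfold op
  rw [comp_eq_sum_smul, opOf_sum, map_sum]
  exact Finset.sum_congr rfl fun k _ => MvPowerSeries.coeff_smul _ _ _

theorem continuous_coeff_op (sc : ℂ → Bool → Mom → ℂ)
    (hsc : ∀ ε p, Continuous fun θ : ℝ => sc (uOf D θ) ε p) (p : Mom) (v : Fock) (w : Idx →₀ ℕ) :
    Continuous fun θ : ℝ => MvPowerSeries.coeff w (V.op sc (uOf D θ) p v) := by
  unfold op opOf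
  simp only [map_sum, MvPowerSeries.coeff_smul]
  refine continuous_finsetSum _ fun ε _ => (hsc ε p).mul ?_
  have h : Continuous fun u : ℂ => MvPowerSeries.coeff w (vop D (V.field ε u) p v) :=
    continuous_iff_continuousAt.mpr fun t => (analyticAt_coeff_vop D (V.field ε) t
      (fun m => V.analytic ε m t (Set.mem_univ _)) p v w).continuousAt
  exact h.comp (continuous_uOf D)

/-- A fixed degree contains finitely many monomials, so the integral passes inside a finite sum and
each term is a product of integrals in separate variables. -/
theorem contourInt_op_comp (hq : D.lq.re < 0) (hη : V.η = 1) (sc : ℂ → Bool → Mom → ℂ)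
    (hsc : ∀ ε p, Continuous fun θ : ℝ => sc (uOf D θ) ε p) (n : ℕ) (p p' : Mom) (v : Fock)
    (ψ : CFock) (hψ : ∀ w, MvPowerSeries.coeff w ψ =
      contourInt D fun t : Fin n → ℂ => MvPowerSeries.coeff w (V.prod sc p v t)) (d : ℕ)
    (w : Idx →₀ ℕ) :
    MvPowerSeries.coeff w (opInt D (V.op sc) p' (comp d ψ)) =
      contourInt D fun t : Fin (n + 1) → ℂ => MvPowerSeries.coeff w
        (V.op sc (t 0) p' (comp d (V.prod sc p v fun i => t i.succ))) := by
  change contourInt D (fun u : Fin 1 → ℂ =>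
    MvPowerSeries.coeff w (V.op sc (u 0) p' (comp d ψ))) = _
  simp_rw [coeff_op_comp]
  have h0 := fun k => V.continuous_coeff_op sc hsc p' (MvPolynomial.monomial k 1) w
  have h1 := fun k => V.continuous_coeff_prod hq hη sc hsc p v (n := n) k
  rw [contourInt_sum D, contourInt_sum D]
  · refine Finset.sum_congr rfl fun k _ => ?_
    rw [contourInt_const_mul, hψ]
    rw [mul_comm, ← contourInt_mul D
      (fun u => MvPowerSeries.coeff w (V.op sc u p' (MvPolynomial.monomial k 1)))]
    congr 1
    funext t
    rw [mul_comm]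
  · intro k _
    have h3 : Continuous fun θ : Fin (n + 1) → ℝ => fun i : Fin n => θ i.succ :=
      continuous_pi fun i => continuous_apply _
    exact ((h1 k).comp h3).mul ((h0 k).comp (continuous_apply 0))
  · intro k _
    exact continuous_const.mul ((h0 k).comp (continuous_apply 0))

theorem exists_bound_op_comp (hq : D.lq.re < 0) (hη : V.η = 1) (sc : ℂ → Bool → Mom → ℂ)
    (hsc : ∀ ε p, Continuous fun θ : ℝ => sc (uOf D θ) ε p) (n : ℕ) (p p' : Mom) (v : Fock)
    (w : Idx →₀ ℕ) :
    ∃ M : ℕ → ℝ, Summable M ∧ ∀ θ ∈ box (n + 1), ∀ d, ‖MvPowerSeries.coeff w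
        (V.op sc (torusPt D θ 0) p' (comp d (V.prod sc p v fun i : Fin n =>
          torusPt D θ i.succ)))‖ ≤ M d := by
  have hmaj : ∀ (ε0 : Bool) (ε : Fin n → Bool), ∃ G : ℕ → ℝ, Summable G ∧
      ∀ (θ : Fin (n + 1) → ℝ) e, ‖gradedExp (contr D (V.field ε0 (torusPt D θ 0))
        (∑ i : Fin n, V.field (ε i) (torusPt D θ i.succ))) e‖ ≤ G e := by
    intro ε0 ε
    -- The terms at v = 0, that is at z = z', majorize each pair contraction over the whole torus.
    obtain ⟨G, hG, -, h⟩ := exists_majorant_sum D (Finset.univ : Finset (Fin n))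
      (fun i e => ‖seqExp (pairCoeff D V.s V.η ε0 (ε i) 0) e‖) fun i _ =>
        (tsum_pairCoeff D hq V.pos V.η ε0 (ε i) 0 (by
          have := norm_exp_lq_lt D hq 0 0
          rwa [sub_self, ← hη] at this)).1
    refine ⟨G, hG, fun θ e => h _ _ (fun i _ e => ?_) e⟩
    rw [V.gradedExp_eq, norm_seqExp_pairCoeff]
    exact norm_exp_uOf_sub D hq _ _
  have hpt : ∀ (j : Fin (n + 1)) (ε : Bool) (m : Mode) (t : Fin (n + 1) → ℂ),
      AnalyticAt ℂ (fun t : Fin (n + 1) → ℂ => V.field ε (t j) m) t := fun j ε m t =>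
    AnalyticAt.comp (f := fun t : Fin (n + 1) → ℂ => t j) (V.analytic ε m (t j) (Set.mem_univ _))
      ((ContinuousLinearMap.proj (R := ℂ) (φ := fun _ : Fin (n + 1) => ℂ) j).analyticAt t)
  have hps : ∀ (ε : Fin n → Bool) (m : Mode) (t : Fin (n + 1) → ℂ),
      AnalyticAt ℂ (fun t : Fin (n + 1) → ℂ =>
        (∑ i : Fin n, V.field (ε i) (t i.succ)) m) t := fun ε m t => by
    simp only [Finset.sum_apply]
    exact Finset.analyticAt_fun_sum _ fun i _ => hpt _ _ _ _
  have htail : Continuous fun θ : Fin (n + 1) → ℝ => fun i : Fin n => θ i.succ :=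
    continuous_pi fun i => continuous_apply _
  have key : ∀ (ε : Fin n → Bool) (ε0 : Bool), ∃ M : ℕ → ℝ, Summable M ∧
      ∀ θ ∈ box (n + 1), ∀ d,
        ‖prodScalar D V.δ p (fun i : Fin n => sc (torusPt D θ i.succ))
            (fun i ε => V.field ε (torusPt D θ i.succ)) ε *
          (sc (torusPt D θ 0) ε0 p' * MvPowerSeries.coeff w (vop D (V.field ε0 (torusPt D θ 0)) p'
            (comp d (vop D (∑ i : Fin n, V.field (ε i) (torusPt D θ i.succ)) p v))))‖ ≤ M d := by
    intro ε ε0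
    obtain ⟨G, hG, hb⟩ := hmaj ε0 ε
    have hc := exists_summable_bound (isCompact_box (n + 1))
      (fun θ => prodScalar D V.δ p (fun i : Fin n => sc (torusPt D θ i.succ))
            (fun i ε => V.field ε (torusPt D θ i.succ)) ε * (sc (torusPt D θ 0) ε0 p' *
          (zeroWeight (V.field ε0 (torusPt D θ 0)) p' *
            zeroWeight (∑ i : Fin n, V.field (ε i) (torusPt D θ i.succ)) p))) ?_
      (fun θ => gradedExp (contr D (V.field ε0 (torusPt D θ 0))
        (∑ i : Fin n, V.field (ε i) (torusPt D θ i.succ)))) G hG hb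
      (fun θ => pairSum D (V.field ε0 (torusPt D θ 0))
        (∑ i : Fin n, V.field (ε i) (torusPt D θ i.succ)) v w) ?_ (deg w + polyDeg v + 1)
        (fun θ e he => pairSum_eq_zero _ _ _ _ _ _ he)
    · obtain ⟨M, hM, hMb⟩ := hc
      refine ⟨M, hM, fun θ hθ d => ?_⟩
      rw [coeff_vop_comp_vop]
      have := hMb θ hθ d
      rwa [mul_assoc, mul_assoc] at this
    · refine ((V.continuous_prodScalar hq hη sc hsc p ε).comp htail).mul
        (((hsc ε0 p').comp (continuous_apply 0)).mul (Continuous.mul ?_ ?_))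
      · have h : Continuous fun t : Fin (n + 1) → ℂ => zeroWeight (V.field ε0 (t 0)) p' :=
          continuous_iff_continuousAt.mpr fun t =>
            (analyticAt_zeroWeight (fun t : Fin (n + 1) → ℂ => V.field ε0 (t 0)) t
              (fun m => hpt 0 ε0 m t) p').continuousAt
        exact h.comp (continuous_torusPt D)
      · have h : Continuous fun t : Fin (n + 1) → ℂ =>
            zeroWeight (∑ i : Fin n, V.field (ε i) (t i.succ)) p :=
          continuous_iff_continuousAt.mpr fun t =>
            (analyticAt_zeroWeight (fun t : Fin (n + 1) → ℂ =>
              ∑ i : Fin n, V.field (ε i) (t i.succ)) t (fun m => hps ε m t) p).continuousAt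
        exact h.comp (continuous_torusPt D)
    · intro e
      have h : Continuous fun t : Fin (n + 1) → ℂ => pairSum D (V.field ε0 (t 0))
          (∑ i : Fin n, V.field (ε i) (t i.succ)) v w e :=
        continuous_iff_continuousAt.mpr fun t =>
          (analyticAt_pairSum D (fun t : Fin (n + 1) → ℂ => V.field ε0 (t 0))
            (fun t : Fin (n + 1) → ℂ => ∑ i : Fin n, V.field (ε i) (t i.succ)) t
            (fun m => hpt 0 ε0 m t) (fun m => hps ε m t) v w e).continuousAt
      exact h.comp (continuous_torusPt D)
  obtain ⟨M, hM, hb⟩ := exists_summable_bound_sum (Finset.univ : Finset (Fin n → Bool)) _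
    fun ε _ => exists_summable_bound_sum (Finset.univ : Finset Bool) _ fun ε0 _ => key ε ε0
  refine ⟨M, hM, fun θ hθ d => ?_⟩
  have := hb θ hθ d
  unfold op prod
  rw [coeff_opOf_comp]
  simp_rw [Finset.mul_sum]
  exact this

/-- Powers of a screening operator are multiple integrals. -/
theorem opPow_opInt (hq : D.lq.re < 0) (hη : V.η = 1) (sc : ℂ → Bool → Mom → ℂ)
    (hsc : ∀ ε p, Continuous fun θ : ℝ => sc (uOf D θ) ε p) (n : ℕ) (p : Mom) (v : Fock) :
    OpPowConverges V.δ (opInt D (V.op sc)) n p v ∧ ∀ w,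
      MvPowerSeries.coeff w (opPow V.δ (opInt D (V.op sc)) n p v) =
        contourInt D fun t : Fin n → ℂ => MvPowerSeries.coeff w (V.prod sc p v t) := by
  induction n with
  | zero =>
    refine ⟨trivial, fun w => ?_⟩
    unfold prod
    simp_rw [prodFormula_zero]
    rw [contourInt_zero_dim]
    rfl
  | succ n ih =>
    obtain ⟨h1, h2⟩ := ih
    have key : ∀ w, HasSum (fun d => MvPowerSeries.coeff w (opInt D (V.op sc) (p + n • V.δ)
        (comp d (opPow V.δ (opInt D (V.op sc)) n p v))))
        (contourInt D fun t : Fin (n + 1) → ℂ => MvPowerSeries.coeff w (V.prod sc p v t)) := by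
      intro w
      rw [funext fun d => V.contourInt_op_comp hq hη sc hsc n p (p + n • V.δ) v _ h2 d w]
      obtain ⟨M, hM, hb⟩ := V.exists_bound_op_comp hq hη sc hsc n p (p + n • V.δ) v w
      -- Dominated convergence exchanges the sum over degrees with the integral; the pointwise sums
      -- are Wick's theorem, valid at every point of the torus since η = 1.
      refine hasSum_contourInt D _ _ (fun d => ?_) M hM (fun d θ hθ => hb θ hθ d) fun θ => ?_
      · simp_rw [coeff_op_comp]
        refine continuous_finsetSum _ fun k _ => ?_
        have h3 : Continuous fun θ : Fin (n + 1) → ℝ => fun i : Fin n => θ i.succ :=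
          continuous_pi fun i => continuous_apply _
        exact ((V.continuous_coeff_prod hq hη sc hsc p v (n := n) k).comp h3).mul
          ((V.continuous_coeff_op sc hsc _ _ w).comp (continuous_apply 0))
      · exact hasSum_opOf_comp D V.δ p v (fun i => sc (torusPt D θ i))
          (fun i ε => V.field ε (torusPt D θ i)) (fun i ε => V.shift ε _)
          (fun i j _ ε ε' => V.contractible_torus hq hη ε ε' _ _) w
    have hlen : (List.replicate n (opInt D (V.op sc))).length = n := List.length_replicate
    refine ⟨⟨h1, fun w => ?_⟩, fun w => ?_⟩
    · have := (key w).summable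
      change Summable fun d => MvPowerSeries.coeff w (opInt D (V.op sc)
        (p + (List.replicate n (opInt D (V.op sc))).length • V.δ)
          (comp d (opPow V.δ (opInt D (V.op sc)) n p v)))
      rwa [hlen]
    · rw [← (key w).tsum_eq]
      change ∑' d, MvPowerSeries.coeff w (opInt D (V.op sc)
        (p + (List.replicate n (opInt D (V.op sc))).length • V.δ)
          (comp d (opPow V.δ (opInt D (V.op sc)) n p v))) = _
      rw [hlen]

end VertexPair

end
end QCoset

/-! ### Symmetrization of the integrand on the torus -/

namespace QCoset
noncomputable section

open MeasureTheory

theorem contourInt_perm (D : Params) {n : ℕ} (f : (Fin n → ℂ) → ℂ) (σ : Equiv.Perm (Fin n)) :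
    contourInt D (fun t => f fun i => t (σ i)) = contourInt D f := by
  have h1 := volume_measurePreserving_piCongrLeft (fun _ : Fin n => ℝ) σ.symm
  have e1 : ∀ θ : Fin n → ℝ, (MeasurableEquiv.piCongrLeft (fun _ : Fin n => ℝ) σ.symm) θ =
      fun i => θ (σ i) := by
    intro θ
    funext i
    have := Equiv.piCongrLeft_apply_apply (fun _ : Fin n => ℝ) σ.symm θ (σ i)
    rw [Equiv.symm_apply_apply] at this
    exact this
  have h2 := h1.setIntegral_preimage_emb (MeasurableEquiv.measurableEmbedding _)
    (fun θ => f fun j => uOf D (θ j)) (box n)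
  have h3 : (MeasurableEquiv.piCongrLeft (fun _ : Fin n => ℝ) σ.symm) ⁻¹' box n = box n := by
    ext θ
    rw [Set.mem_preimage, e1]
    simp only [box, Set.mem_Icc, Pi.le_def, Pi.zero_apply]
    rw [σ.forall_congr_right (q := fun i => 0 ≤ θ i),
      σ.forall_congr_right (q := fun i => θ i ≤ 2 * Real.pi)]
  rw [h3] at h2
  simp only [e1] at h2
  unfold contourInt
  rw [← box, h2]

theorem uOf_sub (D : Params) (θ θ' : ℝ) : uOf D θ - uOf D θ' = uOf D (θ - θ') := by
  unfold uOf
  push_cast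
  ring

theorem exp_uOf (D : Params) (hq : D.lq.re < 0) (θ : ℝ) :
    Complex.exp (2 * (D.lq * uOf D θ)) = Complex.exp (θ * Complex.I) := by
  have h := exp_uOf_sub D hq 0 θ
  have h0 : uOf D 0 = 0 := by simp [uOf]
  rw [h0, sub_zero, sub_zero] at h
  exact h

theorem norm_nome_zpow (D : Params) (s : ℝ) (m : ℤ) :
    ‖Complex.exp (2 * (s * D.lq)) ^ m‖ = Real.exp (m * (2 * (s * D.lq.re))) := by
  rw [← Complex.exp_int_mul, Complex.norm_exp]
  simp

/-- The theta function has no zeros on the translate of the torus by `a`, unless `a` is an integer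
multiple of `s`. -/
theorem th_uOf_add_ne_zero (D : Params) (hq : D.lq.re < 0) {s : ℝ} (hs : 0 < s) (a : ℝ)
    (ha : ∀ m : ℤ, (m : ℝ) * s ≠ a) (θ : ℝ) : th D s (uOf D θ + a) ≠ 0 := by
  rw [Ne, th_eq_zero_iff D hq hs]
  rintro ⟨m, hm⟩
  have h1 := congrArg norm hm
  rw [norm_nome_zpow, mul_add, mul_add, Complex.exp_add, norm_mul, exp_uOf D hq,
    Complex.norm_exp_ofReal_mul_I, one_mul, Complex.norm_exp] at h1
  have h2 := Real.exp_injective h1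
  simp at h2
  apply ha m
  have h3 : (m * s - a) * D.lq.re = 0 := by linarith
  rcases mul_eq_zero.mp h3 with h | h
  · linarith
  · exact absurd h hq.ne

theorem th_uOf_eq_zero (D : Params) (hq : D.lq.re < 0) {s : ℝ} (hs : 0 < s) (θ : ℝ)
    (h : th D s (uOf D θ) = 0) : ∃ k : ℤ, θ = k * (2 * Real.pi) := by
  obtain ⟨m, hm⟩ := (th_eq_zero_iff D hq hs _).mp h
  have h1 := congrArg norm hm
  rw [norm_nome_zpow, exp_uOf D hq, Complex.norm_exp_ofReal_mul_I, ← Real.exp_zero] at h1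
  have h2 := Real.exp_injective h1
  have h3 : (m : ℝ) = 0 := by
    have : s * D.lq.re ≠ 0 := mul_ne_zero hs.ne' hq.ne
    have h4 : (m : ℝ) * (s * D.lq.re) = 0 := by linarith
    exact (mul_eq_zero.mp h4).resolve_right this
  have h4 : m = 0 := by exact_mod_cast h3
  rw [h4, zpow_zero, exp_uOf D hq, Complex.exp_eq_one_iff] at hm
  obtain ⟨k, hk⟩ := hm
  refine ⟨k, ?_⟩
  have h5 : (θ : ℂ) * Complex.I = ((k * (2 * Real.pi) : ℝ) : ℂ) * Complex.I := by
    rw [hk]; push_cast; ring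
  exact_mod_cast mul_right_cancel₀ Complex.I_ne_zero h5

/-- A zero forces θ_i - θ_j into the countable set of multiples of 2π, whose preimage under a
surjective linear form is a null set. -/
theorem ae_th_ne_zero (D : Params) (hq : D.lq.re < 0) {s : ℝ} (hs : 0 < s) {n : ℕ} :
    ∀ᵐ θ : Fin n → ℝ, ∀ i j, i ≠ j → th D s (torusPt D θ i - torusPt D θ j) ≠ 0 := by
  rw [ae_all_iff]; intro i
  rw [ae_all_iff]; intro j
  by_cases hij : i = j
  · simp [hij]
  let L : (Fin n → ℝ) →ₗ[ℝ] ℝ := LinearMap.proj (R := ℝ) (φ := fun _ : Fin n => ℝ) i -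
    LinearMap.proj (R := ℝ) (φ := fun _ : Fin n => ℝ) j
  have hL : Function.Surjective L := fun y => ⟨Pi.single i y, by simp [L, Ne.symm hij]⟩
  let Z : Set ℝ := Set.range fun k : ℤ => (k : ℝ) * (2 * Real.pi)
  have hZ : Z.Countable := Set.countable_range _
  have h1 := (ae_comp_linearMap_mem_iff L (volume : Measure (Fin n → ℝ)) (volume : Measure ℝ) hL
    hZ.measurableSet.compl).mpr (hZ.ae_notMem volume)
  filter_upwards [h1] with θ hθ _ h0
  apply hθ
  simp only [torusPt, uOf_sub] at h0
  obtain ⟨k, hk⟩ := th_uOf_eq_zero D hq hs _ h0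
  exact ⟨k, hk.symm⟩

theorem prod_pairs_rev {n : ℕ} {R : Type*} [CommMonoid R] (g : Fin n → Fin n → R) :
    ∏ i : Fin n, ∏ j ∈ Finset.Ioi i, g i.rev j.rev = ∏ i : Fin n, ∏ j ∈ Finset.Ioi i, g j i := by
  rw [Finset.prod_sigma', Finset.prod_sigma']
  refine Finset.prod_bij' (fun x _ => ⟨x.2.rev, x.1.rev⟩) (fun x _ => ⟨x.2.rev, x.1.rev⟩) ?_ ?_
    (fun x _ => by simp) (fun x _ => by simp) (fun x _ => by simp)
  · intro x hx
    simp only [Finset.mem_sigma, Finset.mem_univ, Finset.mem_Ioi, true_and] at hx ⊢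
    exact Fin.rev_lt_rev.mpr hx
  · intro x hx
    simp only [Finset.mem_sigma, Finset.mem_univ, Finset.mem_Ioi, true_and] at hx ⊢
    exact Fin.rev_lt_rev.mpr hx

/-- The product of the theta function factors of the integrands of screening operators. -/
def thetaRatio (D : Params) (s : ℝ) (η π0 : ℂ) {n : ℕ} (t : Fin n → ℂ) : ℂ :=
  ∏ i, th D s (t i - η / 2 + η * (π0 - 2 * ((Fin.rev i : Fin n) : ℕ))) / th D s (t i - η / 2)

/-- The symmetrizing factor. -/
def thetaCross (D : Params) (s : ℝ) (η : ℂ) {n : ℕ} (t : Fin n → ℂ) : ℂ :=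
  ∏ i : Fin n, ∏ j ∈ Finset.Ioi i, th D s (t i - t j) / th D s (t i - t j + η)

/-- The symmetric product of theta functions. -/
def thetaSym (D : Params) (s : ℝ) (η π0 : ℂ) {n : ℕ} (t : Fin n → ℂ) : ℂ :=
  ∏ i, th D s (t i + η / 2 + η * π0 - η * n) / th D s (t i - η / 2)

theorem thetaCross_inv (D : Params) (s : ℝ) (η : ℂ) {n : ℕ} (t : Fin n → ℂ) :
    (thetaCross D s η t)⁻¹ =
      ∏ i : Fin n, ∏ j ∈ Finset.Ioi i, th D s (t i - t j + η) / th D s (t i - t j) := by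
  unfold thetaCross
  simp_rw [← Finset.prod_inv_distrib, inv_div]

/-- The denominators ∏ [t_i - η/2] are symmetric and factor out; what remains is
`sum_perm_orderedProd`, read in reversed order when η = 1. -/
theorem sum_perm_thetaRatio (D : Params) (hq : D.lq.re < 0) {s : ℝ} (hs : 0 < s) {η : ℂ}
    (hη : η = 1 ∨ η = -1) (h1 : th D s 1 ≠ 0) (π0 : ℂ) {n : ℕ} (t : Fin n → ℂ)
    (ht : ∀ i j, i ≠ j → th D s (t i - t j) ≠ 0) :
    ∑ σ : Equiv.Perm (Fin n), thetaRatio D s η π0 (fun i => t (σ i)) *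
        (thetaCross D s η (fun i => t (σ i)))⁻¹ =
      thFact D s n / th D s 1 ^ n * thetaSym D s η π0 t := by
  have hf := isThetaLike_th D hq hs
  have hd : ∀ σ : Equiv.Perm (Fin n), ∏ i, th D s (t (σ i) - η / 2) =
      ∏ i, th D s (t i - η / 2) := fun σ => Equiv.prod_comp σ fun i => th D s (t i - η / 2)
  unfold thetaRatio thetaSym
  simp_rw [Finset.prod_div_distrib, hd, thetaCross_inv, div_mul_eq_mul_div, ← Finset.sum_div]
  rw [← mul_div_assoc (thFact _ _ _), div_right_comm]
  congr 1
  rw [mul_div_right_comm]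
  unfold thFact
  rcases hη with rfl | rfl
  -- Reversal turns the shift 2(n-1-i) into 2i, so a = -1/2 + π0; since [·] is odd, it also turns
  -- the cross terms with +1 into those with -1.
  · have h2 := hf.sum_perm_orderedProd h1 n t ht (-1 / 2 + π0)
    rw [← Equiv.sum_comp (Equiv.mulRight (Fin.revPerm (n := n)))] at h2
    refine Eq.trans (Finset.sum_congr rfl fun σ _ => ?_) (h2.trans ?_)
    · unfold orderedProd
      have e2 := prod_pairs_rev fun i j : Fin n =>
        th D s (t (σ i) - t (σ j) - 1) / th D s (t (σ i) - t (σ j))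
      simp only [Equiv.coe_mulRight, Equiv.Perm.coe_mul, Function.comp_apply, Fin.revPerm_apply]
      rw [e2, mul_comm]
      congr 1
      · refine Finset.prod_congr rfl fun i _ => Finset.prod_congr rfl fun j _ => ?_
        rw [hf.map_sub_comm (t (σ j)),
          show t (σ j) - t (σ i) - 1 = -(t (σ i) - t (σ j) + 1) by ring, hf.odd, neg_div_neg_eq]
      · rw [← Equiv.prod_comp Fin.revPerm fun i : Fin n =>
          th D s (t (σ i) - 1 / 2 + 1 * (π0 - 2 * ((Fin.rev i : Fin n) : ℕ)))]
        refine Finset.prod_congr rfl fun i _ => ?_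
        simp only [Fin.revPerm_apply, Fin.rev_rev]
        congr 1
        ring
    · congr 1
      refine Finset.prod_congr rfl fun i _ => ?_
      congr 1
      ring
  -- No reversal is needed: +2(n-1-i) equals 2(n-1) - 2i, and the constant part 2(n-1) goes into a.
  · have h2 := hf.sum_perm_orderedProd h1 n t ht (1 / 2 - π0 + 2 * (n - 1))
    refine Eq.trans (Finset.sum_congr rfl fun σ _ => ?_) (h2.trans ?_)
    · unfold orderedProd
      rw [mul_comm]
      congr 1
      refine Finset.prod_congr rfl fun i _ => ?_
      congr 1
      rw [Fin.val_rev, Nat.cast_sub (by omega)]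
      push_cast
      ring
    · congr 1
      refine Finset.prod_congr rfl fun i _ => ?_
      congr 1
      ring

/-- The hypothesis `[1]_s ≠ 0`. -/
def Generic (s : ℝ) : Prop := ∀ m : ℤ, (m : ℝ) * s ≠ 1

namespace Generic

variable {s : ℝ} (h : Generic s)
include h

theorem th_sign_ne_zero (D : Params) (hq : D.lq.re < 0) (hs : 0 < s) {η : ℂ}
    (hη : η = 1 ∨ η = -1) (θ : ℝ) : th D s (uOf D θ + η) ≠ 0 := by
  rcases hη with rfl | rfl
  · have := th_uOf_add_ne_zero D hq hs 1 (fun m hm => h m hm) θ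
    rwa [Complex.ofReal_one] at this
  · have := th_uOf_add_ne_zero D hq hs (-1) (fun m hm => h (-m) (by push_cast; linarith)) θ
    rwa [Complex.ofReal_neg, Complex.ofReal_one] at this

/-- A zero on the contour would require ms = ±1/2, hence 2ms = ±1, so the condition on [1]_s also
protects the poles at ±1/2. -/
theorem th_half_ne_zero (D : Params) (hq : D.lq.re < 0) (hs : 0 < s) {η : ℂ}
    (hη : η = 1 ∨ η = -1) (θ : ℝ) : th D s (uOf D θ - η / 2) ≠ 0 := by
  rcases hη with rfl | rfl
  · have := th_uOf_add_ne_zero D hq hs (-1 / 2)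
      (fun m hm => h (-2 * m) (by push_cast; linarith)) θ
    rwa [show uOf D θ + ((-1 / 2 : ℝ) : ℂ) = uOf D θ - 1 / 2 by push_cast; ring] at this
  · have := th_uOf_add_ne_zero D hq hs (1 / 2)
      (fun m hm => h (2 * m) (by push_cast; linarith)) θ
    rwa [show uOf D θ + ((1 / 2 : ℝ) : ℂ) = uOf D θ - -1 / 2 by push_cast; ring] at this

theorem th_one_ne_zero (D : Params) (hq : D.lq.re < 0) (hs : 0 < s) : th D s 1 ≠ 0 := by
  have := h.th_sign_ne_zero D hq hs (Or.inl rfl) 0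
  rwa [show uOf D 0 = 0 by simp [uOf], zero_add] at this

/-- This infinite product is one of the factors of [u - u' - η], which has no zero on the torus. -/
theorem poch_ne_zero (D : Params) (hq : D.lq.re < 0) (hs : 0 < s) {η : ℂ}
    (hη : η = 1 ∨ η = -1) (θ θ' : ℝ) :
    poch (nome D s) (Complex.exp (2 * (D.lq * (uOf D θ' - uOf D θ + η)))) ≠ 0 := by
  have h1 := h.th_sign_ne_zero D hq hs (η := -η) (by rcases hη with rfl | rfl <;> simp) (θ - θ')
  obtain ⟨C, hC, h2⟩ := th_eq_poch_inv D hq hs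
  rw [h2, ← uOf_sub, show -(uOf D θ - uOf D θ' + -η) = uOf D θ' - uOf D θ + η by ring] at h1
  exact right_ne_zero_of_mul (right_ne_zero_of_mul h1)

end Generic

namespace VertexPair

variable {D : Params} (V : VertexPair D)

/-- The product of the currents, continued analytically. -/
def kernel (c : Bool → ℂ) (p : Mom) (v : Fock) (w : Idx →₀ ℕ) {n : ℕ} (t : Fin n → ℂ) : ℂ :=
  ∑ ε : Fin n → Bool, ((∏ i, c (ε i)) *
    ∏ i, ∏ j ∈ Finset.Ioi i, pairFactor D V.s V.η (ε i) (ε j) (t i) (t j)) *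
      MvPowerSeries.coeff w (vop D (∑ i, V.field (ε i) (t i)) p v)

/-- By the exchange relation each pair contraction times its cross factor is symmetric under
exchanging point and label together. The normal ordered exponential depends only on the sum of the
fields, so permuting the points is undone by permuting the summation labels. -/
theorem kernel_mul_cross_perm (hq : D.lq.re < 0) (hg : Generic V.s) (c : Bool → ℂ) (p : Mom)
    (v : Fock) (w : Idx →₀ ℕ) {n : ℕ} (θ : Fin n → ℝ) (σ : Equiv.Perm (Fin n)) :
    V.kernel c p v w (torusPt D fun i => θ (σ i)) *
        thetaCross D V.s V.η (torusPt D fun i => θ (σ i)) =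
      V.kernel c p v w (torusPt D θ) * thetaCross D V.s V.η (torusPt D θ) := by
  let L : Bool → Bool → ℝ → ℝ → ℂ := fun ε ε' x y =>
    pairFactor D V.s V.η ε ε' (uOf D x) (uOf D y) *
      (th D V.s (uOf D x - uOf D y) / th D V.s (uOf D x - uOf D y + V.η))
  have hL : ∀ ε ε' x y, L ε ε' x y = L ε' ε y x := by
    intro ε ε' x y
    have hp := hg.poch_ne_zero D hq V.pos V.sign
    have h1 := pairFactor_swap D hq V.pos ε ε' (uOf D x) (uOf D y) (hp x y) (hp y x)
    have a1 := hg.th_sign_ne_zero D hq V.pos V.sign (x - y)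
    have a2 := hg.th_sign_ne_zero D hq V.pos V.sign (y - x)
    rw [← uOf_sub] at a1 a2
    have o1 := th_odd D hq V.pos (uOf D x - uOf D y)
    have o2 := th_odd D hq V.pos (uOf D x - uOf D y - V.η)
    rw [neg_sub] at o1
    rw [show -(uOf D x - uOf D y - V.η) = uOf D y - uOf D x + V.η by ring] at o2
    dsimp only [L]
    rw [o1, o2]
    rw [o2] at a2
    rw [neg_div_neg_eq, ← mul_div_assoc, ← mul_div_assoc, div_eq_div_iff a1 (neg_ne_zero.mp a2)]
    linear_combination th D V.s (uOf D x - uOf D y) * h1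
  have key : ∀ θ : Fin n → ℝ, V.kernel c p v w (torusPt D θ) *
      thetaCross D V.s V.η (torusPt D θ) = ∑ ε : Fin n → Bool, ((∏ i, c (ε i)) *
    ∏ i, ∏ j ∈ Finset.Ioi i, L (ε i) (ε j) (θ i) (θ j)) *
      MvPowerSeries.coeff w (vop D (∑ i, V.field (ε i) (uOf D (θ i))) p v) := by
    intro θ
    unfold kernel thetaCross
    rw [Finset.sum_mul]
    refine Finset.sum_congr rfl fun ε _ => ?_
    simp only [L, Finset.prod_mul_distrib, torusPt]
    ring
  rw [key, key, ← (Equiv.arrowCongr σ.symm (Equiv.refl Bool)).sum_comp]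
  refine Finset.sum_congr rfl fun ε _ => ?_
  have e1 : ∀ i, (Equiv.arrowCongr σ.symm (Equiv.refl Bool)) ε i = ε (σ i) := fun i => rfl
  simp only [e1]
  rw [Equiv.prod_comp σ fun i => c (ε i),
    Equiv.sum_comp σ fun i => V.field (ε i) (uOf D (θ i)),
    prod_perm_pairs σ (fun i j => L (ε i) (ε j) (θ i) (θ j)) fun i j => hL _ _ _ _]

theorem continuous_kernel (hq : D.lq.re < 0) (hg : Generic V.s) (c : Bool → ℂ) (p : Mom)
    (v : Fock) (w : Idx →₀ ℕ) {n : ℕ} :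
    Continuous fun θ : Fin n → ℝ => V.kernel c p v w (torusPt D θ) := by
  unfold kernel
  refine continuous_finsetSum _ fun ε _ => (continuous_const.mul
    (continuous_finsetProd _ fun i _ => continuous_finsetProd _ fun j _ =>
      V.continuous_pairFactor_torus hq (hg.poch_ne_zero D hq V.pos V.sign) _ _ i j)).mul ?_
  have h : Continuous fun t : Fin n → ℂ =>
      MvPowerSeries.coeff w (vop D (∑ i, V.field (ε i) (t i)) p v) :=
    continuous_iff_continuousAt.mpr fun t => (analyticAt_coeff_vop D
      (fun t : Fin n → ℂ => ∑ i, V.field (ε i) (t i)) t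
      (V.analyticAt_sum_field ε t) p v w).continuousAt
  exact h.comp (continuous_torusPt D)

end VertexPair

section continuity

variable (D : Params) (hq : D.lq.re < 0) {s : ℝ} (hs : 0 < s) (hg : Generic s) {η : ℂ}
  (hη : η = 1 ∨ η = -1)
include hq hs hg hη

theorem continuous_thetaRatio (π0 : ℂ) {n : ℕ} :
    Continuous fun θ : Fin n → ℝ => thetaRatio D s η π0 (torusPt D θ) := by
  have hc := (th_differentiable D hq hs).continuous
  have ht : ∀ i : Fin n, Continuous fun θ : Fin n → ℝ => torusPt D θ i := fun i =>
    (continuous_apply i).comp (continuous_torusPt D)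
  exact continuous_finsetProd _ fun i _ => (hc.comp (((ht i).sub continuous_const).add
    continuous_const)).div (hc.comp ((ht i).sub continuous_const))
    fun θ => hg.th_half_ne_zero D hq hs hη (θ i)

theorem continuous_thetaSym (π0 : ℂ) {n : ℕ} :
    Continuous fun θ : Fin n → ℝ => thetaSym D s η π0 (torusPt D θ) := by
  have hc := (th_differentiable D hq hs).continuous
  have ht : ∀ i : Fin n, Continuous fun θ : Fin n → ℝ => torusPt D θ i := fun i =>
    (continuous_apply i).comp (continuous_torusPt D)
  exact continuous_finsetProd _ fun i _ => (hc.comp ((((ht i).add continuous_const).add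
    continuous_const).sub continuous_const)).div (hc.comp ((ht i).sub continuous_const))
    fun θ => hg.th_half_ne_zero D hq hs hη (θ i)

theorem continuous_thetaCross {n : ℕ} :
    Continuous fun θ : Fin n → ℝ => thetaCross D s η (torusPt D θ) := by
  have hc := (th_differentiable D hq hs).continuous
  have ht : ∀ i : Fin n, Continuous fun θ : Fin n → ℝ => torusPt D θ i := fun i =>
    (continuous_apply i).comp (continuous_torusPt D)
  refine continuous_finsetProd _ fun i _ => continuous_finsetProd _ fun j _ =>
    (hc.comp ((ht i).sub (ht j))).div (hc.comp (((ht i).sub (ht j)).add continuous_const))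
    fun θ => ?_
  have := hg.th_sign_ne_zero D hq hs hη (θ i - θ j)
  rwa [← uOf_sub] at this

end continuity

namespace VertexPair

variable {D : Params} (V : VertexPair D)

theorem continuous_symmetrized (hq : D.lq.re < 0) (hg : Generic V.s) (c : Bool → ℂ) (p : Mom)
    (v : Fock) (w : Idx →₀ ℕ) (π0 : ℂ) (n : ℕ) :
    Continuous fun θ : Fin n → ℝ => V.kernel c p v w (torusPt D θ) *
      thetaCross D V.s V.η (torusPt D θ) * thetaSym D V.s V.η π0 (torusPt D θ) :=
  ((V.continuous_kernel hq hg c p v w).mul (continuous_thetaCross D hq V.pos hg V.sign)).mul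
    (continuous_thetaSym D hq V.pos hg V.sign π0)

/-- The symmetrization of the integrand. -/
theorem contourInt_symmetrize (hq : D.lq.re < 0) (hg : Generic V.s) (c : Bool → ℂ) (p : Mom)
    (v : Fock) (w : Idx →₀ ℕ) (π0 : ℂ) (n : ℕ) :
    contourInt D (fun t : Fin n → ℂ => thetaRatio D V.s V.η π0 t * V.kernel c p v w t) =
      prefactor D V.s n * contourInt D fun t : Fin n → ℂ => V.kernel c p v w t *
        thetaCross D V.s V.η t * thetaSym D V.s V.η π0 t := by
  have hs := V.pos
  have h1 := hg.th_one_ne_zero D hq hs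
  let f : (Fin n → ℂ) → ℂ := fun t => thetaRatio D V.s V.η π0 t * V.kernel c p v w t
  have hfc : Continuous fun θ : Fin n → ℝ => f (torusPt D θ) :=
    (continuous_thetaRatio D hq hs hg V.sign π0).mul (V.continuous_kernel hq hg c p v w)
  have e1 : (n.factorial : ℂ) * contourInt D f =
      contourInt D fun t => ∑ σ : Equiv.Perm (Fin n), f fun i => t (σ i) := by
    rw [contourInt_sum D Finset.univ (fun (σ : Equiv.Perm (Fin n)) t => f fun i => t (σ i))]
    · simp_rw [contourInt_perm]
      rw [Finset.sum_const, Finset.card_univ, Fintype.card_perm, Fintype.card_fin, nsmul_eq_mul]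
    · intro σ _
      exact hfc.comp (g := fun θ : Fin n → ℝ => f (torusPt D θ))
        (continuous_pi fun i => continuous_apply (σ i))
  have e2 : contourInt D (fun t => ∑ σ : Equiv.Perm (Fin n), f fun i => t (σ i)) =
      contourInt D fun t : Fin n → ℂ => thFact D V.s n / th D V.s 1 ^ n * (V.kernel c p v w t *
        thetaCross D V.s V.η t * thetaSym D V.s V.η π0 t) := by
    unfold contourInt
    congr 1
    refine integral_congr_ae (ae_restrict_of_ae ?_)
    -- The symmetrization identity divides by [u_i - u_j], so it is used off the diagonals, which
    -- form a null set.
    filter_upwards [ae_th_ne_zero D hq hs (n := n)] with θ hθ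
    have e3 := sum_perm_thetaRatio D hq hs V.sign h1 π0 (torusPt D θ) hθ
    change ∑ σ : Equiv.Perm (Fin n), f (fun i => torusPt D θ (σ i)) =
      thFact D V.s n / th D V.s 1 ^ n * (V.kernel c p v w (torusPt D θ) *
        thetaCross D V.s V.η (torusPt D θ) * thetaSym D V.s V.η π0 (torusPt D θ))
    rw [mul_left_comm, ← e3, Finset.mul_sum]
    refine Finset.sum_congr rfl fun σ _ => ?_
    rw [← V.kernel_mul_cross_perm hq hg c p v w θ σ]
    -- The cross factor must be invertible to be moved into the symmetric part; its numerators
    -- vanish exactly on the excluded diagonals.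
    have hx : thetaCross D V.s V.η (fun i => torusPt D θ (σ i)) ≠ 0 := by
      refine Finset.prod_ne_zero_iff.mpr fun i _ => Finset.prod_ne_zero_iff.mpr fun j hj => ?_
      refine div_ne_zero (hθ _ _ fun h => ?_) ?_
      · exact (Finset.mem_Ioi.mp hj).ne (σ.injective h)
      · have := hg.th_sign_ne_zero D hq hs V.sign (θ (σ i) - θ (σ j))
        rwa [← uOf_sub] at this
    change thetaRatio D V.s V.η π0 (fun i => torusPt D θ (σ i)) *
        V.kernel c p v w (fun i => torusPt D θ (σ i)) =
      V.kernel c p v w (fun i => torusPt D θ (σ i)) *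
        thetaCross D V.s V.η (fun i => torusPt D θ (σ i)) *
        (thetaRatio D V.s V.η π0 (fun i => torusPt D θ (σ i)) *
          (thetaCross D V.s V.η (fun i => torusPt D θ (σ i)))⁻¹)
    field_simp
  have e3 := e1.trans e2
  rw [contourInt_const_mul] at e3
  have hn : (n.factorial : ℂ) ≠ 0 := by exact_mod_cast n.factorial_ne_zero
  unfold prefactor
  rw [← mul_right_inj' hn, e3]
  field_simp

end VertexPair

end
end QCoset

/-! ### q-numbers and the modes of the boson fields -/

namespace QCoset
noncomputable section

theorem qp_add (D : Params) (a b : ℂ) : qp D (a + b) = qp D a * qp D b := by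
  unfold qp
  rw [add_mul, Complex.exp_add]

theorem qp_neg (D : Params) (a : ℂ) : qp D (-a) = (qp D a)⁻¹ := by
  unfold qp
  rw [neg_mul, Complex.exp_neg]

theorem qp_ne_zero (D : Params) (a : ℂ) : qp D a ≠ 0 := Complex.exp_ne_zero _

theorem qp_nat_mul (D : Params) (a : ℂ) (n : ℕ) : qp D (n * a) = qp D a ^ n := by
  unfold qp
  rw [mul_assoc, Complex.exp_nat_mul]

theorem norm_qp_ofReal (D : Params) (a : ℝ) : ‖qp D a‖ = Real.exp (a * D.lq.re) := by
  unfold qp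
  rw [Complex.norm_exp, Complex.re_ofReal_mul]

theorem qp_sub_inv_ne_zero (D : Params) (hq : D.lq.re < 0) {a : ℝ} (ha : a ≠ 0) :
    qp D a - (qp D a)⁻¹ ≠ 0 := by
  intro h
  have h1 := congrArg norm (sub_eq_zero.mp h)
  rw [norm_inv, norm_qp_ofReal, ← Real.exp_neg] at h1
  have h2 := Real.exp_injective h1
  have : a * D.lq.re = 0 := by linarith
  exact (mul_ne_zero ha hq.ne) this

theorem br_eq (D : Params) (a : ℝ) :
    br D a = (qp D a - (qp D a)⁻¹) / (qp D 1 - (qp D 1)⁻¹) := by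
  unfold br
  rw [qp_neg, qp_neg]

theorem qp_one_sub_ne_zero (D : Params) (hq : D.lq.re < 0) : qp D 1 - (qp D 1)⁻¹ ≠ 0 := by
  have := qp_sub_inv_ne_zero D hq one_ne_zero
  rwa [Complex.ofReal_one] at this

theorem br_ne_zero (D : Params) (hq : D.lq.re < 0) {a : ℝ} (ha : a ≠ 0) : br D a ≠ 0 := by
  rw [br_eq]
  exact div_ne_zero (qp_sub_inv_ne_zero D hq ha) (qp_one_sub_ne_zero D hq)

theorem br_neg (D : Params) (a : ℝ) : br D (-a) = -br D a := by
  unfold br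
  rw [Complex.ofReal_neg, neg_neg]
  ring

section modes

variable (D : Params) (hq : D.lq.re < 0) (u : ℂ) (δ C : ℝ) (m : ℕ+)

theorem pnat_cast_ne : ((m : ℕ) : ℝ) ≠ 0 := by exact_mod_cast m.ne_zero

include hq

theorem phi_pos (j : Fin 3) : phi D j 1 1 C u δ (.osc j (m : ℕ)) =
    (br D (C * (m : ℕ)))⁻¹ * (zOf D u ^ (m : ℕ))⁻¹ * qp D (δ * (m : ℕ)) := by
  have h := br_ne_zero D hq (pnat_cast_ne m)
  simp only [phi, true_and, ne_eq, Nat.cast_eq_zero, m.ne_zero, not_false_eq_true, if_true,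
    Int.cast_natCast, one_mul, Nat.abs_cast, zpow_neg, zpow_natCast, Complex.ofReal_natCast]
  field_simp

theorem phi_neg (j : Fin 3) : phi D j 1 1 C u δ (.osc j (-((m : ℕ) : ℤ))) =
    -((br D (C * (m : ℕ)))⁻¹ * zOf D u ^ (m : ℕ) * qp D (δ * (m : ℕ))) := by
  have h := br_ne_zero D hq (pnat_cast_ne m)
  simp only [phi, true_and, ne_eq, neg_eq_zero, Nat.cast_eq_zero, m.ne_zero, not_false_eq_true,
    if_true, Int.cast_neg, Int.cast_natCast, one_mul, abs_neg, Nat.abs_cast, neg_neg, zpow_natCast,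
    mul_neg, br_neg, Complex.ofReal_natCast]
  field_simp

omit hq in
theorem phi_of_ne {j j' : Fin 3} (h : j' ≠ j) (n : ℤ) : phi D j 1 1 C u δ (.osc j' n) = 0 := by
  simp [phi, h]

theorem phi0_pos : phi0 D 1 1 C u 0 (.osc 0 (m : ℕ)) =
    (br D (C * (m : ℕ)))⁻¹ * (zOf D u ^ (m : ℕ))⁻¹ := by
  have h := br_ne_zero D hq (pnat_cast_ne m)
  simp only [phi0, true_and, ne_eq, Nat.cast_eq_zero, m.ne_zero, not_false_eq_true, if_true,
    Int.cast_natCast, one_mul, zpow_neg, zpow_natCast, Complex.ofReal_zero, zero_mul]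
  rw [show qp D 0 = 1 by simp [qp]]
  field_simp

theorem phi0_neg : phi0 D 1 1 C u 0 (.osc 0 (-((m : ℕ) : ℤ))) =
    -((br D (C * (m : ℕ)))⁻¹ * zOf D u ^ (m : ℕ)) := by
  have h := br_ne_zero D hq (pnat_cast_ne m)
  simp only [phi0, true_and, ne_eq, neg_eq_zero, Nat.cast_eq_zero, m.ne_zero, not_false_eq_true,
    if_true, Int.cast_neg, Int.cast_natCast, one_mul, neg_neg, zpow_natCast,
    mul_neg, br_neg, Complex.ofReal_zero, zero_mul]
  rw [show qp D 0 = 1 by simp [qp]]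
  field_simp

omit hq in
theorem phi0_of_ne {j : Fin 3} (h : j ≠ 0) (n : ℤ) : phi0 D 1 1 C u 0 (.osc j n) = 0 := by
  simp [phi0, h]

theorem phi0'_pos : phi0' D 1 1 C u 0 (.osc 0 (m : ℕ)) =
    (br D (C * (m : ℕ)))⁻¹ * (br D ((D.r - D.k) * (m : ℕ)) / br D (D.r * (m : ℕ))) *
      (zOf D u ^ (m : ℕ))⁻¹ := by
  have h := br_ne_zero D hq (pnat_cast_ne m)
  simp only [phi0', true_and, ne_eq, Nat.cast_eq_zero, m.ne_zero, not_false_eq_true, if_true,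
    Int.cast_natCast, one_mul, zpow_neg, zpow_natCast, Complex.ofReal_zero, zero_mul]
  rw [show qp D 0 = 1 by simp [qp]]
  field_simp

theorem phi0'_neg : phi0' D 1 1 C u 0 (.osc 0 (-((m : ℕ) : ℤ))) =
    -((br D (C * (m : ℕ)))⁻¹ * (br D ((D.r - D.k) * (m : ℕ)) / br D (D.r * (m : ℕ))) *
      zOf D u ^ (m : ℕ)) := by
  have h := br_ne_zero D hq (pnat_cast_ne m)
  simp only [phi0', true_and, ne_eq, neg_eq_zero, Nat.cast_eq_zero, m.ne_zero, not_false_eq_true,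
    if_true, Int.cast_neg, Int.cast_natCast, one_mul, neg_neg, zpow_natCast,
    mul_neg, br_neg, Complex.ofReal_zero, zero_mul]
  rw [show qp D 0 = 1 by simp [qp]]
  field_simp

omit hq

theorem phi0'_of_ne {j : Fin 3} (h : j ≠ 0) (n : ℤ) : phi0' D 1 1 C u 0 (.osc j n) = 0 := by
  simp [phi0', h]

theorem phiP_pos (j : Fin 3) : phiP D j 1 2 u C (.osc j (m : ℕ)) =
    (qp D 1 - (qp D 1)⁻¹) * (br D (m : ℕ) / br D (2 * (m : ℕ))) * (zOf D u ^ (m : ℕ))⁻¹ *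
      qp D (C * (m : ℕ)) := by
  simp only [phiP, true_and, Nat.cast_pos, m.pos, if_true, Int.cast_natCast, one_mul,
    zpow_neg, zpow_natCast, qp_neg, Complex.ofReal_natCast]

theorem phiP_neg (j j' : Fin 3) : phiP D j 1 2 u C (.osc j' (-((m : ℕ) : ℤ))) = 0 := by
  have : ¬ (0 : ℤ) < -((m : ℕ) : ℤ) := by simp
  simp only [phiP, this, and_false, if_false]

theorem phiP_of_ne {j j' : Fin 3} (h : j' ≠ j) (n : ℤ) : phiP D j 1 2 u C (.osc j' n) = 0 := by
  simp [phiP, h]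

theorem phiM_neg (j : Fin 3) : phiM D j 1 2 u C (.osc j (-((m : ℕ) : ℤ))) =
    (qp D 1 - (qp D 1)⁻¹) * (br D (m : ℕ) / br D (2 * (m : ℕ))) * zOf D u ^ (m : ℕ) *
      qp D (C * (m : ℕ)) := by
  have : -((m : ℕ) : ℤ) < 0 := by simp
  simp only [phiM, true_and, this, if_true, Int.cast_neg, Int.cast_natCast, one_mul,
    neg_neg, zpow_natCast, qp_neg, Complex.ofReal_natCast]

theorem phiM_pos (j j' : Fin 3) : phiM D j 1 2 u C (.osc j' (m : ℕ)) = 0 := by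
  have : ¬ ((m : ℕ) : ℤ) < 0 := by simp
  simp only [phiM, this, and_false, if_false]

theorem phiM_of_ne {j j' : Fin 3} (h : j' ≠ j) (n : ℤ) : phiM D j 1 2 u C (.osc j' n) = 0 := by
  simp [phiM, h]

end modes

section differentiable

variable (D : Params)

theorem differentiable_zOf_zpow (n : ℤ) : Differentiable ℂ fun u => zOf D u ^ n := by
  have : (fun u => zOf D u ^ n) = fun u => Complex.exp (n * (2 * u * D.lq)) := by
    funext u
    rw [Complex.exp_int_mul]
    rfl
  rw [this]
  fun_prop

theorem differentiable_phi (j : Fin 3) (A B C δ : ℝ) (m : Mode) :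
    Differentiable ℂ fun u => phi D j A B C u δ m := by
  have h := fun n => differentiable_zOf_zpow D n
  cases m <;> simp only [phi, logz] <;> split_ifs <;> fun_prop

theorem differentiable_phi0 (A B C δ : ℝ) (m : Mode) :
    Differentiable ℂ fun u => phi0 D A B C u δ m := by
  have h := fun n => differentiable_zOf_zpow D n
  cases m <;> simp only [phi0, logz] <;> split_ifs <;> fun_prop

theorem differentiable_phi0' (A B C δ : ℝ) (m : Mode) :
    Differentiable ℂ fun u => phi0' D A B C u δ m := by
  have h := fun n => differentiable_zOf_zpow D n
  cases m <;> simp only [phi0', logz] <;> split_ifs <;> fun_prop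

theorem differentiable_phiP (j : Fin 3) (A B C : ℝ) (m : Mode) :
    Differentiable ℂ fun u => phiP D j A B u C m := by
  have h := fun n => differentiable_zOf_zpow D n
  cases m <;> simp only [phiP] <;> (try split_ifs) <;> fun_prop

theorem differentiable_phiM (j : Fin 3) (A B C : ℝ) (m : Mode) :
    Differentiable ℂ fun u => phiM D j A B u C m := by
  have h := fun n => differentiable_zOf_zpow D n
  cases m <;> simp only [phiM] <;> (try split_ifs) <;> fun_prop

end differentiable

/-- The commutators of the oscillators. -/
theorem comm_zero (D : Params) (m : ℕ+) : comm D (0, m) =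
    br D (2 * (m : ℕ)) * br D (D.k * (m : ℕ)) / (m : ℕ) *
      (br D (D.r * (m : ℕ)) / br D ((D.r - D.k) * (m : ℕ))) := by
  simp [comm]

theorem comm_one (D : Params) (m : ℕ+) : comm D (1, m) =
    br D (2 * (m : ℕ)) * br D ((D.k + 2) * (m : ℕ)) / (m : ℕ) := by
  simp [comm]

theorem comm_two (D : Params) (m : ℕ+) : comm D (2, m) =
    -(br D (2 * (m : ℕ)) * br D (D.k * (m : ℕ)) / (m : ℕ)) := by
  simp [comm]

end
end QCoset

/-! ### Oscillator contractions of E, F and S -/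

namespace QCoset
noncomputable section

theorem nome_pow (D : Params) (s : ℝ) (m : ℕ) : nome D s ^ m = qp D (s * m) ^ 2 := by
  unfold nome qp
  rw [← Complex.exp_nat_mul, ← Complex.exp_nat_mul]
  congr 1
  push_cast
  ring

theorem exp_sub_pow (D : Params) (u u' : ℂ) (m : ℕ) :
    Complex.exp (2 * (D.lq * (u' - u))) ^ m = zOf D u' ^ m * (zOf D u ^ m)⁻¹ := by
  unfold zOf qp
  rw [← Complex.exp_nat_mul, ← Complex.exp_nat_mul, ← Complex.exp_nat_mul, ← Complex.exp_neg,
    ← Complex.exp_add]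
  congr 1
  ring

theorem exp_sub_add_pow (D : Params) (u u' : ℂ) (m : ℕ) :
    Complex.exp (2 * (D.lq * (u' - u + 1))) ^ m =
      zOf D u' ^ m * (zOf D u ^ m)⁻¹ * qp D m ^ 2 := by
  rw [← exp_sub_pow]
  unfold qp
  rw [← Complex.exp_nat_mul, ← Complex.exp_nat_mul, ← Complex.exp_nat_mul, ← Complex.exp_add]
  congr 1
  push_cast
  ring

theorem exp_sub_sub_pow (D : Params) (u u' : ℂ) (m : ℕ) :
    Complex.exp (2 * (D.lq * (u' - u - 1))) ^ m =
      zOf D u' ^ m * (zOf D u ^ m)⁻¹ * (qp D m)⁻¹ ^ 2 := by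
  rw [← exp_sub_pow, ← qp_neg]
  unfold qp
  rw [← Complex.exp_nat_mul, ← Complex.exp_nat_mul, ← Complex.exp_nat_mul, ← Complex.exp_add]
  congr 1
  push_cast
  ring

theorem sq_sub_one_ne_zero {a : ℂ} (ha : a ≠ 0) (h : a - a⁻¹ ≠ 0) : a ^ 2 - 1 ≠ 0 := by
  intro h1
  apply h
  field_simp
  rw [h1, mul_zero]

/-- The powers of `q` in the commutators of degree `m`. -/
theorem exists_exponents (D : Params) (hk : 0 < D.k) (hr : (D.k : ℝ) < D.r) (hq : D.lq.re < 0)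
    (m : ℕ+) : ∃ g K R : ℂ, (g ≠ 0 ∧ K ≠ 0 ∧ R ≠ 0) ∧
      (g ^ 4 - 1 ≠ 0 ∧ K ^ 4 - 1 ≠ 0 ∧ R ^ 2 - 1 ≠ 0 ∧ K ^ 4 * g ^ 4 - 1 ≠ 0 ∧
        R ^ 2 * K ^ 4 - 1 ≠ 0) ∧
      (qp D (m : ℕ) = g ∧ qp D (2 * (m : ℕ)) = g ^ 2 ∧ qp D (D.k * (m : ℕ)) = K ^ 2 ∧
      qp D ((D.k + 2) * (m : ℕ)) = K ^ 2 * g ^ 2 ∧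
      qp D ((D.r - D.k) * (m : ℕ)) = R ∧ qp D (D.r * (m : ℕ)) = R * K ^ 2) ∧
      (qp D (D.k / 2 * (m : ℕ)) = K ∧ qp D (-D.k / 2 * (m : ℕ)) = K⁻¹ ∧
      qp D ((D.k + 2) / 2 * (m : ℕ)) = K * g ∧
      qp D (-(D.k + 2) / 2 * (m : ℕ)) = (K * g)⁻¹) := by
  have hm : ((m : ℕ) : ℝ) ≠ 0 := pnat_cast_ne m
  have hk' : (0 : ℝ) < D.k := by exact_mod_cast hk
  -- The letters are g = q^m, K = q^(km/2) and R = q^((r-k)m). Every power of q in the contractions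
  -- is a Laurent monomial in them, so each contraction becomes a rational identity.
  have q1 : qp D (2 * (m : ℕ)) = qp D m ^ 2 := by
    rw [← qp_nat_mul]; push_cast; rfl
  have q2 : qp D (D.k * (m : ℕ)) = qp D (D.k / 2 * m) ^ 2 := by
    rw [← qp_nat_mul]; push_cast; ring_nf
  have q6 : qp D ((D.k + 2) * (m : ℕ)) = qp D (D.k / 2 * m) ^ 2 * qp D m ^ 2 := by
    rw [← q1, ← q2, ← qp_add]; ring_nf
  have q3 : qp D (D.r * (m : ℕ)) = qp D ((D.r - D.k) * m) * qp D (D.k / 2 * m) ^ 2 := by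
    rw [← q2, ← qp_add]; ring_nf
  have q4 : qp D ((D.k + 2) / 2 * (m : ℕ)) = qp D (D.k / 2 * m) * qp D m := by
    rw [← qp_add]; ring_nf
  have q5 : qp D (-D.k / 2 * (m : ℕ)) = (qp D (D.k / 2 * m))⁻¹ := by
    rw [← qp_neg]; ring_nf
  have q7 : qp D (-(D.k + 2) / 2 * (m : ℕ)) = (qp D (D.k / 2 * m) * qp D m)⁻¹ := by
    rw [← q4, ← qp_neg]; ring_nf
  have key : ∀ a : ℝ, a ≠ 0 → qp D (a * (m : ℕ)) ^ 2 - 1 ≠ 0 := fun a ha => by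
    have h := qp_sub_inv_ne_zero D hq (mul_ne_zero ha hm)
    rw [Complex.ofReal_mul, Complex.ofReal_natCast] at h
    exact sq_sub_one_ne_zero (qp_ne_zero D _) h
  have n1 := key 2 two_ne_zero
  have n2 := key D.k hk'.ne'
  have n3 := key (D.r - D.k) (sub_pos.mpr hr).ne'
  have n4 := key (D.k + 2) (by positivity)
  have n5 := key D.r (hk'.trans hr).ne'
  push_cast at n1 n2 n3 n4 n5
  rw [q1, ← pow_mul] at n1
  rw [q2, ← pow_mul] at n2
  rw [q6, mul_pow, ← pow_mul, ← pow_mul] at n4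
  rw [q3, mul_pow, ← pow_mul] at n5
  exact ⟨_, _, _, ⟨qp_ne_zero D m, qp_ne_zero D (D.k / 2 * m), qp_ne_zero D ((D.r - D.k) * m)⟩,
    ⟨n1, n2, n3, n4, n5⟩, ⟨rfl, q1, q2, q6, rfl, q3⟩, ⟨rfl, q5, q4, q7⟩⟩

/-- Differentiability of the modes. -/
theorem Current.differentiable_E (D : Params) (m : Mode) :
    Differentiable ℂ (fun u => (curE D).one u m) ∧ Differentiable ℂ (fun u => (curE D).two u m) := by
  have h1 := fun j δ => differentiable_phi D j 1 1 D.k δ m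
  have h2 := differentiable_phi0 D 1 1 D.k 0 m
  have h3 := fun j C => differentiable_phiP D j 1 2 C m
  have h4 := fun j C => differentiable_phiM D j 1 2 C m
  simp only [curE, Pi.add_apply, Pi.sub_apply, Pi.neg_apply]
  constructor <;> fun_prop

theorem Current.differentiable_F (D : Params) (m : Mode) :
    Differentiable ℂ (fun u => (curF D).one u m) ∧ Differentiable ℂ (fun u => (curF D).two u m) := by
  have h1 := fun j δ => differentiable_phi D j 1 1 D.k δ m
  have h2 := differentiable_phi0' D 1 1 D.k 0 m
  have h3 := fun j C => differentiable_phiP D j 1 2 C m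
  have h4 := fun j C => differentiable_phiM D j 1 2 C m
  simp only [curF, Pi.add_apply, Pi.sub_apply, Pi.neg_apply]
  constructor <;> fun_prop

theorem Current.differentiable_S (D : Params) (m : Mode) :
    Differentiable ℂ (fun u => (curS D).one u m) ∧ Differentiable ℂ (fun u => (curS D).two u m) := by
  have h1 := fun j δ => differentiable_phi D j 1 1 (D.k + 2) δ m
  have h3 := fun j C => differentiable_phiP D j 1 2 C m
  have h4 := fun j C => differentiable_phiM D j 1 2 C m
  simp only [curS, Pi.add_apply, Pi.sub_apply, Pi.neg_apply]
  constructor <;> fun_prop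

/-- The two exponents of `E(z)`. -/
def fieldE (D : Params) (ε : Bool) (u : ℂ) : Field :=
  if ε then (curE D).one u else (curE D).two u

/-- The two exponents of `F(z)`. -/
def fieldF (D : Params) (ε : Bool) (u : ℂ) : Field :=
  if ε then (curF D).one u else (curF D).two u

/-- The two exponents of `S(z)`. -/
def fieldS (D : Params) (ε : Bool) (u : ℂ) : Field :=
  if ε then (curS D).two u else (curS D).one u

/-- The φ₂ and φ₀ contractions combine by [rm] = q^(-km)[(r-k)m] + q^((r-k)m)[km], which cancels the
pole at [km] and leaves period r-k. For labels (false, true) nothing else contracts: φ^(-) contains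
only creation modes and φ^(+) only annihilation modes. The other labels add one or both of those
contractions. -/
theorem oscillators_E (D : Params) (hk : 0 < D.k) (hr : (D.k : ℝ) < D.r) (hq : D.lq.re < 0)
    (ε ε' : Bool) (u u' : ℂ) (m : ℕ+) :
    ∑ j, contr D (fieldE D ε u) (fieldE D ε' u') (j, m) =
      pairCoeff D (D.r - D.k) 1 ε ε' (u' - u) m := by
  have hm : ((m : ℕ) : ℂ) ≠ 0 := by exact_mod_cast m.ne_zero
  have n4 := qp_one_sub_ne_zero D hq
  have z1 : zOf D u ^ (m : ℕ) ≠ 0 := pow_ne_zero _ (Complex.exp_ne_zero _)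
  have z2 : zOf D u' ^ (m : ℕ) ≠ 0 := pow_ne_zero _ (Complex.exp_ne_zero _)
  obtain ⟨g, K, R, ⟨g0, K0, R0⟩, ⟨m1, m2, m3, m4, m5⟩, ⟨q1, q2, q3, q4, q5, q6⟩,
    ⟨k1, k2, k3, k4⟩⟩ := exists_exponents D hk hr hq m
  have m3' : 1 - R ^ 2 ≠ 0 := fun h => m3 (by linear_combination -h)
  cases ε <;> cases ε' <;>
  · rw [Fin.sum_univ_three]
    simp only [contr, fieldE, if_true, if_false, Bool.false_eq_true, curE, Pi.add_apply,
      Pi.sub_apply, Pi.neg_apply, phi_pos D hq, phi_neg D hq, phi0_pos D hq, phi0_neg D hq,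
      phiP_pos, phiP_neg, phiM_pos, phiM_neg, comm_zero, comm_one, comm_two, br_eq,
      phi_of_ne D _ _ _ (show (0 : Fin 3) ≠ 2 by decide),
      phi_of_ne D _ _ _ (show (1 : Fin 3) ≠ 2 by decide),
      phi0_of_ne D _ _ (show (1 : Fin 3) ≠ 0 by decide),
      phi0_of_ne D _ _ (show (2 : Fin 3) ≠ 0 by decide),
      phiP_of_ne D _ _ (show (0 : Fin 3) ≠ 2 by decide),
      phiP_of_ne D _ _ (show (1 : Fin 3) ≠ 2 by decide),
      phiP_of_ne D _ _ (show (0 : Fin 3) ≠ 1 by decide),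
      phiP_of_ne D _ _ (show (2 : Fin 3) ≠ 1 by decide),
      phiM_of_ne D _ _ (show (0 : Fin 3) ≠ 2 by decide),
      phiM_of_ne D _ _ (show (1 : Fin 3) ≠ 2 by decide),
      phiM_of_ne D _ _ (show (0 : Fin 3) ≠ 1 by decide),
      phiM_of_ne D _ _ (show (2 : Fin 3) ≠ 1 by decide),
      pairCoeff, pairNum, pairDen, sub_neg_eq_add, ← sub_eq_add_neg, exp_sub_add_pow,
      exp_sub_sub_pow, mul_pow, nome_pow, Bool.true_eq_false, add_zero, zero_add, neg_zero,
      zero_mul, mul_zero, sub_zero, zero_sub]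
    push_cast
    simp only [q1, q2, q3, q4, q5, q6, k1, k2, k3, k4, exp_sub_pow]
    generalize zOf D u ^ (m : ℕ) = Z at *
    generalize zOf D u' ^ (m : ℕ) = Z' at *
    generalize qp D 1 - (qp D 1)⁻¹ = c at *
    field_simp
    ring

/-- As for E, with [(r-k)m] = q^(km)[rm] - q^(rm)[km]: the pole at [km] cancels again, but now [rm]
remains, so the period is r, and the sign is opposite. -/
theorem oscillators_F (D : Params) (hk : 0 < D.k) (hr : (D.k : ℝ) < D.r) (hq : D.lq.re < 0)
    (ε ε' : Bool) (u u' : ℂ) (m : ℕ+) :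
    ∑ j, contr D (fieldF D ε u) (fieldF D ε' u') (j, m) =
      pairCoeff D D.r (-1) ε ε' (u' - u) m := by
  have hm : ((m : ℕ) : ℂ) ≠ 0 := by exact_mod_cast m.ne_zero
  have n4 := qp_one_sub_ne_zero D hq
  have z1 : zOf D u ^ (m : ℕ) ≠ 0 := pow_ne_zero _ (Complex.exp_ne_zero _)
  have z2 : zOf D u' ^ (m : ℕ) ≠ 0 := pow_ne_zero _ (Complex.exp_ne_zero _)
  obtain ⟨g, K, R, ⟨g0, K0, R0⟩, ⟨m1, m2, m3, m4, m5⟩, ⟨q1, q2, q3, q4, q5, q6⟩,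
    ⟨k1, k2, k3, k4⟩⟩ := exists_exponents D hk hr hq m
  have m5' : 1 - R ^ 2 * K ^ 4 ≠ 0 := fun h => m5 (by linear_combination -h)
  have m7 : K ^ 4 * R ^ 2 - 1 ≠ 0 := fun h => m5 (by linear_combination h)
  have m7' : 1 - K ^ 4 * R ^ 2 ≠ 0 := fun h => m5 (by linear_combination -h)
  cases ε <;> cases ε' <;>
  · rw [Fin.sum_univ_three]
    simp only [contr, fieldF, if_true, if_false, Bool.false_eq_true, curF, Pi.add_apply,
      Pi.sub_apply, Pi.neg_apply, phi_pos D hq, phi_neg D hq, phi0'_pos D hq, phi0'_neg D hq,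
      phiP_pos, phiP_neg, phiM_pos, phiM_neg, comm_zero, comm_one, comm_two, br_eq,
      phi_of_ne D _ _ _ (show (0 : Fin 3) ≠ 2 by decide),
      phi_of_ne D _ _ _ (show (1 : Fin 3) ≠ 2 by decide),
      phi0'_of_ne D _ _ (show (1 : Fin 3) ≠ 0 by decide),
      phi0'_of_ne D _ _ (show (2 : Fin 3) ≠ 0 by decide),
      phiP_of_ne D _ _ (show (0 : Fin 3) ≠ 2 by decide),
      phiP_of_ne D _ _ (show (1 : Fin 3) ≠ 2 by decide),
      phiP_of_ne D _ _ (show (0 : Fin 3) ≠ 1 by decide),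
      phiP_of_ne D _ _ (show (2 : Fin 3) ≠ 1 by decide),
      phiM_of_ne D _ _ (show (0 : Fin 3) ≠ 2 by decide),
      phiM_of_ne D _ _ (show (1 : Fin 3) ≠ 2 by decide),
      phiM_of_ne D _ _ (show (0 : Fin 3) ≠ 1 by decide),
      phiM_of_ne D _ _ (show (2 : Fin 3) ≠ 1 by decide),
      pairCoeff, pairNum, pairDen, sub_neg_eq_add, ← sub_eq_add_neg, exp_sub_add_pow,
      exp_sub_sub_pow, mul_pow, nome_pow, Bool.true_eq_false, add_zero, zero_add, neg_zero,
      zero_mul, mul_zero, sub_zero, zero_sub]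
    push_cast
    simp only [q1, q2, q3, q4, q5, q6, k1, k2, k3, k4, exp_sub_pow]
    generalize zOf D u ^ (m : ℕ) = Z at *
    generalize zOf D u' ^ (m : ℕ) = Z' at *
    generalize qp D 1 - (qp D 1)⁻¹ = c at *
    field_simp
    ring

/-- The bare φ₁ contraction is (q^(2m) - q^(-2m))/(m(1 - p^m)) times (z'/z)^m, without the factor
p^m present for E. It matches the pattern (true, false) of `pairCoeff`, which is why `fieldS` labels
its two exponents the other way round. -/
theorem oscillators_S (D : Params) (hk : 0 < D.k) (hr : (D.k : ℝ) < D.r) (hq : D.lq.re < 0)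
    (ε ε' : Bool) (u u' : ℂ) (m : ℕ+) :
    ∑ j, contr D (fieldS D ε u) (fieldS D ε' u') (j, m) =
      pairCoeff D (D.k + 2) 1 ε ε' (u' - u) m := by
  have hm : ((m : ℕ) : ℂ) ≠ 0 := by exact_mod_cast m.ne_zero
  have n4 := qp_one_sub_ne_zero D hq
  have z1 : zOf D u ^ (m : ℕ) ≠ 0 := pow_ne_zero _ (Complex.exp_ne_zero _)
  have z2 : zOf D u' ^ (m : ℕ) ≠ 0 := pow_ne_zero _ (Complex.exp_ne_zero _)
  obtain ⟨g, K, R, ⟨g0, K0, R0⟩, ⟨m1, m2, m3, m4, m5⟩, ⟨q1, q2, q3, q4, q5, q6⟩,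
    ⟨k1, k2, k3, k4⟩⟩ := exists_exponents D hk hr hq m
  have m4' : 1 - K ^ 4 * g ^ 4 ≠ 0 := fun h => m4 (by linear_combination -h)
  cases ε <;> cases ε' <;>
  · rw [Fin.sum_univ_three]
    simp only [contr, fieldS, if_true, if_false, Bool.false_eq_true, curS, Pi.add_apply,
      Pi.sub_apply, Pi.neg_apply, phi_pos D hq, phi_neg D hq,
      phiP_pos, phiP_neg, phiM_pos, phiM_neg, comm_zero, comm_one, comm_two, br_eq,
      phi_of_ne D _ _ _ (show (0 : Fin 3) ≠ 1 by decide),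
      phi_of_ne D _ _ _ (show (2 : Fin 3) ≠ 1 by decide),
      phiP_of_ne D _ _ (show (0 : Fin 3) ≠ 2 by decide),
      phiP_of_ne D _ _ (show (1 : Fin 3) ≠ 2 by decide),
      phiP_of_ne D _ _ (show (0 : Fin 3) ≠ 1 by decide),
      phiP_of_ne D _ _ (show (2 : Fin 3) ≠ 1 by decide),
      phiM_of_ne D _ _ (show (0 : Fin 3) ≠ 2 by decide),
      phiM_of_ne D _ _ (show (1 : Fin 3) ≠ 2 by decide),
      phiM_of_ne D _ _ (show (0 : Fin 3) ≠ 1 by decide),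
      phiM_of_ne D _ _ (show (2 : Fin 3) ≠ 1 by decide),
      pairCoeff, pairNum, pairDen, sub_neg_eq_add, ← sub_eq_add_neg, exp_sub_add_pow,
      exp_sub_sub_pow, mul_pow, nome_pow, Bool.true_eq_false, add_zero, zero_add, neg_zero,
      zero_mul, mul_zero, sub_zero, zero_sub]
    push_cast
    simp only [q1, q2, q3, q4, q5, q6, k1, k2, k3, k4, exp_sub_pow]
    generalize zOf D u ^ (m : ℕ) = Z at *
    generalize zOf D u' ^ (m : ℕ) = Z' at *
    generalize qp D 1 - (qp D 1)⁻¹ = c at *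
    field_simp
    ring

end
end QCoset

/-! ### Zero modes and the three vertex pairs -/

namespace QCoset
noncomputable section

theorem ofReal_sqrt_sq {x : ℝ} (hx : 0 ≤ x) : ((Real.sqrt x : ℝ) : ℂ) ^ 2 = x := by
  rw [← Complex.ofReal_pow, Real.sq_sqrt hx]

theorem ofReal_sqrt_mul_sqrt {x y z : ℝ} (hx : 0 ≤ x) (hz : 0 ≤ z) (h : x * y = z ^ 2) :
    ((Real.sqrt x : ℝ) : ℂ) * ((Real.sqrt y : ℝ) : ℂ) = z := by
  rw [← Complex.ofReal_mul, ← Real.sqrt_mul hx, h, Real.sqrt_sq hz]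

theorem momShift_fieldE (D : Params) (hk : 0 < D.k) (ε : Bool) (u : ℂ) :
    momShift D (fieldE D ε u) =
      ![-(((Real.sqrt (2 * D.k * D.r / (D.r - D.k)) : ℝ) : ℂ) / D.k), 0, -2] := by
  have hk' : (D.k : ℂ) ≠ 0 := by exact_mod_cast hk.ne'
  have hI := Complex.I_mul_I
  funext j
  cases ε <;> fin_cases j <;>
    simp [momShift, fieldE, curE, phi, phi0, phiP, phiM, zcomm] <;> field_simp <;>
    simp

theorem momShift_fieldF (D : Params) (hk : 0 < D.k) (ε : Bool) (u : ℂ) :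
    momShift D (fieldF D ε u) =
      ![((Real.sqrt (2 * D.k * (D.r - D.k) / D.r) : ℝ) : ℂ) / D.k, 0, 2] := by
  have hk' : (D.k : ℂ) ≠ 0 := by exact_mod_cast hk.ne'
  funext j
  cases ε <;> fin_cases j <;>
    simp [momShift, fieldF, curF, phi, phi0', phiP, phiM, zcomm] <;> field_simp <;>
    simp

theorem momShift_fieldS (D : Params) (ε : Bool) (u : ℂ) :
    momShift D (fieldS D ε u) = ![0, -2, 0] := by
  have hk' : (D.k : ℂ) + 2 ≠ 0 := by exact_mod_cast (Nat.succ_ne_zero (D.k + 1))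
  funext j
  cases ε <;> fin_cases j <;>
    simp [momShift, fieldS, curS, phi, phiP, phiM, zcomm] <;> field_simp

theorem shift_E (D : Params) : (curE D).shift D = momShift D (fieldE D true 0) := rfl

theorem shift_F (D : Params) : (curF D).shift D = momShift D (fieldF D true 0) := rfl

theorem shift_S (D : Params) : (curS D).shift D = momShift D (fieldS D false 0) := rfl

/-- The vertex operators of `E(z)`. -/
def vertexE (D : Params) (hk : 0 < D.k) (hr : (D.k : ℝ) < D.r) (hq : D.lq.re < 0) :
    VertexPair D where
  s := D.r - D.k
  pos := sub_pos.mpr hr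
  η := 1
  sign := Or.inl rfl
  field := fieldE D
  δ := (curE D).shift D
  analytic ε m := by
    have h := Current.differentiable_E D m
    cases ε
    · exact h.2.differentiableOn.analyticOnNhd isOpen_univ
    · exact h.1.differentiableOn.analyticOnNhd isOpen_univ
  shift ε u := by rw [shift_E, momShift_fieldE D hk, momShift_fieldE D hk]
  zeroMode ε u := by
    have hk' : (D.k : ℂ) ≠ 0 := by exact_mod_cast hk.ne'
    have hd : (D.r : ℂ) - D.k ≠ 0 := by exact_mod_cast (sub_pos.mpr hr).ne'
    -- Only the square of the root enters: P₀ and P₂ contribute (4u log q / k)(r/(r-k) - 1) = 4u log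
    -- q/(r-k).
    have hs := ofReal_sqrt_sq (x := 2 * D.k * D.r / (D.r - D.k))
      (div_nonneg (by have := hr.le; have : (0 : ℝ) ≤ D.k := D.k.cast_nonneg; nlinarith)
        (sub_pos.mpr hr).le)
    rw [shift_E, momShift_fieldE D hk, Fin.sum_univ_three]
    cases ε <;>
    · simp only [fieldE, if_true, if_false, Bool.false_eq_true, curE, phi, phi0, phiP, phiM,
        Pi.add_apply, Pi.sub_apply, Pi.neg_apply, logz, sgn]
      generalize ((Real.sqrt (2 * D.k * D.r / (D.r - D.k)) : ℝ) : ℂ) = a at *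
      simp only [Matrix.cons_val_zero, Matrix.cons_val_one, Matrix.cons_val, Fin.isValue,
        Fin.reduceEq, if_true, if_false, one_mul, mul_one, mul_zero, add_zero]
      push_cast at hs ⊢
      field_simp at hs ⊢
      linear_combination 2 * u * D.lq * hs
  oscillators := by
    intro ε ε' u u' m
    exact oscillators_E D hk hr hq ε ε' u u' m

/-- The vertex operators of `F(z)`. -/
def vertexF (D : Params) (hk : 0 < D.k) (hr : (D.k : ℝ) < D.r) (hq : D.lq.re < 0) :
    VertexPair D where
  s := D.r
  pos := (Nat.cast_nonneg _).trans_lt hr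
  η := -1
  sign := Or.inr rfl
  field := fieldF D
  δ := (curF D).shift D
  analytic ε m := by
    have h := Current.differentiable_F D m
    cases ε
    · exact h.2.differentiableOn.analyticOnNhd isOpen_univ
    · exact h.1.differentiableOn.analyticOnNhd isOpen_univ
  shift ε u := by rw [shift_F, momShift_fieldF D hk, momShift_fieldF D hk]
  zeroMode ε u := by
    have hk' : (D.k : ℂ) ≠ 0 := by exact_mod_cast hk.ne'
    have hr0 : 0 < D.r := (Nat.cast_nonneg _).trans_lt hr
    have hd : (D.r : ℂ) ≠ 0 := by exact_mod_cast hr0.ne'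
    have hs := ofReal_sqrt_sq (x := 2 * D.k * (D.r - D.k) / D.r)
      (div_nonneg (mul_nonneg (by positivity) (sub_pos.mpr hr).le) hr0.le)
    rw [shift_F, momShift_fieldF D hk, Fin.sum_univ_three]
    cases ε <;>
    · simp only [fieldF, if_true, if_false, Bool.false_eq_true, curF, phi, phi0', phiP, phiM,
        Pi.add_apply, Pi.sub_apply, Pi.neg_apply, logz, sgn]
      generalize ((Real.sqrt (2 * D.k * (D.r - D.k) / D.r) : ℝ) : ℂ) = a at *
      simp only [Matrix.cons_val_zero, Matrix.cons_val_one, Matrix.cons_val, Fin.isValue,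
        Fin.reduceEq, if_true, if_false, one_mul, mul_one, mul_zero, add_zero]
      push_cast at hs ⊢
      field_simp at hs ⊢
      linear_combination 2 * u * D.lq * hs
  oscillators := by
    intro ε ε' u u' m
    exact oscillators_F D hk hr hq ε ε' u u' m

/-- The vertex operators of `S(z)`. -/
def vertexS (D : Params) (hk : 0 < D.k) (hr : (D.k : ℝ) < D.r) (hq : D.lq.re < 0) :
    VertexPair D where
  s := D.k + 2
  pos := by positivity
  η := 1
  sign := Or.inl rfl
  field := fieldS D
  δ := (curS D).shift D
  analytic ε m := by
    have h := Current.differentiable_S D m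
    cases ε
    · exact h.1.differentiableOn.analyticOnNhd isOpen_univ
    · exact h.2.differentiableOn.analyticOnNhd isOpen_univ
  shift ε u := by rw [shift_S, momShift_fieldS, momShift_fieldS]
  zeroMode ε u := by
    have hk' : (D.k : ℂ) + 2 ≠ 0 := by exact_mod_cast (Nat.succ_ne_zero (D.k + 1))
    rw [shift_S, momShift_fieldS, Fin.sum_univ_three]
    cases ε <;>
    · simp only [fieldS, if_true, if_false, Bool.false_eq_true, curS, phi, phiP, phiM,
        Pi.add_apply, Pi.sub_apply, Pi.neg_apply, logz, sgn]
      simp only [Matrix.cons_val_zero, Matrix.cons_val_one, Matrix.cons_val, Fin.isValue,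
        Fin.reduceEq, if_true, if_false, one_mul, mul_one, mul_zero, add_zero, zero_add]
      push_cast
      field_simp
      ring
  oscillators := by
    intro ε ε' u u' m
    exact oscillators_S D hk hr hq ε ε' u u' m

/-- The coefficients of the two exponentials in a current. -/
def signCoeff (a : ℂ) (ε : Bool) : ℂ := if ε then a else -a

theorem act_E (D : Params) (u : ℂ) (p : Mom) (v : Fock) : (curE D).act D u p v =
    ∑ ε, signCoeff (curE D).coef ε • vop D (fieldE D ε u) p v := by
  rw [Fintype.sum_bool]
  simp [Current.act, signCoeff, fieldE, sub_eq_add_neg]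

theorem act_F (D : Params) (u : ℂ) (p : Mom) (v : Fock) : (curF D).act D u p v =
    ∑ ε, signCoeff (curF D).coef ε • vop D (fieldF D ε u) p v := by
  rw [Fintype.sum_bool]
  simp [Current.act, signCoeff, fieldF, sub_eq_add_neg]

/-- The coefficient changes sign because the labels of the two exponents of S are exchanged. -/
theorem act_S (D : Params) (u : ℂ) (p : Mom) (v : Fock) : (curS D).act D u p v =
    ∑ ε, signCoeff (-(curS D).coef) ε • vop D (fieldS D ε u) p v := by
  rw [Fintype.sum_bool]
  simp [Current.act, signCoeff, fieldS, sub_eq_add_neg, add_comm]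

/-- The two square roots multiply to 2r, so one E changes Π̂ by -2r/k + 2(r-k)/k = -2. -/
theorem piPlus_add_shift (D : Params) (hk : 0 < D.k) (hr : (D.k : ℝ) < D.r) (p : Mom) (m : ℕ) :
    piPlus D (p + m • (curE D).shift D) = piPlus D p - 2 * m := by
  have hk0 : (0 : ℝ) < D.k := by exact_mod_cast hk
  have hk' : (D.k : ℂ) ≠ 0 := by exact_mod_cast hk.ne'
  have hd := sub_pos.mpr hr
  have hr0 : 0 < D.r := hk0.trans hr
  have h := ofReal_sqrt_mul_sqrt (x := 2 * D.r * (D.r - D.k) / D.k)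
    (y := 2 * D.k * D.r / (D.r - D.k)) (z := 2 * D.r) (by positivity) (by positivity)
    (by field_simp)
  unfold piPlus
  rw [shift_E, momShift_fieldE D hk]
  simp only [Pi.add_apply, Pi.smul_apply]
  simp only [nsmul_eq_mul, Matrix.cons_val_zero, Matrix.cons_val]
  generalize ((Real.sqrt (2 * D.k * D.r / (D.r - D.k)) : ℝ) : ℂ) = a at *
  generalize ((Real.sqrt (2 * D.r * (D.r - D.k) / D.k) : ℝ) : ℂ) = b at *
  push_cast at h ⊢
  field_simp
  linear_combination -(m : ℂ) * h

/-- Here the roots multiply to 2(r-k), and the change is 2(r-k)/k - 2r/k = -2. -/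
theorem piMinus_add_shift (D : Params) (hk : 0 < D.k) (hr : (D.k : ℝ) < D.r) (p : Mom) (m : ℕ) :
    piMinus D (p + m • (curF D).shift D) = piMinus D p - 2 * m := by
  have hk0 : (0 : ℝ) < D.k := by exact_mod_cast hk
  have hk' : (D.k : ℂ) ≠ 0 := by exact_mod_cast hk.ne'
  have hd := sub_pos.mpr hr
  have hr0 : 0 < D.r := hk0.trans hr
  have h := ofReal_sqrt_mul_sqrt (x := 2 * D.r * (D.r - D.k) / D.k)
    (y := 2 * D.k * (D.r - D.k) / D.r) (z := 2 * (D.r - D.k)) (by positivity) (by positivity)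
    (by field_simp)
  unfold piMinus
  rw [shift_F, momShift_fieldF D hk]
  simp only [Pi.add_apply, Pi.smul_apply]
  simp only [nsmul_eq_mul, Matrix.cons_val_zero, Matrix.cons_val]
  generalize ((Real.sqrt (2 * D.k * (D.r - D.k) / D.r) : ℝ) : ℂ) = a at *
  generalize ((Real.sqrt (2 * D.r * (D.r - D.k) / D.k) : ℝ) : ℂ) = b at *
  push_cast at h ⊢
  field_simp
  linear_combination (m : ℂ) * h

theorem one_add_shift_S (D : Params) (p : Mom) (m : ℕ) :
    (p + m • (curS D).shift D) 1 = p 1 - 2 * m := by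
  rw [shift_S, momShift_fieldS]
  simp only [Pi.add_apply, Pi.smul_apply]
  simp only [nsmul_eq_mul, Matrix.cons_val_one, Matrix.cons_val_zero]
  ring

end
end QCoset

/-! ### Screening operators and their integrands as vertex pairs -/

namespace QCoset
noncomputable section

open MeasureTheory

theorem contourInt_congr (D : Params) {n : ℕ} {f g : (Fin n → ℂ) → ℂ}
    (h : ∀ θ : Fin n → ℝ, f (torusPt D θ) = g (torusPt D θ)) : contourInt D f = contourInt D g := by
  unfold contourInt
  congr 1
  exact integral_congr_ae (Filter.Eventually.of_forall fun θ => h θ)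

theorem reverse_ofFn {α : Type*} {n : ℕ} (f : Fin n → α) :
    (List.ofFn f).reverse = List.ofFn fun i => f (Fin.rev i) := by
  refine List.ext_getElem (by simp) fun i h1 h2 => ?_
  simp only [List.getElem_reverse, List.getElem_ofFn, List.length_ofFn]
  congr 1
  ext
  simp [Fin.val_rev]
  omega

/-- The coefficients in the integrand of a screening operator. -/
def screeningCoeff (D : Params) (s : ℝ) (η : ℂ) (π : Mom → ℂ) (c : Bool → ℂ) (u : ℂ) (ε : Bool)
    (p : Mom) : ℂ :=
  th D s (u - η / 2 + η * π p) / th D s (u - η / 2) * c ε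

theorem continuous_screeningCoeff (D : Params) (hq : D.lq.re < 0) {s : ℝ} (hs : 0 < s)
    (hg : Generic s) {η : ℂ} (hη : η = 1 ∨ η = -1) (π : Mom → ℂ) (c : Bool → ℂ) (ε : Bool) (p : Mom) :
    Continuous fun θ : ℝ => screeningCoeff D s η π c (uOf D θ) ε p := by
  have hc := (th_differentiable D hq hs).continuous
  have hu := continuous_uOf D
  unfold screeningCoeff
  exact ((hc.comp ((hu.sub continuous_const).add continuous_const)).div
    (hc.comp (hu.sub continuous_const)) fun θ => hg.th_half_ne_zero D hq hs hη θ).mul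
    continuous_const

namespace VertexPair

variable {D : Params} (V : VertexPair D)

/-- The points at which the products of vertex operators converge. -/
def Converges {n : ℕ} (t : Fin n → ℂ) : Prop :=
  ∀ i j, i < j → ‖Complex.exp (2 * (D.lq * (t j - t i + V.η)))‖ < 1

theorem opProd_op (hq : D.lq.re < 0) {n : ℕ} {t : Fin n → ℂ} (ht : V.Converges t)
    (sc : ℂ → Bool → Mom → ℂ) (p : Mom) (v : Fock) :
    OpProdConverges V.δ p v (List.ofFn fun i => V.op sc (t i)) ∧
      opProd V.δ p v (List.ofFn fun i => V.op sc (t i)) = V.prod sc p v t :=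
  opProd_ofFn D V.δ p v (fun i => sc (t i)) (fun i ε => V.field ε (t i)) (fun i ε => V.shift ε _)
    fun i j hij ε ε' => V.contractible hq ε ε' _ _ (ht i j hij)

theorem coeff_prod_const (hq : D.lq.re < 0) {n : ℕ} {t : Fin n → ℂ} (ht : V.Converges t)
    (c : Bool → ℂ) (p : Mom) (v : Fock) (w : Idx →₀ ℕ) :
    MvPowerSeries.coeff w (V.prod (fun _ ε _ => c ε) p v t) = V.kernel c p v w t := by
  unfold prod prodFormula kernel prodScalar
  rw [map_sum]
  refine Finset.sum_congr rfl fun ε _ => ?_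
  rw [MvPowerSeries.coeff_smul]
  congr 2
  exact Finset.prod_congr rfl fun i _ => Finset.prod_congr rfl fun j hj =>
    V.contraction_eq hq _ _ _ _ (ht i j (Finset.mem_Ioi.mp hj))

/-- Each operator to the right lowers π by 2. The resulting theta factors depend on the position but
not on the labels, hence come out of the sum over labels. -/
theorem coeff_prod_screening (hq : D.lq.re < 0) {n : ℕ} {t : Fin n → ℂ} (ht : V.Converges t)
    (π : Mom → ℂ) (hπ : ∀ (p : Mom) (m : ℕ), π (p + m • V.δ) = π p - 2 * m)
    (c : Bool → ℂ) (p : Mom) (v : Fock) (w : Idx →₀ ℕ) :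
    MvPowerSeries.coeff w (V.prod (screeningCoeff D V.s V.η π c) p v t) =
      thetaRatio D V.s V.η (π p) t * V.kernel c p v w t := by
  rw [← V.coeff_prod_const hq ht]
  unfold prod prodFormula prodScalar
  rw [map_sum, map_sum, Finset.mul_sum]
  refine Finset.sum_congr rfl fun ε _ => ?_
  rw [MvPowerSeries.coeff_smul, MvPowerSeries.coeff_smul, ← mul_assoc, ← mul_assoc]
  congr 2
  unfold screeningCoeff thetaRatio
  rw [Finset.prod_mul_distrib]
  congr 1
  exact Finset.prod_congr rfl fun i _ => by rw [hπ]

theorem converges_torus (hq : D.lq.re < 0) (hη : V.η = 1) {n : ℕ} (θ : Fin n → ℝ) :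
    V.Converges (torusPt D θ) := fun i j _ => by
  rw [hη]
  exact norm_exp_lq_lt D hq _ _

/-- The powers of a screening operator. -/
theorem opPow_screening (hq : D.lq.re < 0) (hη : V.η = 1) (hg : Generic V.s)
    (π : Mom → ℂ) (hπ : ∀ (p : Mom) (m : ℕ), π (p + m • V.δ) = π p - 2 * m)
    (c : Bool → ℂ) (n : ℕ) (p : Mom) (v : Fock) :
    OpPowConverges V.δ (opInt D (V.op (screeningCoeff D V.s V.η π c))) n p v ∧ ∀ w,
      MvPowerSeries.coeff w
          (opPow V.δ (opInt D (V.op (screeningCoeff D V.s V.η π c))) n p v) =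
        prefactor D V.s n * contourInt D fun t : Fin n → ℂ => V.kernel c p v w t *
          thetaCross D V.s V.η t * thetaSym D V.s V.η (π p) t := by
  obtain ⟨h1, h2⟩ := V.opPow_opInt hq hη _
    (continuous_screeningCoeff D hq V.pos hg V.sign π c) n p v
  refine ⟨h1, fun w => ?_⟩
  rw [h2, ← V.contourInt_symmetrize hq hg]
  exact contourInt_congr D fun θ => V.coeff_prod_screening hq (V.converges_torus hq hη θ) π hπ c p v w

/-- The products of the current on the torus, in the descending order. -/
theorem opProd_reverse (hq : D.lq.re < 0) (hη : V.η = 1) (c : Bool → ℂ) (p : Mom) (v : Fock)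
    {n : ℕ} (θ : Fin n → ℝ) :
    OpProdConverges V.δ p v
        (List.ofFn fun i => V.op (fun _ ε _ => c ε) (torusPt D θ i)).reverse ∧
      ∀ w, MvPowerSeries.coeff w (opProd V.δ p v
        (List.ofFn fun i => V.op (fun _ ε _ => c ε) (torusPt D θ i)).reverse) =
          V.kernel c p v w (torusPt D fun i => θ (Fin.rev i)) := by
  rw [reverse_ofFn]
  have ht := V.converges_torus hq hη fun i => θ (Fin.rev i)
  obtain ⟨h1, h2⟩ := V.opProd_op hq ht (fun _ ε _ => c ε) p v
  refine ⟨h1, fun w => ?_⟩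
  rw [← V.coeff_prod_const hq ht, ← h2]
  rfl

theorem analyticAt_kernel (hq : D.lq.re < 0) (c : Bool → ℂ) (p : Mom) (v : Fock) (w : Idx →₀ ℕ)
    {n : ℕ} (t : Fin n → ℂ) (ht : ∀ i j, i < j →
      poch (nome D V.s) (Complex.exp (2 * (D.lq * (t j - t i + V.η)))) ≠ 0) :
    AnalyticAt ℂ (V.kernel c p v w) t := by
  have hp : ∀ i : Fin n, AnalyticAt ℂ (fun t : Fin n → ℂ => t i) t := fun i =>
    (ContinuousLinearMap.proj (R := ℂ) (φ := fun _ : Fin n => ℂ) i).analyticAt t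
  unfold kernel
  refine Finset.analyticAt_fun_sum _ fun ε _ => (analyticAt_const.mul
    (Finset.analyticAt_fun_prod _ fun i _ => Finset.analyticAt_fun_prod _ fun j hj => ?_)).mul
    (analyticAt_coeff_vop D (fun t : Fin n → ℂ => ∑ i, V.field (ε i) (t i)) t
      (V.analyticAt_sum_field ε t) p v w)
  exact analyticAt_pairFactor D hq V.pos V.η (ε i) (ε j) (fun t : Fin n → ℂ => t i)
    (fun t => t j) t (hp i) (hp j) (ht i j (Finset.mem_Ioi.mp hj))

end VertexPair

theorem analyticAt_thetaRatio (D : Params) (hq : D.lq.re < 0) {s : ℝ} (hs : 0 < s) (η π0 : ℂ)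
    {n : ℕ} (t : Fin n → ℂ) (ht : ∀ i, th D s (t i - η / 2) ≠ 0) :
    AnalyticAt ℂ (fun t : Fin n → ℂ => thetaRatio D s η π0 t) t := by
  have hp : ∀ i : Fin n, AnalyticAt ℂ (fun t : Fin n → ℂ => t i) t := fun i =>
    (ContinuousLinearMap.proj (R := ℂ) (φ := fun _ : Fin n => ℂ) i).analyticAt t
  have hc : ∀ (f : (Fin n → ℂ) → ℂ), AnalyticAt ℂ f t → AnalyticAt ℂ (fun t => th D s (f t)) t :=
    fun f hf => AnalyticAt.comp (g := th D s) (f := f)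
      ((th_differentiable D hq hs).analyticAt _) hf
  exact Finset.analyticAt_fun_prod _ fun i _ =>
    (hc _ (((hp i).sub analyticAt_const).add analyticAt_const)).div
      (hc _ ((hp i).sub analyticAt_const)) (ht i)

/-- Reversing the order of the variables exchanges the roles within each pair, and oddness turns the
shift +1 into -1. -/
theorem thetaCross_rev (D : Params) (hq : D.lq.re < 0) {s : ℝ} (hs : 0 < s) {n : ℕ}
    (u : Fin n → ℂ) : thetaCross D s 1 (fun i => u (Fin.rev i)) = crossFactor D s u := by
  unfold thetaCross crossFactor
  rw [prod_pairs_rev fun i j : Fin n => th D s (u i - u j) / th D s (u i - u j + 1)]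
  refine Finset.prod_congr rfl fun i _ => Finset.prod_congr rfl fun j _ => ?_
  rw [← neg_sub (u i), th_odd D hq hs, show -(u i - u j) + 1 = -(u i - u j - 1) by ring,
    th_odd D hq hs, neg_div_neg_eq]

theorem thetaSym_rev (D : Params) (s : ℝ) (π0 : ℂ) {n : ℕ} (u : Fin n → ℂ) :
    thetaSym D s 1 π0 (fun i => u (Fin.rev i)) =
      ∏ i, th D s (u i + 1 / 2 + π0 - n) / th D s (u i - 1 / 2) := by
  unfold thetaSym
  refine (Equiv.prod_comp Fin.revPerm fun i : Fin n =>
    th D s (u i + 1 / 2 + 1 * π0 - 1 * n) / th D s (u i - 1 / 2)).trans ?_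
  simp only [one_mul]

theorem generic_level (k : ℕ) : Generic ((k : ℝ) + 2) := by
  intro m h
  have h1 : m * ((k : ℤ) + 2) = 1 := by exact_mod_cast h
  have := Int.eq_one_or_neg_one_of_mul_eq_one' h1
  omega

theorem generic_of_one_lt {r : ℝ} (hr : 1 < r) : Generic r := by
  intro m h
  rcases le_or_gt m 0 with hm | hm
  · have : (m : ℝ) ≤ 0 := by exact_mod_cast hm
    nlinarith
  · have : (1 : ℝ) ≤ m := by exact_mod_cast hm
    nlinarith

section currents

variable (D : Params) (hk : 0 < D.k) (hr : (D.k : ℝ) < D.r) (hq : D.lq.re < 0)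

theorem act_E_eq_op (u : ℂ) : (curE D).act D u =
    (vertexE D hk hr hq).op (fun _ ε _ => signCoeff (curE D).coef ε) u := by
  funext p v
  exact act_E D u p v

theorem act_F_eq_op (u : ℂ) : (curF D).act D u =
    (vertexF D hk hr hq).op (fun _ ε _ => signCoeff (curF D).coef ε) u := by
  funext p v
  exact act_F D u p v

theorem act_S_eq_op (u : ℂ) : (curS D).act D u =
    (vertexS D hk hr hq).op (fun _ ε _ => signCoeff (-(curS D).coef) ε) u := by
  funext p v
  exact act_S D u p v

theorem integrandPlus_eq_op : integrandPlus D = (vertexE D hk hr hq).op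
    (screeningCoeff D (D.r - D.k) 1 (piPlus D) (signCoeff (curE D).coef)) := by
  funext u p v
  unfold integrandPlus VertexPair.op opOf screeningCoeff
  rw [act_E, Finset.smul_sum, one_mul]
  exact Finset.sum_congr rfl fun ε _ => smul_smul _ _ _

theorem integrandS_eq_op : integrandS D = (vertexS D hk hr hq).op
    (screeningCoeff D (D.k + 2) 1 (fun p => p 1) (signCoeff (-(curS D).coef))) := by
  funext u p v
  unfold integrandS VertexPair.op opOf screeningCoeff
  rw [act_S, Finset.smul_sum, one_mul]
  exact Finset.sum_congr rfl fun ε _ => smul_smul _ _ _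

theorem integrandMinus_eq_op : integrandMinus D = (vertexF D hk hr hq).op
    (screeningCoeff D D.r (-1) (piMinus D) (signCoeff (curF D).coef)) := by
  funext u p v
  unfold integrandMinus VertexPair.op opOf screeningCoeff
  rw [act_F, Finset.smul_sum, show u - -1 / 2 = u + 1 / 2 by ring, neg_one_mul, ← sub_eq_add_neg]
  exact Finset.sum_congr rfl fun ε _ => smul_smul _ _ _

theorem formulaPlus_torus (n : ℕ) (p : Mom) (v : Fock) (w : Idx →₀ ℕ) (θ : Fin n → ℝ) :
    formulaPlus D n p v w (torusPt D θ) =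
      (vertexE D hk hr hq).kernel (signCoeff (curE D).coef) p v w
          (torusPt D fun i => θ (Fin.rev i)) *
        thetaCross D (D.r - D.k) 1 (torusPt D fun i => θ (Fin.rev i)) *
        thetaSym D (D.r - D.k) 1 (piPlus D p) (torusPt D fun i => θ (Fin.rev i)) := by
  have h := ((vertexE D hk hr hq).opProd_reverse hq rfl (signCoeff (curE D).coef) p v θ).2 w
  have h1 := thetaCross_rev D hq (sub_pos.mpr hr) (torusPt D θ)
  have h2 := thetaSym_rev D (D.r - D.k) (piPlus D p) (torusPt D θ)
  unfold formulaPlus descProd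
  rw [← h1, ← h2, ← h]
  simp_rw [act_E_eq_op D hk hr hq]
  rfl

theorem formulaS_torus (n : ℕ) (p : Mom) (v : Fock) (w : Idx →₀ ℕ) (θ : Fin n → ℝ) :
    formulaS D n p v w (torusPt D θ) =
      (vertexS D hk hr hq).kernel (signCoeff (-(curS D).coef)) p v w
          (torusPt D fun i => θ (Fin.rev i)) *
        thetaCross D (D.k + 2) 1 (torusPt D fun i => θ (Fin.rev i)) *
        thetaSym D (D.k + 2) 1 (p 1) (torusPt D fun i => θ (Fin.rev i)) := by
  have h := ((vertexS D hk hr hq).opProd_reverse hq rfl (signCoeff (-(curS D).coef)) p v θ).2 w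
  have h1 := thetaCross_rev D hq (vertexS D hk hr hq).pos (torusPt D θ)
  have h2 := thetaSym_rev D (D.k + 2) (p 1) (torusPt D θ)
  unfold formulaS descProd
  rw [← h]
  simp_rw [act_S_eq_op D hk hr hq]
  refine (congrArg₂ (fun a b => _ * a * b) h1.symm h2.symm).trans ?_
  rfl

theorem formulaMinus_eq (n : ℕ) (p : Mom) (G : (Fin n → ℂ) → ℂ) (u : Fin n → ℂ) :
    formulaMinus D n p G u = G u * thetaCross D D.r (-1) u * thetaSym D D.r (-1) (piMinus D p) u := by
  unfold formulaMinus crossFactor thetaCross thetaSym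
  simp only [← sub_eq_add_neg]
  congr 1
  refine Finset.prod_congr rfl fun i _ => ?_
  congr 2 <;> ring

/-- For η = -1 the quantity whose modulus must be below 1 is z_j/(q² z_i), so nesting is exactly the
convergence condition. -/
theorem converges_of_nested {n : ℕ} {u : Fin n → ℂ} (hu : u ∈ nested D n) :
    (vertexF D hk hr hq).Converges u := by
  intro i j hij
  have h := hu i j hij
  have e : Complex.exp (2 * (D.lq * (u j - u i + -1))) =
      zOf D (u j) / (qp D 1 ^ 2 * zOf D (u i)) := by
    have hz : zOf D (u i) ≠ 0 := Complex.exp_ne_zero _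
    rw [eq_div_iff (mul_ne_zero (pow_ne_zero 2 (qp_ne_zero D 1)) hz), ← qp_nat_mul]
    unfold zOf qp
    rw [← Complex.exp_add, ← Complex.exp_add]
    congr 1
    push_cast
    ring
  change ‖Complex.exp (2 * (D.lq * (u j - u i + -1)))‖ < 1
  rw [e, norm_div, norm_mul, norm_pow, div_lt_one]
  · exact h
  · exact mul_pos (pow_pos (norm_pos_iff.mpr (qp_ne_zero D 1)) 2)
      (norm_pos_iff.mpr (Complex.exp_ne_zero _))

/-- The zeros of this denominator are p^m z_j = q² z_i with m ≥ 0, the hyperplanes removed in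
`regF`. -/
theorem poch_ne_zero_of_mem_regF {n : ℕ} {u : Fin n → ℂ} (hu : u ∈ regF D n) (i j : Fin n)
    (hij : i < j) : poch (nome D (vertexF D hk hr hq).s)
      (Complex.exp (2 * (D.lq * (u j - u i + (vertexF D hk hr hq).η)))) ≠ 0 := by
  change poch (nome D D.r) (Complex.exp (2 * (D.lq * (u j - u i + -1)))) ≠ 0
  have hP : ‖nome D D.r‖ < 1 := norm_nome_lt D hq ((Nat.cast_nonneg _).trans_lt hr)
  rw [Ne, poch_eq_zero_iff hP]
  rintro ⟨m, hm⟩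
  apply hu i j hij m
  unfold nome at hm
  rw [← Complex.exp_nat_mul, ← Complex.exp_add] at hm
  have e : zOf D (u j) = Complex.exp (m * (2 * (D.r * D.lq)) + 2 * (D.lq * (u j - u i + -1))) *
      (qp D (2 - 2 * D.r * m) * zOf D (u i)) := by
    unfold zOf qp
    rw [← Complex.exp_add, ← Complex.exp_add]
    congr 1
    ring
  rw [e, hm, one_mul]

end currents

end
end QCoset

/-! ### The formulas for the powers of Q_+, Q and Q_- -/

namespace QCoset
noncomputable section

section powers

variable (D : Params) (hk : 0 < D.k) (hr : (D.k : ℝ) < D.r) (hq : D.lq.re < 0)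
include hk hr hq

/-- The powers of `Q_+`. -/
theorem power_Qplus (hg : Generic (D.r - D.k)) (n : ℕ) (p : Mom) (v : Fock) :
    OpPowConverges ((curE D).shift D) (Qplus D) n p v ∧
      (∀ θ : Fin n → ℝ, DescProdConverges D (curE D) p v fun i => uOf D (θ i)) ∧
      ∀ w : Idx →₀ ℕ,
        ContourIntegrable D (formulaPlus D n p v w) ∧
        MvPowerSeries.coeff w (opPow ((curE D).shift D) (Qplus D) n p v) =
          prefactor D (D.r - D.k) n * contourInt D (formulaPlus D n p v w) := by
  have h := (vertexE D hk hr hq).opPow_screening hq rfl hg (piPlus D)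
    (piPlus_add_shift D hk hr) (signCoeff (curE D).coef) n p v
  have hrev : Continuous fun θ : Fin n → ℝ => fun i => θ (Fin.rev i) :=
    continuous_pi fun i => continuous_apply _
  have hQ : Qplus D = opInt D ((vertexE D hk hr hq).op (screeningCoeff D (vertexE D hk hr hq).s
      (vertexE D hk hr hq).η (piPlus D) (signCoeff (curE D).coef))) :=
    congrArg (opInt D) (integrandPlus_eq_op D hk hr hq)
  rw [hQ]
  refine ⟨h.1, fun θ => ?_, fun w => ⟨?_, (h.2 w).trans ?_⟩⟩
  · have := ((vertexE D hk hr hq).opProd_reverse hq rfl (signCoeff (curE D).coef) p v θ).1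
    unfold DescProdConverges
    simp_rw [act_E_eq_op D hk hr hq]
    exact this
  · refine contourIntegrable_of_continuous D _ ?_
    simp_rw [formulaPlus_torus D hk hr hq]
    exact ((vertexE D hk hr hq).continuous_symmetrized hq hg _ p v w _ n).comp hrev
  · refine congrArg (prefactor D (D.r - D.k) n * ·) ?_
    -- The formula has the currents in descending order and the kernel in ascending order;
    -- relabelling the integration variables reconciles them.
    rw [← contourInt_perm D _ Fin.revPerm]
    exact contourInt_congr D fun θ => (formulaPlus_torus D hk hr hq n p v w θ).symm

/-- The powers of `Q`. -/
theorem power_Qscr (n : ℕ) (p : Mom) (v : Fock) :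
    OpPowConverges ((curS D).shift D) (Qscr D) n p v ∧
      (∀ θ : Fin n → ℝ, DescProdConverges D (curS D) p v fun i => uOf D (θ i)) ∧
      ∀ w : Idx →₀ ℕ,
        ContourIntegrable D (formulaS D n p v w) ∧
        MvPowerSeries.coeff w (opPow ((curS D).shift D) (Qscr D) n p v) =
          prefactor D (D.k + 2) n * contourInt D (formulaS D n p v w) := by
  have hg := generic_level D.k
  have h := (vertexS D hk hr hq).opPow_screening hq rfl hg (fun p => p 1)
    (one_add_shift_S D) (signCoeff (-(curS D).coef)) n p v
  have hrev : Continuous fun θ : Fin n → ℝ => fun i => θ (Fin.rev i) :=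
    continuous_pi fun i => continuous_apply _
  have hQ : Qscr D = opInt D ((vertexS D hk hr hq).op (screeningCoeff D (vertexS D hk hr hq).s
      (vertexS D hk hr hq).η (fun p => p 1) (signCoeff (-(curS D).coef)))) :=
    congrArg (opInt D) (integrandS_eq_op D hk hr hq)
  rw [hQ]
  refine ⟨h.1, fun θ => ?_, fun w => ⟨?_, (h.2 w).trans ?_⟩⟩
  · have := ((vertexS D hk hr hq).opProd_reverse hq rfl (signCoeff (-(curS D).coef)) p v θ).1
    unfold DescProdConverges
    simp_rw [act_S_eq_op D hk hr hq]
    exact this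
  · refine contourIntegrable_of_continuous D _ ?_
    simp_rw [formulaS_torus D hk hr hq]
    exact ((vertexS D hk hr hq).continuous_symmetrized hq hg _ p v w _ n).comp hrev
  · refine congrArg (prefactor D (D.k + 2) n * ·) ?_
    rw [← contourInt_perm D _ Fin.revPerm]
    exact contourInt_congr D fun θ => (formulaS_torus D hk hr hq n p v w θ).symm

/-- The analytic continuation of the product of the currents `F`. -/
theorem isProduct_kernel (n : ℕ) (p : Mom) (v : Fock) (w : Idx →₀ ℕ) :
    IsProduct D ((curF D).shift D) p v ((curF D).act D) (regF D n) w
      ((vertexF D hk hr hq).kernel (signCoeff (curF D).coef) p v w) := by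
  refine ⟨fun u hu => (vertexF D hk hr hq).analyticAt_kernel hq _ p v w u
    (poch_ne_zero_of_mem_regF D hk hr hq hu), fun u hu => ?_⟩
  have ht := converges_of_nested D hk hr hq hu.1
  obtain ⟨h1, h2⟩ := (vertexF D hk hr hq).opProd_op hq ht
    (fun _ ε _ => signCoeff (curF D).coef ε) p v
  simp_rw [act_F_eq_op D hk hr hq]
  refine ⟨h1, ?_⟩
  rw [← (vertexF D hk hr hq).coeff_prod_const hq ht, ← h2]
  rfl

/-- The analytic continuation of the product of the integrands of `Q_-`. -/
theorem isProduct_integrandMinus (n : ℕ) (p : Mom) (v : Fock) (w : Idx →₀ ℕ) :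
    IsProduct D ((curF D).shift D) p v (integrandMinus D) (regMinus D n) w fun t =>
      thetaRatio D D.r (-1) (piMinus D p) t *
        (vertexF D hk hr hq).kernel (signCoeff (curF D).coef) p v w t := by
  refine ⟨fun u hu => (analyticAt_thetaRatio D hq (vertexF D hk hr hq).pos (-1) _ u
    fun i => ?_).mul ((vertexF D hk hr hq).analyticAt_kernel hq _ p v w u
      (poch_ne_zero_of_mem_regF D hk hr hq hu.1)), fun u hu => ?_⟩
  · have := hu.2 i
    rwa [show u i - -1 / 2 = u i + 1 / 2 by ring]
  · have ht := converges_of_nested D hk hr hq hu.1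
    obtain ⟨h1, h2⟩ := (vertexF D hk hr hq).opProd_op hq ht
      (screeningCoeff D D.r (-1) (piMinus D) (signCoeff (curF D).coef)) p v
    rw [integrandMinus_eq_op D hk hr hq]
    refine ⟨h1, ?_⟩
    have h3 := (vertexF D hk hr hq).coeff_prod_screening hq ht (piMinus D)
      (piMinus_add_shift D hk hr) (signCoeff (curF D).coef) p v w
    refine h3.symm.trans ?_
    exact congrArg _ h2.symm

/-- For one factor there are no pairs, so the convergence condition is empty and no continuation
takes place. -/
theorem Qminus_eq (p : Mom) (v : Fock) (w : Idx →₀ ℕ) :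
    contourInt D (fun t : Fin 1 → ℂ => thetaRatio D D.r (-1) (piMinus D p) t *
      (vertexF D hk hr hq).kernel (signCoeff (curF D).coef) p v w t) =
        MvPowerSeries.coeff w (Qminus D p v) := by
  change _ = contourInt D fun u : Fin 1 → ℂ => MvPowerSeries.coeff w (integrandMinus D (u 0) p v)
  congr 1
  funext t
  have h3 := (vertexF D hk hr hq).coeff_prod_screening hq (t := t)
    (fun i j hij => absurd hij (by rw [Subsingleton.elim i j]; exact lt_irrefl _)) (piMinus D)
      (piMinus_add_shift D hk hr) (signCoeff (curF D).coef) p v w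
  refine h3.symm.trans (congrArg _ ?_)
  rw [integrandMinus_eq_op D hk hr hq]
  unfold VertexPair.prod prodFormula VertexPair.op opOf prodScalar
  rw [← (Equiv.funUnique (Fin 1) Bool).symm.sum_comp]
  refine Finset.sum_congr rfl fun ε _ => ?_
  simp
  rfl

/-- The powers of `Q_-`. -/
theorem power_Qminus (n : ℕ) (p : Mom) (v : Fock) :
    ∃ ψ : CFock, IsMinusPower D n p v ψ ∧ (n = 1 → ψ = Qminus D p v) ∧
      ∀ w : Idx →₀ ℕ, ∃ G : (Fin n → ℂ) → ℂ,
        IsProduct D ((curF D).shift D) p v ((curF D).act D) (regF D n) w G ∧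
        ContourIntegrable D (formulaMinus D n p G) ∧
        MvPowerSeries.coeff w ψ = prefactor D D.r n * contourInt D (formulaMinus D n p G) := by
  have hk1 : (1 : ℝ) ≤ D.k := by exact_mod_cast hk
  have hg : Generic D.r := generic_of_one_lt (hk1.trans_lt hr)
  let V := vertexF D hk hr hq
  let c := signCoeff (curF D).coef
  -- The vector is defined by its matrix elements. The same kernel continues the product of the
  -- currents and, multiplied by the theta factors, the product of the integrands.
  refine ⟨fun w => contourInt D fun t : Fin n → ℂ => thetaRatio D D.r (-1) (piMinus D p) t *
    V.kernel c p v w t, fun w => ⟨_, isProduct_integrandMinus D hk hr hq n p v w, ?_, rfl⟩,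
    fun hn => ?_, fun w => ⟨V.kernel c p v w, isProduct_kernel D hk hr hq n p v w, ?_, ?_⟩⟩
  · exact contourIntegrable_of_continuous D _
      ((continuous_thetaRatio D hq V.pos hg V.sign _).mul (V.continuous_kernel hq hg c p v w))
  · subst hn
    funext w
    exact Qminus_eq D hk hr hq p v w
  · refine contourIntegrable_of_continuous D _ ?_
    simp_rw [formulaMinus_eq]
    exact V.continuous_symmetrized hq hg c p v w (piMinus D p) n
  · rw [funext (formulaMinus_eq D n p (V.kernel c p v w))]
    exact V.contourInt_symmetrize hq hg c p v w (piMinus D p) n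

end powers

end
end QCoset

open QCoset
theorem lemma5p6 (D : Params) (hk : 0 < D.k) (hr : (D.k : ℝ) < D.r) (hq : D.lq.re < 0)
    (n : ℕ) (p : Mom) (v : Fock) :
    -- the power of Q_+; the hypothesis says that [1]_{r-k}, which occurs in a denominator, is not 0
    ((∀ m : ℤ, (m : ℝ) * (D.r - D.k) ≠ 1) →
      OpPowConverges ((curE D).shift D) (Qplus D) n p v ∧
      (∀ θ : Fin n → ℝ, DescProdConverges D (curE D) p v fun i => uOf D (θ i)) ∧
      ∀ w : Idx →₀ ℕ,
        ContourIntegrable D (formulaPlus D n p v w) ∧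
        MvPowerSeries.coeff w (opPow ((curE D).shift D) (Qplus D) n p v) =
          prefactor D (D.r - D.k) n * contourInt D (formulaPlus D n p v w)) ∧
    -- the power of Q_-
    (∃ ψ : CFock, IsMinusPower D n p v ψ ∧ (n = 1 → ψ = Qminus D p v) ∧
      ∀ w : Idx →₀ ℕ, ∃ G : (Fin n → ℂ) → ℂ,
        IsProduct D ((curF D).shift D) p v ((curF D).act D) (regF D n) w G ∧
        ContourIntegrable D (formulaMinus D n p G) ∧
        MvPowerSeries.coeff w ψ = prefactor D D.r n * contourInt D (formulaMinus D n p G)) ∧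
    -- the power of Q
    (OpPowConverges ((curS D).shift D) (Qscr D) n p v ∧
      (∀ θ : Fin n → ℝ, DescProdConverges D (curS D) p v fun i => uOf D (θ i)) ∧
      ∀ w : Idx →₀ ℕ,
        ContourIntegrable D (formulaS D n p v w) ∧
        MvPowerSeries.coeff w (opPow ((curS D).shift D) (Qscr D) n p v) =
          prefactor D (D.k + 2) n * contourInt D (formulaS D n p v w)) :=
  ⟨fun hg => power_Qplus D hk hr hq hg n p v, power_Qminus D hk hr hq n p v,
    power_Qscr D hk hr hq n p v⟩
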